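/- **Theorem (Bonnet theorem for timelike surfaces in $Q^n_r$).** Let $r\ge 1$, $n-r\ge 2$. Let $\mathbb R^{n+2}_{r+1}$ be $\mathbb R^{n+2}$ with $\langle x,x\rangle=\sum_{i\le n-r+1}x_i^2-\sum_{i>n-r+1}x_i^2$, let $Q^n_r=\{[x]\in\mathbb RP^{n+1}: x\neq0,\ \langle x,x\rangle=0\}$, and let $O(n-r+1,r+1)$ be the group of linear automorphisms preserving $\langle\,,\rangle$, acting on $Q^n_r$ by $T[x]=[Tx]$. Let $M$ be a connected oriented Lorentz surface: a surface with an atlas of asymptotic coordinates $(u,v)$ whose coordinate changes are smooth, locally of the form $\tilde u=\tilde u(u)$, $\tilde v=\tilde v(v)$, with $\frac{\partial u}{\partial\tilde u}\frac{\partial v}{\partial\tilde v}=e^{2\rho}>0$. Everything below is smooth ($C^\infty$). *Conventions.* A map $y:M\to Q^n_r$ is a timelike conformal immersion if locally $y=[Y]$ with $\langle dY,dY\rangle$ a positive multiple of $du\,dv$. A canonical lift of $y$ consists of a lift $Y$ of $y$ on each coordinate domain of the atlas with $\langle dY,dY\rangle=\frac12(du\otimes dv+dv\otimes du)$, such that the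 lift for $(\tilde u,\tilde v)$ is $e^{-\rho}$ times the lift for $(u,v)$. Put $V=\mathrm{Span}\{Y,Y_u,Y_v,Y_{uv}\}$, let $V^\perp$ be its orthogonal complement (the conformal normal bundle), with normal connection $D$ given by the $V^\perp$-part of the derivative. The Hopf differentials $\kappa_1,\kappa_2$ (sections of $V^\perp$) and the Schwarzians $s_1,s_2$ of $Y$ are defined by $Y_{uu}=-\frac{s_1}2Y+\kappa_1$, $Y_{vv}=-\frac{s_2}2Y+\kappa_2$. **(a)** The differentials $\frac{du^2}{\sqrt{du\,dv}}$ and $\frac{dv^2}{\sqrt{du\,dv}}$ define real line bundles $L_1$, $L_2$ over $M$ (their transition functions are smooth, nowhere zero and satisfy the cocycle identities). **(b) Existence.** Suppose $M$ is simply connected. Let $NM$ be a subbundle of rank $n-2$ of $M\times\mathbb R^{n+2}_{r+1}$ whose induced fibre metric has signature $(n-r-1,r-1)$, let $D$ be a metric connection on $NM$ with derivatives $D_u,D_v$, let $\kappa_1\in\Gamma(NM\otimes L_1)$, $\kappa_2\in\Gamma(NM\otimes L_2)$ (written in coordinates as sections of $NM$), and let $s_1,s_2$ be functions on each coordinate domain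 transforming by $\tilde s_1=s_1(\frac{\partial u}{\partial\tilde u})^2+2\rho_{\tilde u\tilde u}-2\rho_{\tilde u}^2$, $\tilde s_2=s_2(\frac{\partial v}{\partial\tilde v})^2+2\rho_{\tilde v\tilde v}-2\rho_{\tilde v}^2$. If in all coordinates $(u,v)$ of the atlas $$\tfrac12(s_1)_v=3\langle D_u\kappa_2,\kappa_1\rangle+\langle D_u\kappa_1,\kappa_2\rangle,\qquad \tfrac12(s_2)_u=\langle\kappa_1,D_v\kappa_2\rangle+3\langle D_v\kappa_1,\kappa_2\rangle,$$ $$D_vD_v\kappa_1+\tfrac{s_2}2\kappa_1=D_uD_u\kappa_2+\tfrac{s_1}2\kappa_2,$$ $$D_vD_u\psi-D_uD_v\psi=2\langle\psi,\kappa_1\rangle\kappa_2-2\langle\psi,\kappa_2\rangle\kappa_1\quad\text{for all local sections }\psi\text{ of }NM,$$ then there is a timelike conformal immersion $y:M\to Q^n_r$ with these conformal data: for some canonical lift $Y$ of $y$ there is an isometric bundle isomorphism $NM\to V^\perp$ over $M$ that takes $D$ to the normal connection and $\kappa_1,\kappa_2$ to the Hopf differentials of $Y$, and the Schwarzians of $Y$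 are $s_1,s_2$. **(c) Uniqueness.** Let $y,\hat y:M\to Q^n_r$ be timelike conformal immersions of $M$ (which need not be simply connected) with canonical lifts $Y,\hat Y$. Assume that (i) $s_1=\hat s_1$, $s_2=\hat s_2$; (ii) there are global orthonormal frames $\{\psi_\alpha\}$, $\{\hat\psi_\alpha\}$ of the conformal normal bundles of $y$, $\hat y$, with the same signs $\langle\psi_\alpha,\psi_\alpha\rangle=\langle\hat\psi_\alpha,\hat\psi_\alpha\rangle=\pm1$, in which the two normal connections have the same coefficients; (iii) $\kappa_i=\sum_\alpha k_{i\alpha}\psi_\alpha$ and $\hat\kappa_i=\sum_\alpha k_{i\alpha}\hat\psi_\alpha$ with the same coefficients $k_{i\alpha}$, for $i=1,2$. Then there is $T\in O(n-r+1,r+1)$ with $Ty=\hat y$. -/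

import Mathlib

open scoped ContDiff LinearAlgebra.Projectivization

noncomputable section

/-! ### The pseudo-Euclidean space, the projective light cone and its conformal group -/

/-- The vector space underlying `ℝ^{n+2}_{r+1}`. -/
abbrev Ambient (n : ℕ) : Type := Fin (n + 2) → ℝ

/-- The inner product of `ℝ^{n+2}_{r+1}`: the first `n - r + 1` coordinates are positive,
the last `r + 1` coordinates are negative. -/
def ambientForm (n r : ℕ) : LinearMap.BilinForm ℝ (Ambient n) :=
  Matrix.toBilin' (Matrix.diagonal fun i : Fin (n + 2) => if (i : ℕ) + r < n + 1 then 1 else -1)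

theorem ambientForm_apply (n r : ℕ) (x z : Ambient n) :
    ambientForm n r x z = ∑ i : Fin (n + 2), (if (i : ℕ) + r < n + 1 then 1 else -1) * (x i * z i) := by
  simp only [ambientForm, Matrix.toBilin'_apply, Matrix.diagonal_apply]
  refine Finset.sum_congr rfl fun i _ => ?_
  rw [Finset.sum_eq_single i]
  · simp only [if_true]; ring
  · intro j _ hj
    simp [Ne.symm hj]
  · simp

/-- The projective light cone `Q^n_r = {[x] : x ≠ 0, ⟨x, x⟩ = 0}`. -/
def ProjLightCone (n r : ℕ) : Set (ℙ ℝ (Ambient n)) :=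
  {l | ∃ (x : Ambient n) (hx : x ≠ 0),
    ambientForm n r x x = 0 ∧ Projectivization.mk ℝ x hx = l}

/-- Membership in `O(n-r+1, r+1)`: linear automorphisms preserving the inner product. -/
def IsPseudoOrthogonal (n r : ℕ) (T : Ambient n ≃ₗ[ℝ] Ambient n) : Prop :=
  ∀ x z, ambientForm n r (T x) (T z) = ambientForm n r x z

/-- The projective transformation `[x] ↦ [T x]`. -/
def mobiusMap {n : ℕ} (T : Ambient n ≃ₗ[ℝ] Ambient n) : ℙ ℝ (Ambient n) → ℙ ℝ (Ambient n) :=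
  Projectivization.map (T : Ambient n →ₗ[ℝ] Ambient n) T.injective

/-! ### Oriented Lorentz surfaces and asymptotic coordinates -/

section Surface

variable {M : Type*} [TopologicalSpace M]

/-- A chart `p ↦ (u(p), v(p))`. -/
abbrev Chart (M : Type*) [TopologicalSpace M] : Type _ := OpenPartialHomeomorph M (ℝ × ℝ)

section Partial

variable {F : Type*} [NormedAddCommGroup F] [NormedSpace ℝ F]

/-- The derivative of `f` along the constant coordinate vector `w` of the chart `e`. -/
def coordDeriv (w : ℝ × ℝ) (e : Chart M) (f : M → F) (p : M) : F :=
  fderiv ℝ (fun x : ℝ × ℝ => f (e.symm x)) (e p) w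

/-- `∂f/∂u` in the chart `e = (u, v)`. -/
abbrev pu (e : Chart M) (f : M → F) : M → F := coordDeriv (1, 0) e f

/-- `∂f/∂v` in the chart `e = (u, v)`. -/
abbrev pv (e : Chart M) (f : M → F) : M → F := coordDeriv (0, 1) e f

/-- Smoothness on an open subset `U`, tested in all charts of the atlas. -/
def SmoothOnSurface [ChartedSpace (ℝ × ℝ) M] (U : Set M) (f : M → F) : Prop :=
  ∀ e ∈ atlas (ℝ × ℝ) M, ContDiffOn ℝ ∞ (fun x => f (e.symm x)) (e.target ∩ e.symm ⁻¹' U)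

end Partial

/-- For charts `e = (u, v)` and `e' = (ũ, ṽ)`: the function `∂u/∂ũ`. -/
def jacU (e e' : Chart M) (p : M) : ℝ := pu e' (fun q => (e q).1) p

/-- For charts `e = (u, v)` and `e' = (ũ, ṽ)`: the function `∂v/∂ṽ`. -/
def jacV (e e' : Chart M) (p : M) : ℝ := pv e' (fun q => (e q).2) p

/-- The function `ρ` with `e^{2ρ} = (∂u/∂ũ)(∂v/∂ṽ)`, that is, `du dv = e^{2ρ} dũ dṽ`. -/
def confFactor (e e' : Chart M) (p : M) : ℝ := Real.log (jacU e e' p * jacV e e' p) / 2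

/-- An oriented surface with a conformal class of Lorentzian metrics, given by an atlas of oriented
asymptotic (null) coordinates `(u, v)`, in which the metrics of the class are `e^{2ω} du dv`:
coordinate changes are smooth, of the form `ũ = ũ(u)`, `ṽ = ṽ(v)` locally,
and preserve the conformal class of `du dv`. -/
structure IsLorentzSurface (M : Type*) [TopologicalSpace M] [ChartedSpace (ℝ × ℝ) M] : Prop where
  smooth : ∀ e ∈ atlas (ℝ × ℝ) M, ∀ e' ∈ atlas (ℝ × ℝ) M,
    ContDiffOn ℝ ∞ (e'.symm.trans e) (e'.symm.trans e).source
  null_u : ∀ e ∈ atlas (ℝ × ℝ) M, ∀ e' ∈ atlas (ℝ × ℝ) M, ∀ p ∈ e.source ∩ e'.source,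
    pv e' (fun q => (e q).1) p = 0
  null_v : ∀ e ∈ atlas (ℝ × ℝ) M, ∀ e' ∈ atlas (ℝ × ℝ) M, ∀ p ∈ e.source ∩ e'.source,
    pu e' (fun q => (e q).2) p = 0
  conformal : ∀ e ∈ atlas (ℝ × ℝ) M, ∀ e' ∈ atlas (ℝ × ℝ) M, ∀ p ∈ e.source ∩ e'.source,
    0 < jacU e e' p * jacV e e' p

/-- The factor `g` with `du² / √(du dv) = g · dũ² / √(dũ dṽ)`. Components with respect to the local
generator `du² / √(du dv)` of the line bundle `L₁` are multiplied by `g` under `e → e'`. -/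
def weight₁ (e e' : Chart M) (p : M) : ℝ :=
  jacU e e' p ^ 2 / Real.sqrt (jacU e e' p * jacV e e' p)

/-- The factor `g` with `dv² / √(du dv) = g · dṽ² / √(dũ dṽ)`. -/
def weight₂ (e e' : Chart M) (p : M) : ℝ :=
  jacV e e' p ^ 2 / Real.sqrt (jacU e e' p * jacV e e' p)

variable [ChartedSpace (ℝ × ℝ) M]

/-- The functions `g e e'` on the overlaps of the charts are the transition functions of a smooth
real line bundle over `M`. -/
def IsLineBundleCocycle (g : Chart M → Chart M → M → ℝ) : Prop :=
  (∀ e ∈ atlas (ℝ × ℝ) M, ∀ e' ∈ atlas (ℝ × ℝ) M,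
    SmoothOnSurface (e.source ∩ e'.source) (g e e') ∧
      ∀ p ∈ e.source ∩ e'.source, g e e' p ≠ 0) ∧
  (∀ e ∈ atlas (ℝ × ℝ) M, ∀ p ∈ e.source, g e e p = 1) ∧
  (∀ e ∈ atlas (ℝ × ℝ) M, ∀ e' ∈ atlas (ℝ × ℝ) M, ∀ e'' ∈ atlas (ℝ × ℝ) M,
    ∀ p ∈ e.source ∩ e'.source ∩ e''.source, g e e' p * g e' e'' p = g e e'' p)

/-! ### Abstract conformal data -/

/-- The signs of an orthonormal frame of signature `(n - r - 1, r - 1)`. -/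
def normalSign (n r : ℕ) (α : Fin (n - 2)) : ℝ := if (α : ℕ) + r + 1 < n then 1 else -1

/-- `NM` is a smooth subbundle of rank `n - 2` of the trivial bundle `M × ℝ^{n+2}_{r+1}` on whose
fibres the induced metric has signature `(n - r - 1, r - 1)`: it has smooth local orthonormal
frames. -/
def IsNormalSubbundle (n r : ℕ) (NM : M → Submodule ℝ (Ambient n)) : Prop :=
  ∀ p : M, ∃ U : Set M, IsOpen U ∧ p ∈ U ∧ ∃ ψ : Fin (n - 2) → M → Ambient n,
    (∀ α, SmoothOnSurface U (ψ α)) ∧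
    ∀ q ∈ U, NM q = Submodule.span ℝ (Set.range fun α => ψ α q) ∧
      ∀ α β, ambientForm n r (ψ α q) (ψ β q) = if α = β then normalSign n r α else 0

/-- `σ` restricts to a smooth section of `NM` over `U`. -/
def IsSectionOn {n : ℕ} (NM : M → Submodule ℝ (Ambient n)) (U : Set M) (σ : M → Ambient n) :
    Prop :=
  SmoothOnSurface U σ ∧ ∀ p ∈ U, σ p ∈ NM p

/-- `D e` is the covariant derivative along the coordinate vector field `w` of the chart `e`, for a
metric connection on `NM`: it is a local operator on smooth sections over open subsets of the
chart domain which is additive, satisfies the Leibniz rule and is compatible with the metric. -/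
structure IsCovariantDeriv (n r : ℕ) (NM : M → Submodule ℝ (Ambient n)) (w : ℝ × ℝ)
    (D : Chart M → (M → Ambient n) → M → Ambient n) : Prop where
  isSectionOn : ∀ e ∈ atlas (ℝ × ℝ) M, ∀ U : Set M, IsOpen U → U ⊆ e.source →
    ∀ σ, IsSectionOn NM U σ → IsSectionOn NM U (D e σ)
  locality : ∀ e ∈ atlas (ℝ × ℝ) M, ∀ U : Set M, IsOpen U → U ⊆ e.source →
    ∀ σ τ, IsSectionOn NM U σ → IsSectionOn NM U τ → Set.EqOn σ τ U →
      Set.EqOn (D e σ) (D e τ) U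
  add : ∀ e ∈ atlas (ℝ × ℝ) M, ∀ U : Set M, IsOpen U → U ⊆ e.source →
    ∀ σ τ, IsSectionOn NM U σ → IsSectionOn NM U τ →
      ∀ p ∈ U, D e (fun q => σ q + τ q) p = D e σ p + D e τ p
  leibniz : ∀ e ∈ atlas (ℝ × ℝ) M, ∀ U : Set M, IsOpen U → U ⊆ e.source →
    ∀ (f : M → ℝ) (σ : M → Ambient n), SmoothOnSurface U f → IsSectionOn NM U σ →
      ∀ p ∈ U, D e (fun q => f q • σ q) p = coordDeriv w e f p • σ p + f p • D e σ p
  metric : ∀ e ∈ atlas (ℝ × ℝ) M, ∀ U : Set M, IsOpen U → U ⊆ e.source →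
    ∀ σ τ, IsSectionOn NM U σ → IsSectionOn NM U τ →
      ∀ p ∈ U, coordDeriv w e (fun q => ambientForm n r (σ q) (τ q)) p =
        ambientForm n r (D e σ p) (τ p) + ambientForm n r (σ p) (D e τ p)

/-- Conformal data on an oriented Lorentz surface: a bundle `NM` with a metric connection `D`,
sections `κ₁ ∈ Γ(NM ⊗ L₁)` and `κ₂ ∈ Γ(NM ⊗ L₂)`, and Schwarzians `s₁`, `s₂`. The objects that
depend on the asymptotic coordinates are families indexed by the charts, with their
transformation laws. -/
structure ConformalData (M : Type*) [TopologicalSpace M] [ChartedSpace (ℝ × ℝ) M] (n r : ℕ) where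
  NM : M → Submodule ℝ (Ambient n)
  isNormalSubbundle : IsNormalSubbundle n r NM
  Du : Chart M → (M → Ambient n) → M → Ambient n
  Dv : Chart M → (M → Ambient n) → M → Ambient n
  isCovariantDeriv_u : IsCovariantDeriv n r NM (1, 0) Du
  isCovariantDeriv_v : IsCovariantDeriv n r NM (0, 1) Dv
  Du_change : ∀ e ∈ atlas (ℝ × ℝ) M, ∀ e' ∈ atlas (ℝ × ℝ) M, ∀ U : Set M, IsOpen U →
    U ⊆ e.source ∩ e'.source → ∀ σ, IsSectionOn NM U σ →
      ∀ p ∈ U, Du e' σ p = jacU e e' p • Du e σ p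
  Dv_change : ∀ e ∈ atlas (ℝ × ℝ) M, ∀ e' ∈ atlas (ℝ × ℝ) M, ∀ U : Set M, IsOpen U →
    U ⊆ e.source ∩ e'.source → ∀ σ, IsSectionOn NM U σ →
      ∀ p ∈ U, Dv e' σ p = jacV e e' p • Dv e σ p
  κ₁ : Chart M → M → Ambient n
  κ₂ : Chart M → M → Ambient n
  isSection_κ₁ : ∀ e ∈ atlas (ℝ × ℝ) M, IsSectionOn NM e.source (κ₁ e)
  isSection_κ₂ : ∀ e ∈ atlas (ℝ × ℝ) M, IsSectionOn NM e.source (κ₂ e)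
  κ₁_change : ∀ e ∈ atlas (ℝ × ℝ) M, ∀ e' ∈ atlas (ℝ × ℝ) M, ∀ p ∈ e.source ∩ e'.source,
    κ₁ e' p = weight₁ e e' p • κ₁ e p
  κ₂_change : ∀ e ∈ atlas (ℝ × ℝ) M, ∀ e' ∈ atlas (ℝ × ℝ) M, ∀ p ∈ e.source ∩ e'.source,
    κ₂ e' p = weight₂ e e' p • κ₂ e p
  s₁ : Chart M → M → ℝ
  s₂ : Chart M → M → ℝ
  smooth_s₁ : ∀ e ∈ atlas (ℝ × ℝ) M, SmoothOnSurface e.source (s₁ e)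
  smooth_s₂ : ∀ e ∈ atlas (ℝ × ℝ) M, SmoothOnSurface e.source (s₂ e)
  s₁_change : ∀ e ∈ atlas (ℝ × ℝ) M, ∀ e' ∈ atlas (ℝ × ℝ) M, ∀ p ∈ e.source ∩ e'.source,
    s₁ e' p = s₁ e p * jacU e e' p ^ 2 +
      2 * pu e' (pu e' (confFactor e e')) p - 2 * pu e' (confFactor e e') p ^ 2
  s₂_change : ∀ e ∈ atlas (ℝ × ℝ) M, ∀ e' ∈ atlas (ℝ × ℝ) M, ∀ p ∈ e.source ∩ e'.source,
    s₂ e' p = s₂ e p * jacV e e' p ^ 2 +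
      2 * pv e' (pv e' (confFactor e e')) p - 2 * pv e' (confFactor e e') p ^ 2

/-- The conformal Gauss, Codazzi and Ricci equations, in every chart of the atlas. -/
structure ConformalData.IsIntegrable {n r : ℕ} (𝒟 : ConformalData M n r) : Prop where
  gauss₁ : ∀ e ∈ atlas (ℝ × ℝ) M, ∀ p ∈ e.source,
    pv e (𝒟.s₁ e) p / 2 =
      3 * ambientForm n r (𝒟.Du e (𝒟.κ₂ e) p) (𝒟.κ₁ e p) +
        ambientForm n r (𝒟.Du e (𝒟.κ₁ e) p) (𝒟.κ₂ e p)
  gauss₂ : ∀ e ∈ atlas (ℝ × ℝ) M, ∀ p ∈ e.source,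
    pu e (𝒟.s₂ e) p / 2 =
      ambientForm n r (𝒟.κ₁ e p) (𝒟.Dv e (𝒟.κ₂ e) p) +
        3 * ambientForm n r (𝒟.Dv e (𝒟.κ₁ e) p) (𝒟.κ₂ e p)
  codazzi : ∀ e ∈ atlas (ℝ × ℝ) M, ∀ p ∈ e.source,
    𝒟.Dv e (𝒟.Dv e (𝒟.κ₁ e)) p + (𝒟.s₂ e p / 2) • 𝒟.κ₁ e p =
      𝒟.Du e (𝒟.Du e (𝒟.κ₂ e)) p + (𝒟.s₁ e p / 2) • 𝒟.κ₂ e p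
  ricci : ∀ e ∈ atlas (ℝ × ℝ) M, ∀ U : Set M, IsOpen U → U ⊆ e.source →
    ∀ ψ, IsSectionOn 𝒟.NM U ψ → ∀ p ∈ U,
      𝒟.Dv e (𝒟.Du e ψ) p - 𝒟.Du e (𝒟.Dv e ψ) p =
        (2 * ambientForm n r (ψ p) (𝒟.κ₁ e p)) • 𝒟.κ₂ e p -
          (2 * ambientForm n r (ψ p) (𝒟.κ₂ e p)) • 𝒟.κ₁ e p

/-! ### Timelike surfaces in the projective light cone -/

/-- `Y` is a local lift of `y` over `U`: `Y ≠ 0` and `y = [Y]`. (Then `⟨Y, Y⟩ = 0`, because `y` takes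
values in the light cone.) -/
def IsLiftOn {n r : ℕ} (y : M → ProjLightCone n r) (U : Set M) (Y : M → Ambient n) : Prop :=
  ∀ p ∈ U, ∃ hY : Y p ≠ 0, Projectivization.mk ℝ (Y p) hY = (y p : ℙ ℝ (Ambient n))

/-- `y` is a timelike conformal immersion into the projective light cone, with the given oriented
asymptotic coordinates: near every point it has a smooth lift `Y` to the light cone
with `⟨dY, dY⟩ = λ du dv` for a positive function `λ`. (Since `⟨Y, dY⟩ = 0`, this forces
`Y, Y_u, Y_v` to be linearly independent, i.e. `y` is an immersion.) -/
def IsTimelikeConformalImmersion {n r : ℕ} (y : M → ProjLightCone n r) : Prop :=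
  ∀ e ∈ atlas (ℝ × ℝ) M, ∀ p ∈ e.source, ∃ U : Set M, IsOpen U ∧ p ∈ U ∧ U ⊆ e.source ∧
    ∃ Y : M → Ambient n, SmoothOnSurface U Y ∧ IsLiftOn y U Y ∧ ∀ q ∈ U,
      ambientForm n r (pu e Y q) (pu e Y q) = 0 ∧
      ambientForm n r (pv e Y q) (pv e Y q) = 0 ∧
      0 < ambientForm n r (pu e Y q) (pv e Y q)

/-- `Y` is a canonical lift of `y`: in every asymptotic chart `(u, v)` it is a smooth lift with
`⟨dY, dY⟩ = ½ (du ⊗ dv + dv ⊗ du)`, and it becomes `e^{-ρ} Y` in coordinates `(ũ, ṽ)`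
with `du dv = e^{2ρ} dũ dṽ`. -/
structure IsCanonicalLift {n r : ℕ} (y : M → ProjLightCone n r) (Y : Chart M → M → Ambient n) :
    Prop where
  smooth : ∀ e ∈ atlas (ℝ × ℝ) M, SmoothOnSurface e.source (Y e)
  isLift : ∀ e ∈ atlas (ℝ × ℝ) M, IsLiftOn y e.source (Y e)
  metric_uu : ∀ e ∈ atlas (ℝ × ℝ) M, ∀ p ∈ e.source,
    ambientForm n r (pu e (Y e) p) (pu e (Y e) p) = 0
  metric_vv : ∀ e ∈ atlas (ℝ × ℝ) M, ∀ p ∈ e.source,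
    ambientForm n r (pv e (Y e) p) (pv e (Y e) p) = 0
  metric_uv : ∀ e ∈ atlas (ℝ × ℝ) M, ∀ p ∈ e.source,
    ambientForm n r (pu e (Y e) p) (pv e (Y e) p) = 1 / 2
  change : ∀ e ∈ atlas (ℝ × ℝ) M, ∀ e' ∈ atlas (ℝ × ℝ) M, ∀ p ∈ e.source ∩ e'.source,
    Y e' p = Real.exp (-confFactor e e' p) • Y e p

/-- The fibre at `p` of the conformal tangent bundle `V = Span {Y, Y_u, Y_v, Y_uv}`. -/
def confTangent {n : ℕ} (Y : Chart M → M → Ambient n) (e : Chart M) (p : M) :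
    Submodule ℝ (Ambient n) :=
  Submodule.span ℝ {Y e p, pu e (Y e) p, pv e (Y e) p, pv e (pu e (Y e)) p}

/-- The fibre at `p` of the conformal normal bundle `V^⊥`. -/
def confNormal {n : ℕ} (r : ℕ) (Y : Chart M → M → Ambient n) (e : Chart M) (p : M) :
    Submodule ℝ (Ambient n) :=
  (ambientForm n r).orthogonal (confTangent Y e p)

/-- `η` is the component in `V^⊥` of the vector `x` with respect to `ℝ^{n+2}_{r+1} = V ⊕ V^⊥`.
For a section `ψ` of `V^⊥`, the normal component of `ψ_u` is `D_u ψ`, and likewise for `v`. -/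
def IsNormalPart {n : ℕ} (r : ℕ) (Y : Chart M → M → Ambient n) (e : Chart M) (p : M)
    (x η : Ambient n) : Prop :=
  η ∈ confNormal r Y e p ∧ x - η ∈ confTangent Y e p

/-- `κ₁, κ₂` are the conformal Hopf differentials and `s₁, s₂` the Schwarzians of the canonical lift
`Y`: `Y_uu = -(s₁/2) Y + κ₁` and `Y_vv = -(s₂/2) Y + κ₂` with `κ₁, κ₂` normal. -/
structure HasConformalInvariants {n : ℕ} (r : ℕ) (Y : Chart M → M → Ambient n)
    (κ₁ κ₂ : Chart M → M → Ambient n) (s₁ s₂ : Chart M → M → ℝ) : Prop where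
  normal_κ₁ : ∀ e ∈ atlas (ℝ × ℝ) M, ∀ p ∈ e.source, κ₁ e p ∈ confNormal r Y e p
  normal_κ₂ : ∀ e ∈ atlas (ℝ × ℝ) M, ∀ p ∈ e.source, κ₂ e p ∈ confNormal r Y e p
  eq_uu : ∀ e ∈ atlas (ℝ × ℝ) M, ∀ p ∈ e.source,
    pu e (pu e (Y e)) p = -(s₁ e p / 2) • Y e p + κ₁ e p
  eq_vv : ∀ e ∈ atlas (ℝ × ℝ) M, ∀ p ∈ e.source,
    pv e (pv e (Y e)) p = -(s₂ e p / 2) • Y e p + κ₂ e p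

/-- `Φ` restricts to a smooth isometric bundle isomorphism from `NM` onto the conformal normal bundle
`V^⊥` of `Y` which takes the connection of `𝒟` to the normal connection. (Only the
restriction of `Φ p` to the fibre `NM p` matters.) -/
structure IsNormalBundleIsometry {n r : ℕ} (𝒟 : ConformalData M n r)
    (Y : Chart M → M → Ambient n) (Φ : M → Ambient n →ₗ[ℝ] Ambient n) : Prop where
  map_eq : ∀ e ∈ atlas (ℝ × ℝ) M, ∀ p ∈ e.source, (𝒟.NM p).map (Φ p) = confNormal r Y e p
  isometry : ∀ p, ∀ x ∈ 𝒟.NM p, ∀ z ∈ 𝒟.NM p,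
    ambientForm n r (Φ p x) (Φ p z) = ambientForm n r x z
  smooth : ∀ U : Set M, IsOpen U → ∀ σ, IsSectionOn 𝒟.NM U σ →
    SmoothOnSurface U fun p => Φ p (σ p)
  connection_u : ∀ e ∈ atlas (ℝ × ℝ) M, ∀ U : Set M, IsOpen U → U ⊆ e.source →
    ∀ σ, IsSectionOn 𝒟.NM U σ → ∀ p ∈ U,
      IsNormalPart r Y e p (pu e (fun q => Φ q (σ q)) p) (Φ p (𝒟.Du e σ p))
  connection_v : ∀ e ∈ atlas (ℝ × ℝ) M, ∀ U : Set M, IsOpen U → U ⊆ e.source →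
    ∀ σ, IsSectionOn 𝒟.NM U σ → ∀ p ∈ U,
      IsNormalPart r Y e p (pv e (fun q => Φ q (σ q)) p) (Φ p (𝒟.Dv e σ p))

/-- `y` has conformal data `𝒟`: for some canonical lift, its normal bundle with its metric and normal
connection is identified with `NM`, in such a way that its Hopf differentials are `κ₁, κ₂`;
and its Schwarzians are `s₁, s₂`. -/
def ConformalData.IsRealizedBy {n r : ℕ} (𝒟 : ConformalData M n r) (y : M → ProjLightCone n r) :
    Prop :=
  ∃ (Y : Chart M → M → Ambient n) (Φ : M → Ambient n →ₗ[ℝ] Ambient n),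
    IsCanonicalLift y Y ∧ IsNormalBundleIsometry 𝒟 Y Φ ∧
      HasConformalInvariants r Y (fun e p => Φ p (𝒟.κ₁ e p)) (fun e p => Φ p (𝒟.κ₂ e p)) 𝒟.s₁ 𝒟.s₂

/-- `ψ` is a smooth orthonormal frame, with signs `ε`, of the conformal normal bundle of `Y`. -/
structure IsNormalFrame {n : ℕ} (r : ℕ) (Y : Chart M → M → Ambient n) (ε : Fin (n - 2) → ℝ)
    (ψ : Fin (n - 2) → M → Ambient n) : Prop where
  smooth : ∀ α, SmoothOnSurface Set.univ (ψ α)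
  span_eq : ∀ e ∈ atlas (ℝ × ℝ) M, ∀ p ∈ e.source,
    Submodule.span ℝ (Set.range fun α => ψ α p) = confNormal r Y e p
  sign : ∀ α, ε α = 1 ∨ ε α = -1
  orthonormal : ∀ p α β, ambientForm n r (ψ α p) (ψ β p) = if α = β then ε α else 0

/-- In the frame `ψ` the normal connection has the coefficients `Γu`, `Γv`:
`D_u ψ_α = ∑_β Γu_αβ ψ_β` and `D_v ψ_α = ∑_β Γv_αβ ψ_β`. -/
def HasConnectionCoefficients {n : ℕ} (r : ℕ) (Y : Chart M → M → Ambient n)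
    (ψ : Fin (n - 2) → M → Ambient n)
    (Γu Γv : Chart M → M → Fin (n - 2) → Fin (n - 2) → ℝ) : Prop :=
  ∀ e ∈ atlas (ℝ × ℝ) M, ∀ p ∈ e.source, ∀ α,
    IsNormalPart r Y e p (pu e (ψ α) p) (∑ β, Γu e p α β • ψ β p) ∧
    IsNormalPart r Y e p (pv e (ψ α) p) (∑ β, Γv e p α β • ψ β p)

end Surface

end

noncomputable section

/-! ### Linear differential equations and the linear Frobenius theorem in the plane -/

section Frobenius

open Set Filter Topology

variable {E : Type*} [NormedAddCommGroup E] [NormedSpace ℝ E]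

/-! The proof is the method of moving frames. Along a canonical lift Y take the frame X = (Y, Y_u,
Y_v, N, ψ_α) with N = 2 Y_uv + 2cY, where c = ⟨κ₁, κ₂⟩ and ψ is an orthonormal frame of V^⊥. Since
⟨Y_uv, Y_uv⟩ = c (`IsFramedSurface.form_uv_uv`), the correction 2cY makes N null, and X has the
constant Gram matrix `frameGram`. Its derivatives are X_u = A X and X_v = B X, where A and B
(`frameCoefU`, `frameCoefV`) contain only s₁, s₂, c, the components of κ₁, κ₂, D_v κ₁, D_u κ₂, and
the coefficients of D. The conformal data are thus the coefficients of a linear total differential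
equation.

Uniqueness: if X and X' solve the same equation, the linear map taking X(q) to X'(q) has derivative
zero, so it is locally constant, and it is orthogonal because both Gram matrices are `frameGram`. A
local congruence is unique, because Y, its derivatives and ψ span the whole space. Connectedness of
M therefore makes all local congruences one transformation T.

Existence: the integrability condition of the system is A_v + AB = B_u + BA, and `frameCoef_compat`
derives it entry by entry from the Gauss, Codazzi and Ricci equations. The Frobenius theorem in the
plane (`exists_local_solution_of_compat`), obtained here from linear differential equations along
lines and Grönwall estimates, yields a local frame. As A and B are skew for `frameGram`, the frame
keeps the Gram matrix of its initial value. Its first vector is a canonical lift, and its last n - 2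
vectors are the images of a frame of NM.

Globalisation: the transformation laws of κ₁, κ₂, s₁, s₂ are exactly those produced by replacing Y
by e^{-ρ} Y (`RealizesOn.change`), so realisations in different charts can be compared. On overlaps
they differ by unique isometries, which form a locally constant cocycle. On a simply connected
surface this cocycle is a coboundary (`exists_coboundary_of_simplyConnected`): it defines a covering
space, and a global section comes from lifting the identity. Correcting the local realisations by
the coboundary makes them agree.

The line bundles in (a) need only the chain rule: changes of null coordinates have diagonal
Jacobians, so ∂u/∂ũ and ∂v/∂ṽ are separately multiplicative. -/

/-- Two-sided Grönwall inequality with a constant that does not depend on the function. -/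
theorem exists_gronwall_const (K δ : ℝ) :
    ∃ C : ℝ, 0 ≤ C ∧ ∀ (f f' : ℝ → E) (b η ε : ℝ), 0 ≤ η → 0 ≤ ε →
      (∀ t ∈ Icc (b - δ) (b + δ), HasDerivWithinAt f (f' t) (Icc (b - δ) (b + δ)) t) →
      (∀ t ∈ Icc (b - δ) (b + δ), ‖f' t‖ ≤ K * ‖f t‖ + ε) → ‖f b‖ ≤ η →
      ∀ t ∈ Icc (b - δ) (b + δ), ‖f t‖ ≤ C * (η + ε) := by
  -- With K' ≥ 1 the Grönwall bound takes its exponential form, and ε / K' can be replaced by ε.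
  set K' := max K 1 with hK'
  have hK'1 : 1 ≤ K' := le_max_right _ _
  have hK'0 : 0 < K' := by linarith
  have key : ∀ (f f' : ℝ → E) (η ε : ℝ), 0 ≤ η → 0 ≤ ε →
      (∀ t ∈ Icc 0 δ, HasDerivWithinAt f (f' t) (Icc 0 δ) t) →
      (∀ t ∈ Icc 0 δ, ‖f' t‖ ≤ K * ‖f t‖ + ε) → ‖f 0‖ ≤ η →
      ∀ t ∈ Icc 0 δ, ‖f t‖ ≤ Real.exp (K' * δ) * (η + ε) := by
    intro f f' η ε hη hε hf hf' h0 t ht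
    have h1 := norm_le_gronwallBound_of_norm_deriv_right_le (f := f) (f' := f') (δ := η)
      (K := K') (ε := ε) (a := 0) (b := δ) (fun s hs => (hf s hs).continuousWithinAt)
      (fun s hs => (hf s (Ico_subset_Icc_self hs)).mono_of_mem_nhdsWithin
        (mem_of_superset (Ico_mem_nhdsGE hs.2) fun r hr => ⟨hs.1.trans hr.1, hr.2.le⟩)) h0
      (fun s hs => (hf' s (Ico_subset_Icc_self hs)).trans (by
        have := mul_le_mul_of_nonneg_right (le_max_left K 1) (norm_nonneg (f s))
        linarith)) t ht
    rw [gronwallBound_of_K_ne_0 hK'0.ne', sub_zero] at h1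
    have h2 : Real.exp (K' * t) ≤ Real.exp (K' * δ) :=
      Real.exp_le_exp.2 (mul_le_mul_of_nonneg_left ht.2 hK'0.le)
    have h3 : 1 ≤ Real.exp (K' * t) := Real.one_le_exp (mul_nonneg hK'0.le ht.1)
    have h4 : ε / K' ≤ ε := div_le_self hε hK'1
    have h5 : ε / K' * (Real.exp (K' * t) - 1) ≤ ε * Real.exp (K' * δ) :=
      mul_le_mul h4 (by linarith) (by linarith) hε
    have h6 : η * Real.exp (K' * t) ≤ η * Real.exp (K' * δ) :=
      mul_le_mul_of_nonneg_left h2 hη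
    simp only at h1
    linarith
  refine ⟨Real.exp (K' * δ), (Real.exp_pos _).le, fun f f' b η ε hη hε hf hf' h0 t ht => ?_⟩
  rcases le_total b t with hbt | hbt
  · have := key (fun s => f (b + s)) (fun s => f' (b + s)) η ε hη hε
      (fun s hs => by
        have h1 : HasDerivWithinAt (fun s : ℝ => b + s) 1 (Icc 0 δ) s :=
          ((hasDerivAt_id s).const_add b).hasDerivWithinAt
        have := (hf (b + s) ⟨by linarith [hs.1, hs.2], by linarith [hs.2]⟩).scomp s h1
          (fun r hr => ⟨by linarith [hr.1, hr.2], by linarith [hr.2]⟩)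
        simpa [Function.comp_def] using this)
      (fun s hs => hf' _ ⟨by linarith [hs.1, hs.2], by linarith [hs.2]⟩) (by simpa using h0)
      (t - b) ⟨by linarith, by linarith [ht.2]⟩
    simpa using this
  -- To the left of b the forward estimate is applied to the time-reversed function.
  · have := key (fun s => f (b - s)) (fun s => -f' (b - s)) η ε hη hε
      (fun s hs => by
        have h1 : HasDerivWithinAt (fun s : ℝ => b - s) (-1) (Icc 0 δ) s :=
          ((hasDerivAt_id s).const_sub b).hasDerivWithinAt
        have := (hf (b - s) ⟨by linarith [hs.1, hs.2], by linarith [hs.1, hs.2]⟩).scomp s h1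
          (fun r hr => ⟨by linarith [hr.1, hr.2], by linarith [hr.1, hr.2]⟩)
        simpa [Function.comp_def] using this)
      (fun s hs => by
        rw [norm_neg]
        exact hf' _ ⟨by linarith [hs.1, hs.2], by linarith [hs.1, hs.2]⟩) (by simpa using h0)
      (b - t) ⟨by linarith, by linarith [ht.1]⟩
    simpa using this

/-- A linear differential equation is solvable on an interval of length controlled by the bound of
its coefficients. -/
theorem exists_linear_ode_solution [CompleteSpace E] {A : ℝ → E →L[ℝ] E} {K δ b : ℝ} (hδ : 0 ≤ δ)
    (hK : 0 ≤ K) (hKδ : K * δ ≤ 1 / 2) (hA : ContinuousOn A (Icc (b - δ) (b + δ)))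
    (hAK : ∀ t ∈ Icc (b - δ) (b + δ), ‖A t‖ ≤ K) (x₀ : E) :
    ∃ x : ℝ → E, x b = x₀ ∧ ∀ t ∈ Icc (b - δ) (b + δ),
      HasDerivWithinAt x (A t (x t)) (Icc (b - δ) (b + δ)) t := by
  lift K to NNReal using hK
  have hb : b ∈ Icc (b - δ) (b + δ) := ⟨by linarith, by linarith⟩
  have hbound : ∀ x ∈ Metric.closedBall x₀ ‖x₀‖, ‖x‖ ≤ 2 * ‖x₀‖ := by
    intro x hx
    have := norm_le_of_mem_closedBall hx
    linarith
  -- On the ball of radius ‖x₀‖ about x₀ the speed is at most 2K‖x₀‖. Since Kδ ≤ 1/2, a solution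
  -- cannot leave this ball within time δ.
  have hPL : IsPicardLindelof (fun t x => A t x) (tmin := b - δ) (tmax := b + δ) ⟨b, hb⟩ x₀
      ‖x₀‖₊ 0 (K * (2 * ‖x₀‖₊)) K := by
    refine ⟨fun t ht => ?_, fun x _ => ?_, fun t ht x hx => ?_, ?_⟩
    · refine LipschitzOnWith.of_dist_le_mul fun x _ y _ => ?_
      rw [dist_eq_norm, dist_eq_norm, ← map_sub]
      exact (A t).le_of_opNorm_le (hAK t ht) _
    · exact hA.clm_apply continuousOn_const
    · refine ((A t).le_of_opNorm_le (hAK t ht) x).trans ?_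
      simpa using mul_le_mul_of_nonneg_left (hbound x hx) K.2
    · have : max (b + δ - b) (b - (b - δ)) = δ := by ring_nf; simp
      simp only [this]
      have := mul_le_mul_of_nonneg_right hKδ (mul_nonneg zero_le_two (norm_nonneg x₀))
      push_cast
      rw [sub_zero]
      linarith
  exact hPL.exists_eq_forall_mem_Icc_hasDerivWithinAt₀


/-- Compactness bounds g and its derivative on the ball, and convexity of the ball turns the second
bound into a Lipschitz estimate. One constant serves both purposes. -/
theorem ContDiffOn.exists_bound_lipschitz_closedBall {F : Type*} [NormedAddCommGroup F]
    [NormedSpace ℝ F] {g : ℝ × ℝ → F} {Ω : Set (ℝ × ℝ)} (hΩ : IsOpen Ω) (hg : ContDiffOn ℝ ∞ g Ω)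
    {p : ℝ × ℝ} {δ : ℝ} (hp : Metric.closedBall p δ ⊆ Ω) :
    ∃ K : ℝ, 0 ≤ K ∧ (∀ q ∈ Metric.closedBall p δ, ‖g q‖ ≤ K) ∧
      ∀ q ∈ Metric.closedBall p δ, ∀ q' ∈ Metric.closedBall p δ, ‖g q - g q'‖ ≤ K * ‖q - q'‖ := by
  have hc := isCompact_closedBall p δ
  obtain ⟨K₁, h₁⟩ := hc.exists_bound_of_continuousOn (hg.continuousOn.mono hp)
  obtain ⟨K₂, h₂⟩ := hc.exists_bound_of_continuousOn
    ((hg.continuousOn_fderiv_of_isOpen hΩ (by simp)).mono hp)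
  refine ⟨max 0 (max K₁ K₂), le_max_left _ _, fun q hq => (h₁ q hq).trans (by simp),
    fun q hq q' hq' => ?_⟩
  refine (convex_closedBall p δ).norm_image_sub_le_of_norm_hasFDerivWithin_le (f' := fderiv ℝ g)
    (fun x hx => ?_) (fun x hx => (h₂ x hx).trans (by simp)) hq' hq
  exact ((hg.differentiableOn (by simp) x (hp hx)).differentiableAt
    (hΩ.mem_nhds (hp hx))).hasFDerivAt.hasFDerivWithinAt

theorem hasDerivAt_fst_of_differentiableAt {F : Type*} [NormedAddCommGroup F] [NormedSpace ℝ F]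
    {g : ℝ × ℝ → F} {u v : ℝ} (hg : DifferentiableAt ℝ g (u, v)) :
    HasDerivAt (fun t => g (t, v)) (fderiv ℝ g (u, v) (1, 0)) u :=
  hg.hasFDerivAt.comp_hasDerivAt u ((hasDerivAt_id u).prodMk (hasDerivAt_const u v))

theorem hasDerivAt_snd_of_differentiableAt {F : Type*} [NormedAddCommGroup F] [NormedSpace ℝ F]
    {g : ℝ × ℝ → F} {u v : ℝ} (hg : DifferentiableAt ℝ g (u, v)) :
    HasDerivAt (fun t => g (u, t)) (fderiv ℝ g (u, v) (0, 1)) v :=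
  hg.hasFDerivAt.comp_hasDerivAt v ((hasDerivAt_const v u).prodMk (hasDerivAt_id v))

/-- Solutions of a total differential equation are smooth. -/
theorem contDiffOn_of_hasFDerivAt_clm {X : ℝ × ℝ → E} {U V : ℝ × ℝ → E →L[ℝ] E}
    {W : Set (ℝ × ℝ)} (hW : IsOpen W) (hU : ContDiffOn ℝ ∞ U W) (hV : ContDiffOn ℝ ∞ V W)
    (hX : ∀ q ∈ W, HasFDerivAt X
      (((ContinuousLinearMap.fst ℝ ℝ ℝ).smulRight (U q (X q))) +
        ((ContinuousLinearMap.snd ℝ ℝ ℝ).smulRight (V q (X q)))) q) :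
    ContDiffOn ℝ ∞ X W := by
  rw [contDiffOn_infty]
  intro n
  -- Bootstrapping: the derivative of X is a smooth expression in X itself, so each order of
  -- differentiability yields the next one.
  induction n with
  | zero =>
    exact contDiffOn_zero.2 fun q hq => (hX q hq).continuousAt.continuousWithinAt
  | succ n ih =>
    have h : ContDiffOn ℝ (((n : ℕ) : WithTop ℕ∞) + 1) X W := by
      rw [contDiffOn_succ_iff_fderiv_of_isOpen hW]
      refine ⟨fun q hq => (hX q hq).differentiableAt.differentiableWithinAt, by simp, ?_⟩
      refine ContDiffOn.congr ?_ fun q hq => (hX q hq).fderiv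
      have hU' : ContDiffOn ℝ n U W := hU.of_le (by exact_mod_cast le_top)
      have hV' : ContDiffOn ℝ n V W := hV.of_le (by exact_mod_cast le_top)
      exact (contDiffOn_const.smulRight (hU'.clm_apply ih)).add
        (contDiffOn_const.smulRight (hV'.clm_apply ih))
    exact_mod_cast h


theorem mem_closedBall_prod_iff {a b u v δ : ℝ} : (u, v) ∈ Metric.closedBall (a, b) δ ↔
    u ∈ Icc (a - δ) (a + δ) ∧ v ∈ Icc (b - δ) (b + δ) := by
  rw [← closedBall_prod_same, mem_prod, Real.closedBall_eq_Icc, Real.closedBall_eq_Icc]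

/-- A solution of a linear system along the lines `u = const` whose initial values solve the system
along a line `v = b` solves the system in both directions. -/
theorem hasDerivAt_of_compat {U V : ℝ × ℝ → E →L[ℝ] E} {Ω : Set (ℝ × ℝ)} (hΩ : IsOpen Ω)
    (hU : ContDiffOn ℝ ∞ U Ω) (hV : ContDiffOn ℝ ∞ V Ω)
    (hUV : ∀ q ∈ Ω, fderiv ℝ U q (0, 1) + U q ∘L V q = fderiv ℝ V q (1, 0) + V q ∘L U q)
    {a b δ : ℝ} (hp : Metric.closedBall (a, b) δ ⊆ Ω) {X : ℝ → ℝ → E}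
    (hXu : ∀ u ∈ Icc (a - δ) (a + δ),
      HasDerivWithinAt (fun u => X u b) (U (u, b) (X u b)) (Icc (a - δ) (a + δ)) u)
    (hXv : ∀ u ∈ Icc (a - δ) (a + δ), ∀ v ∈ Icc (b - δ) (b + δ),
      HasDerivWithinAt (X u) (V (u, v) (X u v)) (Icc (b - δ) (b + δ)) v)
    {u₀ v : ℝ} (hu₀ : u₀ ∈ Ioo (a - δ) (a + δ)) (hv : v ∈ Icc (b - δ) (b + δ)) :
    HasDerivAt (fun u => X u v) (U (u₀, v) (X u₀ v)) u₀ := by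
  have hu₀' := Ioo_subset_Icc_self hu₀
  have hbI : b ∈ Icc (b - δ) (b + δ) := by
    have := hu₀.1.trans hu₀.2
    exact ⟨by linarith, by linarith⟩
  have hVu : ContDiffOn ℝ ∞ (fun q => fderiv ℝ V q (1, 0)) Ω :=
    (hV.fderiv_of_isOpen hΩ (by simp)).clm_apply contDiffOn_const
  obtain ⟨K, hK, hVK, hVL⟩ := hV.exists_bound_lipschitz_closedBall hΩ hp
  obtain ⟨K₁, hK₁, -, hVuL⟩ := hVu.exists_bound_lipschitz_closedBall hΩ hp
  obtain ⟨C, hC, hgron⟩ := exists_gronwall_const (E := E) K δ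
  have hdU : ∀ q ∈ Ω, DifferentiableAt ℝ U q := fun q hq =>
    (hU.differentiableOn (by simp) q hq).differentiableAt (hΩ.mem_nhds hq)
  have hdV : ∀ q ∈ Ω, DifferentiableAt ℝ V q := fun q hq =>
    (hV.differentiableOn (by simp) q hq).differentiableAt (hΩ.mem_nhds hq)
  have hmem : ∀ u ∈ Icc (a - δ) (a + δ), ∀ s ∈ Icc (b - δ) (b + δ),
      (u, s) ∈ Metric.closedBall (a, b) δ := fun u hu s hs => mem_closedBall_prod_iff.2 ⟨hu, hs⟩
  -- bounds for the solution through `u₀`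
  have hcX : ContinuousOn (X u₀) (Icc (b - δ) (b + δ)) := fun s hs =>
    (hXv u₀ hu₀' s hs).continuousWithinAt
  obtain ⟨R, hR⟩ := isCompact_Icc.exists_bound_of_continuousOn hcX
  have hcUX : ContinuousOn (fun s => U (u₀, s) (X u₀ s)) (Icc (b - δ) (b + δ)) :=
    (hU.continuousOn.comp (by fun_prop) fun s hs => hp (hmem u₀ hu₀' s hs)).clm_apply hcX
  obtain ⟨R₁, hR₁⟩ := isCompact_Icc.exists_bound_of_continuousOn hcUX
  have hR0 : 0 ≤ R := (norm_nonneg _).trans (hR b hbI)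
  have hR₁0 : 0 ≤ R₁ := (norm_nonneg _).trans (hR₁ b hbI)
  -- First order Taylor expansion of V in u, with a quadratic remainder that is uniform in s because
  -- V_u is Lipschitz on the ball.
  have htaylor : ∀ u ∈ Icc (a - δ) (a + δ), ∀ s ∈ Icc (b - δ) (b + δ),
      ‖V (u, s) - V (u₀, s) - (u - u₀) • fderiv ℝ V (u₀, s) (1, 0)‖ ≤ K₁ * |u - u₀| ^ 2 := by
    intro u hu s hs
    have hsub : uIcc u₀ u ⊆ Icc (a - δ) (a + δ) := ordConnected_Icc.uIcc_subset hu₀' hu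
    have := (convex_uIcc u₀ u).norm_image_sub_le_of_norm_hasDerivWithin_le
      (f := fun t => V (t, s) - t • fderiv ℝ V (u₀, s) (1, 0))
      (f' := fun t => fderiv ℝ V (t, s) (1, 0) - (1 : ℝ) • fderiv ℝ V (u₀, s) (1, 0))
      (C := K₁ * |u - u₀|)
      (fun t ht => ((hasDerivAt_fst_of_differentiableAt
        (hdV _ (hp (hmem t (hsub ht) s hs)))).sub
        ((hasDerivAt_id t).smul_const _)).hasDerivWithinAt)
      (fun t ht => by
        rw [one_smul]
        refine (hVuL _ (hmem t (hsub ht) s hs) _ (hmem u₀ hu₀' s hs)).trans ?_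
        refine mul_le_mul_of_nonneg_left ?_ hK₁
        simp only [Prod.mk_sub_mk, sub_self, Prod.norm_mk, norm_zero, Real.norm_eq_abs]
        exact max_le (abs_sub_left_of_mem_uIcc ht) (abs_nonneg _)) left_mem_uIcc right_mem_uIcc
    rw [Real.norm_eq_abs] at this
    calc _ = ‖V (u, s) - u • fderiv ℝ V (u₀, s) (1, 0) -
          (V (u₀, s) - u₀ • fderiv ℝ V (u₀, s) (1, 0))‖ := by congr 1; module
      _ ≤ _ := this
      _ = _ := by ring
  have hlip : ∀ u ∈ Icc (a - δ) (a + δ), ∀ s ∈ Icc (b - δ) (b + δ),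
      ‖V (u, s) - V (u₀, s)‖ ≤ K * |u - u₀| := by
    intro u hu s hs
    refine (hVL _ (hmem u hu s hs) _ (hmem u₀ hu₀' s hs)).trans (le_of_eq ?_)
    simp [Prod.norm_mk]
  -- the first order error
  set f : ℝ → ℝ → E := fun u s => X u s - X u₀ s - (u - u₀) • U (u₀, s) (X u₀ s) with hf
  -- In the v-direction the error f satisfies f' = V f + O(|u - u₀|²), so Grönwall controls it at v
  -- by its value at b. The constant C must be the same for all u, which is why
  -- `exists_gronwall_const` quantifies it before the function.
  have hmain : ∀ u ∈ Icc (a - δ) (a + δ),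
      ‖f u v‖ ≤ C * (‖f u b‖ + (K₁ * R + K * R₁) * |u - u₀| ^ 2) := by
    intro u hu
    refine hgron (f u) (fun s => V (u, s) (f u s) +
      (V (u, s) - V (u₀, s) - (u - u₀) • fderiv ℝ V (u₀, s) (1, 0)) (X u₀ s) +
      (u - u₀) • (V (u, s) - V (u₀, s)) (U (u₀, s) (X u₀ s))) b _ _ (norm_nonneg _)
      (by positivity) (fun s hs => ?_) (fun s hs => ?_) le_rfl v hv
    · have hq := hp (hmem u₀ hu₀' s hs)
      have h1 := (hXv u hu s hs).sub (hXv u₀ hu₀' s hs)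
      have h2 := ((hasDerivAt_snd_of_differentiableAt (hdU _ hq)).hasDerivWithinAt
        (s := Icc (b - δ) (b + δ))).clm_apply (hXv u₀ hu₀' s hs)
      have h3 := h1.sub (h2.const_smul (u - u₀))
      -- The v-derivative of U X is (U_v + UV) X. Compatibility turns it into (V_u + VU) X, and then
      -- all terms of first order in u - u₀ cancel.
      have hc := congrArg (fun T : E →L[ℝ] E => T (X u₀ s)) (hUV _ hq)
      simp only [add_apply, ContinuousLinearMap.comp_apply] at hc
      refine h3.congr_deriv ?_
      rw [hc]
      simp only [hf, map_sub, map_smul, sub_apply,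
        smul_apply]
      module
    · refine (norm_add₃_le).trans ?_
      have e1 : ‖V (u, s) (f u s)‖ ≤ K * ‖f u s‖ :=
        (V (u, s)).le_of_opNorm_le (hVK _ (hmem u hu s hs)) _
      have e2 := (ContinuousLinearMap.le_of_opNorm_le _ (htaylor u hu s hs) (X u₀ s)).trans
        (mul_le_mul_of_nonneg_left (hR s hs) (by positivity))
      have e3 := (ContinuousLinearMap.le_of_opNorm_le _ (hlip u hu s hs)
        (U (u₀, s) (X u₀ s))).trans (mul_le_mul_of_nonneg_left (hR₁ s hs) (by positivity))
      have e4 := mul_le_mul_of_nonneg_left e3 (abs_nonneg (u - u₀))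
      rw [norm_smul, Real.norm_eq_abs]
      calc _ ≤ K * ‖f u s‖ + K₁ * |u - u₀| ^ 2 * R + |u - u₀| * (K * |u - u₀| * R₁) :=
            add_le_add (add_le_add e1 e2) e4
        _ = _ := by ring
  have hnhds : Icc (a - δ) (a + δ) ∈ 𝓝 u₀ := Icc_mem_nhds hu₀.1 hu₀.2
  have hb0 : HasDerivAt (fun u => X u b) (U (u₀, b) (X u₀ b)) u₀ :=
    (hXu u₀ hu₀').hasDerivAt hnhds
  rw [hasDerivAt_iff_isLittleO] at hb0 ⊢
  have hsq : (fun u => (K₁ * R + K * R₁) * |u - u₀| ^ 2) =o[𝓝 u₀] fun u => u - u₀ := by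
    refine Asymptotics.IsLittleO.const_mul_left ?_ _
    simp only [sq_abs]
    have : (fun u : ℝ => (u - u₀) ^ 2) = fun u => (u - u₀) * (u - u₀) := by ext; ring
    rw [this]
    have h0 : Tendsto (fun u => u - u₀) (𝓝 u₀) (𝓝 0) := by
      simpa using (continuous_id.sub continuous_const).tendsto (x := u₀) (f := fun u => u - u₀)
    simpa using ((Asymptotics.isLittleO_one_iff ℝ).2 h0).mul_isBigO
      (Asymptotics.isBigO_refl (fun u => u - u₀) (𝓝 u₀))
  -- Both parts of the bound are o(u - u₀): the error on the line v = b by the equation assumed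
  -- there, and the remainder because it is quadratic.
  have hsum := (hb0.norm_left.add hsq).const_mul_left C
  refine Asymptotics.IsBigO.trans_isLittleO (Asymptotics.IsBigO.of_bound 1 ?_) hsum
  filter_upwards [hnhds] with u hu
  rw [one_mul]
  exact (hmain u hu).trans (le_abs_self _)

/-- Local solvability of linear total differential equations in the plane. -/
theorem exists_local_solution_of_compat [CompleteSpace E] {U V : ℝ × ℝ → E →L[ℝ] E}
    {Ω : Set (ℝ × ℝ)} (hΩ : IsOpen Ω) (hU : ContDiffOn ℝ ∞ U Ω) (hV : ContDiffOn ℝ ∞ V Ω)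
    (hUV : ∀ q ∈ Ω, fderiv ℝ U q (0, 1) + U q ∘L V q = fderiv ℝ V q (1, 0) + V q ∘L U q)
    {p : ℝ × ℝ} (hp : p ∈ Ω) (x₀ : E) :
    ∃ W : Set (ℝ × ℝ), IsOpen W ∧ Convex ℝ W ∧ p ∈ W ∧ W ⊆ Ω ∧ ∃ X : ℝ × ℝ → E, X p = x₀ ∧
      ContDiffOn ℝ ∞ X W ∧ ∀ q ∈ W, fderiv ℝ X q (1, 0) = U q (X q) ∧
        fderiv ℝ X q (0, 1) = V q (X q) := by
  obtain ⟨a, b⟩ := p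
  obtain ⟨δ₀, hδ₀, hball⟩ := Metric.nhds_basis_closedBall.mem_iff.1 (hΩ.mem_nhds hp)
  obtain ⟨K₁, hK₁, hUK, -⟩ := hU.exists_bound_lipschitz_closedBall hΩ hball
  obtain ⟨K₂, hK₂, hVK, -⟩ := hV.exists_bound_lipschitz_closedBall hΩ hball
  set K := K₁ + K₂ + 1 with hKdef
  have hK : 0 < K := by positivity
  -- This choice gives Kδ ≤ 1/2, so the linear equations along the horizontal line and along all
  -- vertical lines are solvable on intervals of the same length.
  set δ := min δ₀ (1 / (2 * K)) with hδdef
  have hδ : 0 < δ := lt_min hδ₀ (by positivity)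
  have hKδ : K * δ ≤ 1 / 2 := by
    calc K * δ ≤ K * (1 / (2 * K)) := mul_le_mul_of_nonneg_left (min_le_right _ _) hK.le
      _ = 1 / 2 := by field_simp
  have hsub : Metric.closedBall (a, b) δ ⊆ Metric.closedBall (a, b) δ₀ :=
    Metric.closedBall_subset_closedBall (min_le_left _ _)
  have hmem : ∀ u ∈ Icc (a - δ) (a + δ), ∀ s ∈ Icc (b - δ) (b + δ),
      (u, s) ∈ Metric.closedBall (a, b) δ := fun u hu s hs => mem_closedBall_prod_iff.2 ⟨hu, hs⟩
  have haI : a ∈ Icc (a - δ) (a + δ) := ⟨by linarith, by linarith⟩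
  have hbI : b ∈ Icc (b - δ) (b + δ) := ⟨by linarith, by linarith⟩
  obtain ⟨x, hx0, hx⟩ := exists_linear_ode_solution (A := fun u => U (u, b)) hδ.le hK.le hKδ
    (hU.continuousOn.comp (by fun_prop) fun u hu => hball (hsub (hmem u hu b hbI)))
    (fun u hu => (hUK _ (hsub (hmem u hu b hbI))).trans (by linarith)) x₀
  -- The initial value on each vertical line is the solution along v = b. Outside the interval a
  -- dummy function makes the family total, so that it can be chosen for every u.
  have hex : ∀ u : ℝ, ∃ y : ℝ → E, u ∈ Icc (a - δ) (a + δ) → y b = x u ∧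
      ∀ t ∈ Icc (b - δ) (b + δ),
        HasDerivWithinAt y (V (u, t) (y t)) (Icc (b - δ) (b + δ)) t := by
    intro u
    by_cases hu : u ∈ Icc (a - δ) (a + δ)
    · obtain ⟨y, hy⟩ := exists_linear_ode_solution (A := fun s => V (u, s)) hδ.le hK.le hKδ
        (hV.continuousOn.comp (by fun_prop) fun s hs => hball (hsub (hmem u hu s hs)))
        (fun s hs => (hVK _ (hsub (hmem u hu s hs))).trans (by linarith)) (x u)
      exact ⟨y, fun _ => hy⟩
    · exact ⟨0, fun h => (hu h).elim⟩
  choose X hX using hex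
  have hXu : ∀ u ∈ Icc (a - δ) (a + δ),
      HasDerivWithinAt (fun u => X u b) (U (u, b) (X u b)) (Icc (a - δ) (a + δ)) u := by
    intro u hu
    rw [(hX u hu).1]
    exact (hx u hu).congr_of_mem (fun w hw => (hX w hw).1) hu
  have hdv : ∀ u ∈ Ioo (a - δ) (a + δ), ∀ v ∈ Ioo (b - δ) (b + δ),
      HasDerivAt (X u) (V (u, v) (X u v)) v := fun u hu v hv =>
    ((hX u (Ioo_subset_Icc_self hu)).2 v (Ioo_subset_Icc_self hv)).hasDerivAt
      (Icc_mem_nhds hv.1 hv.2)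
  have hdu : ∀ u ∈ Ioo (a - δ) (a + δ), ∀ v ∈ Ioo (b - δ) (b + δ),
      HasDerivAt (fun u => X u v) (U (u, v) (X u v)) u := fun u hu v hv =>
    hasDerivAt_of_compat hΩ hU hV hUV (hsub.trans hball) hXu (fun u hu => (hX u hu).2) hu
      (Ioo_subset_Icc_self hv)
  -- a uniform bound and joint continuity
  obtain ⟨C, hC, hgron⟩ := exists_gronwall_const (E := E) K δ
  have hxb : ∀ u ∈ Icc (a - δ) (a + δ), ‖x u‖ ≤ C * (‖x₀‖ + 0) :=
    hgron x (fun u => U (u, b) (x u)) a _ 0 (norm_nonneg _) le_rfl hx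
      (fun u hu => by
        rw [add_zero]
        exact (U (u, b)).le_of_opNorm_le
          ((hUK _ (hsub (hmem u hu b hbI))).trans (by linarith)) _) (by rw [hx0])
  have hXb : ∀ u ∈ Icc (a - δ) (a + δ), ∀ v ∈ Icc (b - δ) (b + δ),
      ‖X u v‖ ≤ C * (C * (‖x₀‖ + 0) + 0) := fun u hu v hv =>
    hgron (X u) (fun v => V (u, v) (X u v)) b _ 0 (by positivity) le_rfl (hX u hu).2
      (fun v hv => by
        rw [add_zero]
        exact (V (u, v)).le_of_opNorm_le
          ((hVK _ (hsub (hmem u hu v hv))).trans (by linarith)) _)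
      (by rw [(hX u hu).1]; exact hxb u hu) v hv
  set R := C * (C * (‖x₀‖ + 0) + 0) with hRdef
  have hR : 0 ≤ R := by positivity
  set W : Set (ℝ × ℝ) := Ioo (a - δ) (a + δ) ×ˢ Ioo (b - δ) (b + δ) with hW
  have hWo : IsOpen W := isOpen_Ioo.prod isOpen_Ioo
  have hWΩ : W ⊆ Ω := fun q hq => hball (hsub
    (hmem q.1 (Ioo_subset_Icc_self hq.1) q.2 (Ioo_subset_Icc_self hq.2)))
  -- Moving first in u and then in v, each partial derivative is bounded by KR. This gives the joint
  -- continuity needed to pass from partial derivatives to a Fréchet derivative.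
  have hlip : ∀ q ∈ W, ∀ q' ∈ W, ‖X q.1 q.2 - X q'.1 q'.2‖ ≤
      K * R * ‖q.1 - q'.1‖ + K * R * ‖q.2 - q'.2‖ := by
    intro q hq q' hq'
    have h1 := (convex_Ioo (a - δ) (a + δ)).norm_image_sub_le_of_norm_hasDerivWithin_le
      (f := fun u => X u q.2) (C := K * R)
      (fun u hu => (hdu u hu q.2 hq.2).hasDerivWithinAt)
      (fun u hu => (ContinuousLinearMap.le_of_opNorm_le _ ((hUK _ (hsub (hmem u
        (Ioo_subset_Icc_self hu) q.2 (Ioo_subset_Icc_self hq.2)))).trans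
        (show K₁ ≤ K by linarith)) _).trans (mul_le_mul_of_nonneg_left
        (hXb u (Ioo_subset_Icc_self hu) q.2 (Ioo_subset_Icc_self hq.2)) hK.le)) hq'.1 hq.1
    have h2 := (convex_Ioo (b - δ) (b + δ)).norm_image_sub_le_of_norm_hasDerivWithin_le
      (f := fun v => X q'.1 v) (C := K * R)
      (fun v hv => (hdv q'.1 hq'.1 v hv).hasDerivWithinAt)
      (fun v hv => (ContinuousLinearMap.le_of_opNorm_le _ ((hVK _ (hsub (hmem q'.1
        (Ioo_subset_Icc_self hq'.1) v (Ioo_subset_Icc_self hv)))).trans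
        (show K₂ ≤ K by linarith)) _).trans (mul_le_mul_of_nonneg_left
        (hXb q'.1 (Ioo_subset_Icc_self hq'.1) v (Ioo_subset_Icc_self hv)) hK.le)) hq'.2 hq.2
    calc _ = ‖(X q.1 q.2 - X q'.1 q.2) + (X q'.1 q.2 - X q'.1 q'.2)‖ := by congr 1; abel
      _ ≤ _ := (norm_add_le _ _).trans (add_le_add h1 h2)
  have hcont : ContinuousOn (fun q : ℝ × ℝ => X q.1 q.2) W := by
    refine LipschitzOnWith.continuousOn (K := (2 * (K * R)).toNNReal)
      (LipschitzOnWith.of_dist_le_mul fun q hq q' hq' => ?_)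
    rw [dist_eq_norm, dist_eq_norm, Real.coe_toNNReal _ (by positivity)]
    refine (hlip q hq q' hq').trans ?_
    have h1 := mul_le_mul_of_nonneg_left (norm_fst_le (q - q')) (by positivity : 0 ≤ K * R)
    have h2 := mul_le_mul_of_nonneg_left (norm_snd_le (q - q')) (by positivity : 0 ≤ K * R)
    simp only [Prod.fst_sub, Prod.snd_sub] at h1 h2
    linarith
  have hfd : ∀ q ∈ W, HasFDerivAt (fun q : ℝ × ℝ => X q.1 q.2)
      (((ContinuousLinearMap.fst ℝ ℝ ℝ).smulRight (U q (X q.1 q.2))) +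
        ((ContinuousLinearMap.snd ℝ ℝ ℝ).smulRight (V q (X q.1 q.2)))) q := by
    intro q hq
    have hcU : ContinuousAt (fun q : ℝ × ℝ => U q (X q.1 q.2)) q :=
      ((hU.continuousOn.mono hWΩ).clm_apply hcont).continuousAt (hWo.mem_nhds hq)
    have hcV : ContinuousAt (fun q : ℝ × ℝ => V q (X q.1 q.2)) q :=
      ((hV.continuousOn.mono hWΩ).clm_apply hcont).continuousAt (hWo.mem_nhds hq)
    have := hasStrictFDerivAt_uncurry_coprod (𝕜 := ℝ) (u := q) (f := X)
      (f₁ := fun u v => (ContinuousLinearMap.id ℝ ℝ).smulRight (U (u, v) (X u v)))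
      (f₂ := fun u v => (ContinuousLinearMap.id ℝ ℝ).smulRight (V (u, v) (X u v)))
      (by
        filter_upwards [hWo.mem_nhds hq] with w hw
        exact (hdu w.1 hw.1 w.2 hw.2).hasFDerivAt)
      (by
        filter_upwards [hWo.mem_nhds hq] with w hw
        exact (hdv w.1 hw.1 w.2 hw.2).hasFDerivAt)
      (((ContinuousLinearMap.smulRightL ℝ ℝ E (ContinuousLinearMap.id ℝ ℝ)).continuous.tendsto
        _).comp hcU)
      (((ContinuousLinearMap.smulRightL ℝ ℝ E (ContinuousLinearMap.id ℝ ℝ)).continuous.tendsto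
        _).comp hcV)
    refine this.hasFDerivAt.congr_fderiv ?_
    ext <;> simp [Function.HasUncurry.uncurry]
  refine ⟨W, hWo, (convex_Ioo _ _).prod (convex_Ioo _ _),
    ⟨⟨by linarith, by linarith⟩, ⟨by linarith, by linarith⟩⟩, hWΩ, fun q => X q.1 q.2, ?_,
    contDiffOn_of_hasFDerivAt_clm hWo (hU.mono hWΩ) (hV.mono hWΩ) hfd, fun q hq => ?_⟩
  · simp only [(hX a haI).1, hx0]
  · rw [(hfd q hq).fderiv]
    simp

/-- A solution of a linear total differential equation on a convex open set which vanishes at one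
point vanishes identically. -/
theorem eq_zero_of_linear_system {Z : ℝ × ℝ → E} {U V : ℝ × ℝ → E →L[ℝ] E} {W : Set (ℝ × ℝ)}
    (hWo : IsOpen W) (hW : Convex ℝ W) (hU : ContinuousOn U W) (hV : ContinuousOn V W)
    (hZ : DifferentiableOn ℝ Z W)
    (hZu : ∀ q ∈ W, fderiv ℝ Z q (1, 0) = U q (Z q))
    (hZv : ∀ q ∈ W, fderiv ℝ Z q (0, 1) = V q (Z q)) {p : ℝ × ℝ} (hp : p ∈ W) (h0 : Z p = 0) :
    ∀ q ∈ W, Z q = 0 := by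
  intro q hq
  have hγ : ∀ t ∈ Icc (0 : ℝ) 1, p + t • (q - p) ∈ W := fun t ht =>
    hW.add_smul_sub_mem hp hq ht
  have hγc : Continuous fun t : ℝ => p + t • (q - p) := by fun_prop
  have hUγ : ContinuousOn (fun t : ℝ => U (p + t • (q - p))) (Icc 0 1) :=
    ContinuousOn.comp (g := U) hU hγc.continuousOn hγ
  have hVγ : ContinuousOn (fun t : ℝ => V (p + t • (q - p))) (Icc 0 1) :=
    ContinuousOn.comp (g := V) hV hγc.continuousOn hγ
  -- Along the segment from p to q the system becomes one linear differential equation with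
  -- coefficient A, to which Grönwall uniqueness applies. The existential keeps A opaque.
  obtain ⟨A, hA⟩ : ∃ A : ℝ → E →L[ℝ] E, A = fun t =>
    (q - p).1 • U (p + t • (q - p)) + (q - p).2 • V (p + t • (q - p)) := ⟨_, rfl⟩
  have hAc : ContinuousOn A (Icc 0 1) := by
    rw [hA]
    exact (hUγ.const_smul (q - p).1).add (hVγ.const_smul (q - p).2)
  obtain ⟨K, hK⟩ := isCompact_Icc.exists_bound_of_continuousOn hAc
  have hd : ∀ t ∈ Icc (0 : ℝ) 1,
      HasDerivAt (fun t => Z (p + t • (q - p))) (A t (Z (p + t • (q - p)))) t := by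
    intro t ht
    have h1 := ((hZ _ (hγ t ht)).differentiableAt (hWo.mem_nhds (hγ t ht))).hasFDerivAt
    have h2 : HasDerivAt (fun t : ℝ => p + t • (q - p)) ((1 : ℝ) • (q - p)) t :=
      ((hasDerivAt_id t).smul_const _).const_add _
    have h3 := h1.comp_hasDerivAt t h2
    refine h3.congr_deriv ?_
    have hdec : q - p = (q - p).1 • ((1, 0) : ℝ × ℝ) + (q - p).2 • ((0, 1) : ℝ × ℝ) := by
      ext <;> simp
    rw [one_smul, congrArg (fderiv ℝ Z (p + t • (q - p))) hdec]
    rw [map_add, map_smul, map_smul, hZu _ (hγ t ht), hZv _ (hγ t ht), hA]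
    rfl
  have := eq_zero_of_abs_deriv_le_mul_abs_self_of_eq_zero_right (K := K)
    (f := fun t => Z (p + t • (q - p))) (f' := fun t => A t (Z (p + t • (q - p))))
    (a := 0) (b := 1)
    (fun t ht => (hd t ht).continuousAt.continuousWithinAt)
    (fun t ht => (hd t (Ico_subset_Icc_self ht)).hasDerivWithinAt) (by simpa using h0)
    (fun t ht => (A t).le_of_opNorm_le (hK t (Ico_subset_Icc_self ht)) _) 1
    (right_mem_Icc.2 zero_le_one)
  simpa using this

end Frobenius

/-! ### Calculus in a chart -/

section ChartCalculus

open Set Filter Topology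

variable {M : Type*} [TopologicalSpace M]
variable {F G H : Type*} [NormedAddCommGroup F] [NormedSpace ℝ F] [NormedAddCommGroup G]
  [NormedSpace ℝ G] [NormedAddCommGroup H] [NormedSpace ℝ H]

/-- `f` is smooth at `p` when expressed in the chart `e`. -/
def ChartSmoothAt (e : Chart M) (f : M → F) (p : M) : Prop :=
  ContDiffAt ℝ ∞ (fun x => f (e.symm x)) (e p)

variable {e : Chart M} {p : M} {f g : M → F} {w w' : ℝ × ℝ}

omit [NormedAddCommGroup F] [NormedSpace ℝ F] in
theorem eventuallyEq_comp_symm (hp : p ∈ e.source) (h : f =ᶠ[𝓝 p] g) :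
    (fun x => f (e.symm x)) =ᶠ[𝓝 (e p)] fun x => g (e.symm x) :=
  (e.tendsto_symm hp).eventually h

theorem ChartSmoothAt.congr (hp : p ∈ e.source) (hf : ChartSmoothAt e f p) (h : f =ᶠ[𝓝 p] g) :
    ChartSmoothAt e g p :=
  ContDiffAt.congr_of_eventuallyEq hf (eventuallyEq_comp_symm hp h.symm)

theorem coordDeriv_congr (hp : p ∈ e.source) (h : f =ᶠ[𝓝 p] g) :
    coordDeriv w e f p = coordDeriv w e g p := by
  simp only [coordDeriv, (eventuallyEq_comp_symm hp h).fderiv_eq]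

theorem eventually_coordDeriv_congr (hp : p ∈ e.source) (h : f =ᶠ[𝓝 p] g) :
    coordDeriv w e f =ᶠ[𝓝 p] coordDeriv w e g := by
  filter_upwards [h.eventuallyEq_nhds, e.open_source.mem_nhds hp] with q hq hqe
  exact coordDeriv_congr hqe hq

theorem ChartSmoothAt.differentiableAt (hf : ChartSmoothAt e f p) :
    DifferentiableAt ℝ (fun x => f (e.symm x)) (e p) :=
  ContDiffAt.differentiableAt hf (by simp)

theorem ChartSmoothAt.hasFDerivAt (hf : ChartSmoothAt e f p) :
    HasFDerivAt (fun x => f (e.symm x)) (fderiv ℝ (fun x => f (e.symm x)) (e p)) (e p) :=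
  hf.differentiableAt.hasFDerivAt

theorem chartSmoothAt_const (c : F) : ChartSmoothAt e (fun _ => c) p := contDiffAt_const

theorem ChartSmoothAt.clm_comp (hf : ChartSmoothAt e f p) (L : F →L[ℝ] G) :
    ChartSmoothAt e (fun q => L (f q)) p :=
  L.contDiff.contDiffAt.comp (e p) hf

theorem ChartSmoothAt.bilin {g : M → G} (hf : ChartSmoothAt e f p) (hg : ChartSmoothAt e g p)
    (B : F →L[ℝ] G →L[ℝ] H) : ChartSmoothAt e (fun q => B (f q) (g q)) p :=
  ContDiffAt.clm_apply (hf.clm_comp B) hg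

theorem ChartSmoothAt.add (hf : ChartSmoothAt e f p) (hg : ChartSmoothAt e g p) :
    ChartSmoothAt e (fun q => f q + g q) p :=
  ContDiffAt.add hf hg

theorem ChartSmoothAt.sub (hf : ChartSmoothAt e f p) (hg : ChartSmoothAt e g p) :
    ChartSmoothAt e (fun q => f q - g q) p :=
  ContDiffAt.sub hf hg

theorem ChartSmoothAt.neg (hf : ChartSmoothAt e f p) : ChartSmoothAt e (fun q => -f q) p :=
  ContDiffAt.neg hf

theorem ChartSmoothAt.smul {a : M → ℝ} (ha : ChartSmoothAt e a p) (hf : ChartSmoothAt e f p) :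
    ChartSmoothAt e (fun q => a q • f q) p :=
  ContDiffAt.smul ha hf

theorem ChartSmoothAt.mul {a b : M → ℝ} (ha : ChartSmoothAt e a p) (hb : ChartSmoothAt e b p) :
    ChartSmoothAt e (fun q => a q * b q) p :=
  ContDiffAt.mul ha hb

theorem ChartSmoothAt.sum {ι : Type*} {s : Finset ι} {f : ι → M → F}
    (hf : ∀ i ∈ s, ChartSmoothAt e (f i) p) : ChartSmoothAt e (fun q => ∑ i ∈ s, f i q) p :=
  ContDiffAt.sum hf

theorem coordDeriv_const (c : F) : coordDeriv w e (fun _ => c) p = 0 := by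
  simp [coordDeriv]

theorem coordDeriv_clm_comp (hf : ChartSmoothAt e f p) (L : F →L[ℝ] G) :
    coordDeriv w e (fun q => L (f q)) p = L (coordDeriv w e f p) := by
  have := (L.hasFDerivAt.comp (e p) hf.hasFDerivAt).fderiv
  exact congrArg (fun T : ℝ × ℝ →L[ℝ] G => T w) this

theorem coordDeriv_bilin {g : M → G} (hp : p ∈ e.source) (hf : ChartSmoothAt e f p)
    (hg : ChartSmoothAt e g p) (B : F →L[ℝ] G →L[ℝ] H) :
    coordDeriv w e (fun q => B (f q) (g q)) p =
      B (coordDeriv w e f p) (g p) + B (f p) (coordDeriv w e g p) := by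
  have := (B.hasFDerivAt_of_bilinear hf.hasFDerivAt hg.hasFDerivAt).fderiv
  have h2 := congrArg (fun T : ℝ × ℝ →L[ℝ] H => T w) this
  simp only [e.left_inv hp] at h2
  simp only [coordDeriv, h2]
  simp [add_comm]

theorem coordDeriv_add (hf : ChartSmoothAt e f p) (hg : ChartSmoothAt e g p) :
    coordDeriv w e (fun q => f q + g q) p = coordDeriv w e f p + coordDeriv w e g p :=
  congrArg (fun T : ℝ × ℝ →L[ℝ] F => T w) (hf.hasFDerivAt.add hg.hasFDerivAt).fderiv

theorem coordDeriv_sub (hf : ChartSmoothAt e f p) (hg : ChartSmoothAt e g p) :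
    coordDeriv w e (fun q => f q - g q) p = coordDeriv w e f p - coordDeriv w e g p :=
  congrArg (fun T : ℝ × ℝ →L[ℝ] F => T w) (hf.hasFDerivAt.sub hg.hasFDerivAt).fderiv

theorem coordDeriv_neg (hf : ChartSmoothAt e f p) :
    coordDeriv w e (fun q => -f q) p = -coordDeriv w e f p :=
  congrArg (fun T : ℝ × ℝ →L[ℝ] F => T w) hf.hasFDerivAt.neg.fderiv

theorem coordDeriv_smul (hp : p ∈ e.source) {a : M → ℝ} (ha : ChartSmoothAt e a p)
    (hf : ChartSmoothAt e f p) :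
    coordDeriv w e (fun q => a q • f q) p =
      coordDeriv w e a p • f p + a p • coordDeriv w e f p :=
  coordDeriv_bilin hp ha hf (ContinuousLinearMap.lsmul ℝ ℝ)

theorem coordDeriv_mul (hp : p ∈ e.source) {a b : M → ℝ} (ha : ChartSmoothAt e a p)
    (hb : ChartSmoothAt e b p) :
    coordDeriv w e (fun q => a q * b q) p =
      coordDeriv w e a p * b p + a p * coordDeriv w e b p :=
  coordDeriv_smul hp ha hb

theorem coordDeriv_const_mul {a : M → ℝ} (ha : ChartSmoothAt e a p) (c : ℝ) :
    coordDeriv w e (fun q => c * a q) p = c * coordDeriv w e a p :=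
  coordDeriv_clm_comp ha (c • ContinuousLinearMap.id ℝ ℝ)

theorem coordDeriv_const_smul (hf : ChartSmoothAt e f p) (c : ℝ) :
    coordDeriv w e (fun q => c • f q) p = c • coordDeriv w e f p :=
  coordDeriv_clm_comp hf (c • ContinuousLinearMap.id ℝ F)

theorem coordDeriv_sum {ι : Type*} {s : Finset ι} {f : ι → M → F}
    (hf : ∀ i ∈ s, ChartSmoothAt e (f i) p) :
    coordDeriv w e (fun q => ∑ i ∈ s, f i q) p = ∑ i ∈ s, coordDeriv w e (f i) p := by
  have := (HasFDerivAt.fun_sum fun i hi => (hf i hi).hasFDerivAt).fderiv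
  have h2 := congrArg (fun T : ℝ × ℝ →L[ℝ] F => T w) this
  simpa [coordDeriv] using h2

/-- `coordDeriv` evaluates at `e (e.symm x)`, which is x only on the target. This local
identification turns iterated coordinate derivatives into iterated derivatives in the plane. -/
theorem coordDeriv_comp_symm_eventuallyEq (hp : p ∈ e.source) :
    (fun x => coordDeriv w e f (e.symm x)) =ᶠ[𝓝 (e p)]
      fun x => fderiv ℝ (fun x => f (e.symm x)) x w := by
  filter_upwards [e.open_target.mem_nhds (e.map_source hp)] with x hx
  simp only [coordDeriv, e.right_inv hx]

theorem ChartSmoothAt.coordDeriv (hp : p ∈ e.source) (hf : ChartSmoothAt e f p) :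
    ChartSmoothAt e (coordDeriv w e f) p := by
  have h1 : ContDiffAt ℝ ∞ (fderiv ℝ fun x => f (e.symm x)) (e p) :=
    ContDiffAt.fderiv_right hf (by simp)
  exact (h1.clm_apply contDiffAt_const).congr_of_eventuallyEq
    (coordDeriv_comp_symm_eventuallyEq hp)

/-- This is the symmetry of the second derivative; since w and w' are constant vectors, no first
order term appears. -/
theorem coordDeriv_comm (hp : p ∈ e.source) (hf : ChartSmoothAt e f p) :
    coordDeriv w e (coordDeriv w' e f) p = coordDeriv w' e (coordDeriv w e f) p := by
  have h1 : ContDiffAt ℝ ∞ (fderiv ℝ fun x => f (e.symm x)) (e p) :=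
    ContDiffAt.fderiv_right hf (by simp)
  have hd := h1.differentiableAt (by simp)
  have h2 : ∀ w w' : ℝ × ℝ, _root_.coordDeriv w e (_root_.coordDeriv w' e f) p =
      fderiv ℝ (fderiv ℝ fun x => f (e.symm x)) (e p) w w' := by
    intro w w'
    rw [_root_.coordDeriv, (coordDeriv_comp_symm_eventuallyEq hp).fderiv_eq,
      fderiv_clm_apply hd (differentiableAt_const _)]
    simp
  have hs : IsSymmSndFDerivAt ℝ (fun x => f (e.symm x)) (e p) :=
    ContDiffAt.isSymmSndFDerivAt hf (by
    rw [minSmoothness_of_isRCLikeNormedField]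
    exact WithTop.coe_le_coe.2 le_top)
  rw [h2, h2, hs.eq]

theorem chartSmoothAt_of_comp {h : ℝ × ℝ → F} (hp : p ∈ e.source) (hh : ContDiffAt ℝ ∞ h (e p)) :
    ChartSmoothAt e (fun q => h (e q)) p := by
  refine ContDiffAt.congr_of_eventuallyEq hh ?_
  filter_upwards [e.open_target.mem_nhds (e.map_source hp)] with x hx
  rw [e.right_inv hx]

theorem coordDeriv_of_comp {h : ℝ × ℝ → F} (hp : p ∈ e.source) :
    coordDeriv w e (fun q => h (e q)) p = fderiv ℝ h (e p) w := by
  have : (fun x => h (e (e.symm x))) =ᶠ[𝓝 (e p)] h := by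
    filter_upwards [e.open_target.mem_nhds (e.map_source hp)] with x hx
    rw [e.right_inv hx]
  rw [coordDeriv, this.fderiv_eq]

/-- A function with vanishing partial derivatives is locally constant. -/
theorem eventually_eq_of_coordDeriv_eq_zero (hp : p ∈ e.source)
    (h : ∀ᶠ q in 𝓝 p, ChartSmoothAt e f q ∧ pu e f q = 0 ∧ pv e f q = 0) :
    ∀ᶠ q in 𝓝 p, f q = f p := by
  have h1 := (e.tendsto_symm hp).eventually h
  obtain ⟨δ, hδ, hball⟩ := Metric.eventually_nhds_iff_ball.1
    (h1.and (e.open_target.eventually_mem (e.map_source hp)))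
  have hd : ∀ x ∈ Metric.ball (e p) δ, DifferentiableAt ℝ (fun x => f (e.symm x)) x := by
    intro x hx
    have := (hball x hx).1.1.differentiableAt
    rwa [e.right_inv (hball x hx).2] at this
  have hz : ∀ x ∈ Metric.ball (e p) δ, fderiv ℝ (fun x => f (e.symm x)) x = 0 := by
    intro x hx
    have h2 := (hball x hx).1.2
    simp only [pu, pv, _root_.coordDeriv, e.right_inv (hball x hx).2] at h2
    refine ContinuousLinearMap.prod_ext ?_ ?_ <;> ext <;> simp [h2.1, h2.2]
  filter_upwards [(e.continuousAt hp).preimage_mem_nhds (Metric.ball_mem_nhds (e p) hδ),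
    e.open_source.mem_nhds hp] with q hq hqe
  have := (convex_ball (e p) δ).is_const_of_fderivWithin_eq_zero (𝕜 := ℝ)
    (f := fun x => f (e.symm x)) (fun x hx => (hd x hx).differentiableWithinAt)
    (fun x hx => by
      rw [fderivWithin_of_isOpen Metric.isOpen_ball hx, hz x hx]) hq (Metric.mem_ball_self hδ)
  simpa only [e.left_inv hqe, e.left_inv hp] using this

end ChartCalculus

/-! ### Change of charts -/

section ChangeOfCharts

open Set Filter Topology

variable {M : Type*} [TopologicalSpace M] [ChartedSpace (ℝ × ℝ) M] (hM : IsLorentzSurface M)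
variable {F : Type*} [NormedAddCommGroup F] [NormedSpace ℝ F]
variable {e e' e'' : Chart M} {p : M} {f : M → F}

include hM

theorem IsLorentzSurface.chartSmoothAt_chart (he : e ∈ atlas (ℝ × ℝ) M)
    (he' : e' ∈ atlas (ℝ × ℝ) M) (hp : p ∈ e.source ∩ e'.source) :
    ChartSmoothAt e' (fun q => e q) p := by
  refine (hM.smooth e he e' he').contDiffAt ((e'.symm.trans e).open_source.mem_nhds ?_)
  simp [e'.map_source hp.2, e'.left_inv hp.2, hp.1]

theorem IsLorentzSurface.chartSmoothAt_change (he : e ∈ atlas (ℝ × ℝ) M)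
    (he' : e' ∈ atlas (ℝ × ℝ) M) (hp : p ∈ e.source ∩ e'.source) (hf : ChartSmoothAt e f p) :
    ChartSmoothAt e' f p := by
  have h1 := hM.chartSmoothAt_chart he he' hp
  have h2 : ContDiffAt ℝ ∞ (fun x => f (e.symm (e (e'.symm x)))) (e' p) := by
    refine ContDiffAt.comp (e' p) (g := fun x => f (e.symm x)) ?_ h1
    rw [e'.left_inv hp.2]
    exact hf
  refine h2.congr_of_eventuallyEq ?_
  filter_upwards [eventuallyEq_comp_symm hp.2 (f := fun q => f q) (g := fun q => f (e.symm (e q)))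
    (by filter_upwards [e.open_source.mem_nhds hp.1] with q hq; rw [e.left_inv hq])] with x hx
  exact hx

theorem IsLorentzSurface.coordDeriv_change (he : e ∈ atlas (ℝ × ℝ) M)
    (he' : e' ∈ atlas (ℝ × ℝ) M) (hp : p ∈ e.source ∩ e'.source) (hf : ChartSmoothAt e f p)
    (w : ℝ × ℝ) :
    coordDeriv w e' f p = coordDeriv w e' (fun q => (e q).1) p • pu e f p +
      coordDeriv w e' (fun q => (e q).2) p • pv e f p := by
  have h1 := hM.chartSmoothAt_chart he he' hp
  have hcomp : HasFDerivAt (fun x => f (e.symm (e (e'.symm x)))) _ (e' p) :=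
    HasFDerivAt.comp (e' p) (g := fun x => f (e.symm x))
      (g' := fderiv ℝ (fun x => f (e.symm x)) (e p)) (by
        rw [e'.left_inv hp.2]
        exact hf.hasFDerivAt) h1.hasFDerivAt
  have heq : (fun x => f (e'.symm x)) =ᶠ[𝓝 (e' p)] fun x => f (e.symm (e (e'.symm x))) :=
    eventuallyEq_comp_symm hp.2 (f := f) (g := fun q => f (e.symm (e q)))
      (by filter_upwards [e.open_source.mem_nhds hp.1] with q hq; rw [e.left_inv hq])
  have e1 : coordDeriv w e' (fun q => (e q).1) p = (coordDeriv w e' (fun q => e q) p).1 :=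
    coordDeriv_clm_comp h1 (ContinuousLinearMap.fst ℝ ℝ ℝ)
  have e2 : coordDeriv w e' (fun q => (e q).2) p = (coordDeriv w e' (fun q => e q) p).2 :=
    coordDeriv_clm_comp h1 (ContinuousLinearMap.snd ℝ ℝ ℝ)
  have hdec : coordDeriv w e' (fun q => e q) p =
      (coordDeriv w e' (fun q => e q) p).1 • ((1, 0) : ℝ × ℝ) +
        (coordDeriv w e' (fun q => e q) p).2 • ((0, 1) : ℝ × ℝ) := by
    ext <;> simp
  rw [e1, e2]
  conv_lhs => rw [coordDeriv, heq.fderiv_eq, hcomp.fderiv]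
  change fderiv ℝ (fun x => f (e.symm x)) (e p) (coordDeriv w e' (fun q => e q) p) = _
  conv_lhs => rw [hdec, map_add, map_smul, map_smul]
  rfl

/-- In the chain rule the term with ∂v/∂ũ drops out, because v depends locally on ṽ alone. Hence the
two null directions rescale independently. -/
theorem IsLorentzSurface.pu_change (he : e ∈ atlas (ℝ × ℝ) M) (he' : e' ∈ atlas (ℝ × ℝ) M)
    (hp : p ∈ e.source ∩ e'.source) (hf : ChartSmoothAt e f p) :
    pu e' f p = jacU e e' p • pu e f p := by
  have h0 : coordDeriv (1, 0) e' (fun q => (e q).2) p = 0 := hM.null_v e he e' he' p hp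
  rw [pu, hM.coordDeriv_change he he' hp hf, h0, zero_smul, add_zero]
  rfl

theorem IsLorentzSurface.pv_change (he : e ∈ atlas (ℝ × ℝ) M) (he' : e' ∈ atlas (ℝ × ℝ) M)
    (hp : p ∈ e.source ∩ e'.source) (hf : ChartSmoothAt e f p) :
    pv e' f p = jacV e e' p • pv e f p := by
  have h0 : coordDeriv (0, 1) e' (fun q => (e q).1) p = 0 := hM.null_u e he e' he' p hp
  rw [pv, hM.coordDeriv_change he he' hp hf, h0, zero_smul, zero_add]
  rfl

/-- Transition maps are smooth, so one chart around each point decides smoothness. Openness of U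
makes smoothness on the set equivalent to smoothness at its points. -/
theorem smoothOnSurface_iff {U : Set M} (hU : IsOpen U) :
    SmoothOnSurface U f ↔
      ∀ p ∈ U, ∃ e ∈ atlas (ℝ × ℝ) M, p ∈ e.source ∧ ChartSmoothAt e f p := by
  constructor
  · intro h p hp
    refine ⟨chartAt _ p, chart_mem_atlas _ p, mem_chart_source _ p, ?_⟩
    refine (h _ (chart_mem_atlas _ p)).contDiffAt
      (((chartAt (ℝ × ℝ) p).isOpen_inter_preimage_symm hU).mem_nhds ?_)
    simp [hp]
  · intro h e he x hx
    obtain ⟨e', he', hpe', hf⟩ := h _ hx.2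
    have := hM.chartSmoothAt_change he' he ⟨hpe', e.map_target hx.1⟩ hf
    rw [ChartSmoothAt, e.right_inv hx.1] at this
    exact this.contDiffWithinAt

omit hM in
theorem SmoothOnSurface.chartSmoothAt {U : Set M} (h : SmoothOnSurface U f) (hU : IsOpen U)
    (hp : p ∈ U) (he : e ∈ atlas (ℝ × ℝ) M) (hpe : p ∈ e.source) : ChartSmoothAt e f p := by
  refine (h e he).contDiffAt ((e.isOpen_inter_preimage_symm hU).mem_nhds ?_)
  simp [hp, e.map_source hpe, e.left_inv hpe]

omit hM in
theorem SmoothOnSurface.mono {U V : Set M} (h : SmoothOnSurface U f) (hVU : V ⊆ U) :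
    SmoothOnSurface V f :=
  fun e he => (h e he).mono fun _ hx => ⟨hx.1, hVU hx.2⟩

theorem IsLorentzSurface.chartSmoothAt_jacU (he : e ∈ atlas (ℝ × ℝ) M)
    (he' : e' ∈ atlas (ℝ × ℝ) M) (hp : p ∈ e.source ∩ e'.source) :
    ChartSmoothAt e' (jacU e e') p :=
  ChartSmoothAt.coordDeriv hp.2
    ((hM.chartSmoothAt_chart he he' hp).clm_comp (ContinuousLinearMap.fst ℝ ℝ ℝ))

theorem IsLorentzSurface.chartSmoothAt_jacV (he : e ∈ atlas (ℝ × ℝ) M)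
    (he' : e' ∈ atlas (ℝ × ℝ) M) (hp : p ∈ e.source ∩ e'.source) :
    ChartSmoothAt e' (jacV e e') p :=
  ChartSmoothAt.coordDeriv hp.2
    ((hM.chartSmoothAt_chart he he' hp).clm_comp (ContinuousLinearMap.snd ℝ ℝ ℝ))

omit hM [ChartedSpace (ℝ × ℝ) M] in
theorem jacU_self (hp : p ∈ e.source) : jacU e e p = 1 := by
  rw [jacU, pu, coordDeriv_of_comp (h := Prod.fst) hp, fderiv_fst]
  rfl

omit hM [ChartedSpace (ℝ × ℝ) M] in
theorem jacV_self (hp : p ∈ e.source) : jacV e e p = 1 := by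
  rw [jacV, pv, coordDeriv_of_comp (h := Prod.snd) hp, fderiv_snd]
  rfl

/-- This is `pu_change` applied to the first coordinate function of e. -/
theorem IsLorentzSurface.jacU_mul (he : e ∈ atlas (ℝ × ℝ) M) (he' : e' ∈ atlas (ℝ × ℝ) M)
    (he'' : e'' ∈ atlas (ℝ × ℝ) M) (hp : p ∈ e.source ∩ e'.source ∩ e''.source) :
    jacU e e' p * jacU e' e'' p = jacU e e'' p := by
  have := hM.pu_change he' he'' ⟨hp.1.2, hp.2⟩ (f := fun q => (e q).1)
    ((hM.chartSmoothAt_chart he he' hp.1).clm_comp (ContinuousLinearMap.fst ℝ ℝ ℝ))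
  rw [mul_comm]
  exact this.symm

theorem IsLorentzSurface.jacV_mul (he : e ∈ atlas (ℝ × ℝ) M) (he' : e' ∈ atlas (ℝ × ℝ) M)
    (he'' : e'' ∈ atlas (ℝ × ℝ) M) (hp : p ∈ e.source ∩ e'.source ∩ e''.source) :
    jacV e e' p * jacV e' e'' p = jacV e e'' p := by
  have := hM.pv_change he' he'' ⟨hp.1.2, hp.2⟩ (f := fun q => (e q).2)
    ((hM.chartSmoothAt_chart he he' hp.1).clm_comp (ContinuousLinearMap.snd ℝ ℝ ℝ))
  rw [mul_comm]
  exact this.symm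

theorem IsLorentzSurface.chartSmoothAt_jac_mul (he : e ∈ atlas (ℝ × ℝ) M)
    (he' : e' ∈ atlas (ℝ × ℝ) M) (hp : p ∈ e.source ∩ e'.source) :
    ChartSmoothAt e' (fun q => jacU e e' q * jacV e e' q) p :=
  (hM.chartSmoothAt_jacU he he' hp).mul (hM.chartSmoothAt_jacV he he' hp)

theorem IsLorentzSurface.chartSmoothAt_confFactor (he : e ∈ atlas (ℝ × ℝ) M)
    (he' : e' ∈ atlas (ℝ × ℝ) M) (hp : p ∈ e.source ∩ e'.source) :
    ChartSmoothAt e' (confFactor e e') p := by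
  refine ContDiffAt.div_const (ContDiffAt.log (hM.chartSmoothAt_jac_mul he he' hp) ?_) 2
  simpa [e'.left_inv hp.2] using (hM.conformal e he e' he' p hp).ne'

theorem IsLorentzSurface.confFactor_add (he : e ∈ atlas (ℝ × ℝ) M) (he' : e' ∈ atlas (ℝ × ℝ) M)
    (he'' : e'' ∈ atlas (ℝ × ℝ) M) (hp : p ∈ e.source ∩ e'.source ∩ e''.source) :
    confFactor e e' p + confFactor e' e'' p = confFactor e e'' p := by
  have h1 := hM.conformal e he e' he' p hp.1
  have h2 := hM.conformal e' he' e'' he'' p ⟨hp.1.2, hp.2⟩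
  rw [confFactor, confFactor, confFactor, ← add_div, ← Real.log_mul h1.ne' h2.ne',
    ← hM.jacU_mul he he' he'' hp, ← hM.jacV_mul he he' he'' hp]
  congr 2
  ring

omit hM [ChartedSpace (ℝ × ℝ) M] in
theorem confFactor_self (hp : p ∈ e.source) : confFactor e e p = 0 := by
  simp [confFactor, jacU_self hp, jacV_self hp]

/-- The two weights differ only in which Jacobian factor is squared, so j stands for `jacU` or
`jacV`. The cocycle identity follows from multiplicativity of j and of the product under the square
root. -/
theorem isLineBundleCocycle_of_jac {j : Chart M → Chart M → M → ℝ}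
    (hj : ∀ e ∈ atlas (ℝ × ℝ) M, ∀ e' ∈ atlas (ℝ × ℝ) M, ∀ p ∈ e.source ∩ e'.source,
      ChartSmoothAt e' (j e e') p ∧ j e e' p ≠ 0)
    (hj1 : ∀ e ∈ atlas (ℝ × ℝ) M, ∀ p ∈ e.source, j e e p = 1)
    (hjm : ∀ e ∈ atlas (ℝ × ℝ) M, ∀ e' ∈ atlas (ℝ × ℝ) M, ∀ e'' ∈ atlas (ℝ × ℝ) M,
      ∀ p ∈ e.source ∩ e'.source ∩ e''.source, j e e' p * j e' e'' p = j e e'' p) :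
    IsLineBundleCocycle (M := M)
      fun e e' p => j e e' p ^ 2 / Real.sqrt (jacU e e' p * jacV e e' p) := by
  refine ⟨fun e he e' he' => ⟨?_, fun p hp => ?_⟩, fun e he p hp => ?_,
    fun e he e' he' e'' he'' p hp => ?_⟩
  · refine (smoothOnSurface_iff hM (e.open_source.inter e'.open_source)).2 fun p hp =>
      ⟨e', he', hp.2, ?_⟩
    have hpos := hM.conformal e he e' he' p hp
    refine ContDiffAt.div ((hj e he e' he' p hp).1.pow 2)
      (ContDiffAt.sqrt (hM.chartSmoothAt_jac_mul he he' hp) ?_) ?_ <;>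
      simp only [e'.left_inv hp.2]
    exacts [hpos.ne', (Real.sqrt_pos.2 hpos).ne']
  · exact div_ne_zero (pow_ne_zero 2 (hj e he e' he' p hp).2)
      (Real.sqrt_pos.2 (hM.conformal e he e' he' p hp)).ne'
  · simp [hj1 e he p hp, jacU_self hp, jacV_self hp]
  · have h1 := hM.conformal e he e' he' p hp.1
    beta_reduce
    rw [div_mul_div_comm, ← Real.sqrt_mul h1.le, ← mul_pow, hjm e he e' he' e'' he'' p hp,
      ← hM.jacU_mul he he' he'' hp, ← hM.jacV_mul he he' he'' hp]
    congr 2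
    ring

theorem isLineBundleCocycle_weight₁ : IsLineBundleCocycle (M := M) weight₁ :=
  isLineBundleCocycle_of_jac hM
    (fun _ he _ he' _ hp => ⟨hM.chartSmoothAt_jacU he he' hp,
      left_ne_zero_of_mul (hM.conformal _ he _ he' _ hp).ne'⟩)
    (fun _ _ _ hp => jacU_self hp) fun _ he _ he' _ he'' _ hp => hM.jacU_mul he he' he'' hp

theorem isLineBundleCocycle_weight₂ : IsLineBundleCocycle (M := M) weight₂ :=
  isLineBundleCocycle_of_jac hM
    (fun _ he _ he' _ hp => ⟨hM.chartSmoothAt_jacV he he' hp,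
      right_ne_zero_of_mul (hM.conformal _ he _ he' _ hp).ne'⟩)
    (fun _ _ _ hp => jacV_self hp) fun _ he _ he' _ he'' _ hp => hM.jacV_mul he he' he'' hp

end ChangeOfCharts

/-! ### Null frames of the pseudo-Euclidean space -/

section Frames

open Set Filter Topology Module

variable {n r : ℕ}

theorem ambientForm_comm (x z : Ambient n) : ambientForm n r x z = ambientForm n r z x := by
  simp only [ambientForm_apply, mul_comm (x _)]

/-- The inner product as a continuous bilinear map. -/
def ambientFormL (n r : ℕ) : Ambient n →L[ℝ] Ambient n →L[ℝ] ℝ :=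
  LinearMap.toContinuousLinearMap
    ((LinearMap.toContinuousLinearMap : (Ambient n →ₗ[ℝ] ℝ) ≃ₗ[ℝ] _).toLinearMap ∘ₗ
      ambientForm n r)

theorem ambientFormL_apply (x z : Ambient n) : ambientFormL n r x z = ambientForm n r x z := rfl

theorem ambientForm_single (i j : Fin (n + 2)) :
    ambientForm n r (Pi.single i 1) (Pi.single j 1) =
      if i = j then (if (i : ℕ) + r < n + 1 then 1 else -1) else 0 := by
  rw [ambientForm_apply, Finset.sum_eq_single i]
  · by_cases h : i = j
    · subst h; simp
    · simp [h]
  · intro k _ hk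
    simp [hk]
  · simp

/-- The index set of a frame adapted to a timelike surface: the vectors `Y, Y_u, Y_v, N` and a normal
frame. -/
abbrev FrameIndex (n : ℕ) : Type := Fin 4 ⊕ Fin (n - 2)

/-- The Gram matrix of an adapted frame whose normal part is orthonormal with signs `ε`. -/
def frameGram (ε : Fin (n - 2) → ℝ) : FrameIndex n → FrameIndex n → ℝ
  | .inl i, .inl j => !![0, 0, 0, -1; 0, 0, 1 / 2, 0; 0, 1 / 2, 0, 0; -1, 0, 0, 0] i j
  | .inr α, .inr β => if α = β then ε α else 0
  | _, _ => 0

/-- The index of the frame vector which is dual, up to a factor, to the given one. -/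
def dualIndex : FrameIndex n → FrameIndex n
  | .inl i => .inl i.rev
  | .inr α => .inr α

/-- The factor which makes the dual frame vectors into the dual basis. -/
def dualWeight (ε : Fin (n - 2) → ℝ) : FrameIndex n → ℝ
  | .inl i => ![-1, 2, 2, -1] i
  | .inr α => ε α

variable {ε : Fin (n - 2) → ℝ}

theorem frameGram_dual (hε : ∀ α, ε α * ε α = 1) (i j : FrameIndex n) :
    dualWeight ε j * frameGram ε i (dualIndex j) = if i = j then 1 else 0 := by
  rcases i with i | α <;> rcases j with j | β
  · fin_cases i <;> fin_cases j <;> simp [dualWeight, frameGram, dualIndex, Fin.rev]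
  · simp [dualIndex, frameGram]
  · simp [dualIndex, frameGram]
  · by_cases h : α = β
    · subst h; simp [dualWeight, frameGram, dualIndex, hε]
    · simp [dualIndex, frameGram, h]

/-- `X` is an adapted frame. -/
def IsAdaptedFrame (r : ℕ) (ε : Fin (n - 2) → ℝ) (X : FrameIndex n → Ambient n) : Prop :=
  ∀ i j, ambientForm n r (X i) (X j) = frameGram ε i j

variable {X X' : FrameIndex n → Ambient n}

theorem IsAdaptedFrame.form_sum_left (hX : IsAdaptedFrame r ε X) (a : FrameIndex n → ℝ)
    (j : FrameIndex n) :
    ambientForm n r (∑ i, a i • X i) (X j) = ∑ i, a i * frameGram ε i j := by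
  simp only [map_sum, LinearMap.sum_apply, map_smul, LinearMap.smul_apply, hX _ _, smul_eq_mul]

/-- Pairing with the weighted dual vector isolates one coefficient. Linear independence and explicit
expansions both follow, without inverting the Gram matrix. -/
theorem IsAdaptedFrame.dual_sum (hX : IsAdaptedFrame r ε X) (hε : ∀ α, ε α * ε α = 1)
    (a : FrameIndex n → ℝ) (j : FrameIndex n) :
    dualWeight ε j * ambientForm n r (∑ i, a i • X i) (X (dualIndex j)) = a j := by
  rw [hX.form_sum_left, Finset.mul_sum]
  simp only [mul_left_comm (dualWeight ε j), frameGram_dual hε]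
  simp

theorem IsAdaptedFrame.linearIndependent (hX : IsAdaptedFrame r ε X)
    (hε : ∀ α, ε α * ε α = 1) : LinearIndependent ℝ X := by
  rw [Fintype.linearIndependent_iff]
  intro a ha j
  rw [← hX.dual_sum hε a j, ha]
  simp

theorem card_frameIndex (hn : 2 ≤ n) : Fintype.card (FrameIndex n) = finrank ℝ (Ambient n) := by
  simp
  omega

/-- The basis formed by an adapted frame. -/
def IsAdaptedFrame.basis (hX : IsAdaptedFrame r ε X) (hε : ∀ α, ε α * ε α = 1) (hn : 2 ≤ n) :
    Basis (FrameIndex n) ℝ (Ambient n) :=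
  haveI : Nonempty (FrameIndex n) := ⟨.inl 0⟩
  basisOfLinearIndependentOfCardEqFinrank (hX.linearIndependent hε) (card_frameIndex hn)

@[simp]
theorem IsAdaptedFrame.basis_apply (hX : IsAdaptedFrame r ε X) (hε : ∀ α, ε α * ε α = 1)
    (hn : 2 ≤ n) (i : FrameIndex n) : hX.basis hε hn i = X i := by
  simp [IsAdaptedFrame.basis]

theorem IsAdaptedFrame.sum_dual (hX : IsAdaptedFrame r ε X) (hε : ∀ α, ε α * ε α = 1)
    (hn : 2 ≤ n) (x : Ambient n) :
    ∑ i, (dualWeight ε i * ambientForm n r x (X (dualIndex i))) • X i = x := by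
  have hx : ∑ i, (hX.basis hε hn).repr x i • X i = x := by
    simpa using (hX.basis hε hn).sum_repr x
  conv_rhs => rw [← hx]
  refine Finset.sum_congr rfl fun j _ => ?_
  congr 1
  conv_lhs => rw [← hx]
  exact hX.dual_sum hε _ j

theorem IsAdaptedFrame.ext (hX : IsAdaptedFrame r ε X) (hε : ∀ α, ε α * ε α = 1) (hn : 2 ≤ n)
    {x z : Ambient n} (h : ∀ i, ambientForm n r x (X i) = ambientForm n r z (X i)) : x = z := by
  rw [← hX.sum_dual hε hn x, ← hX.sum_dual hε hn z]
  simp only [h]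

/-- Lowering an index with the Gram matrix just permutes and rescales the components; the skewness
and expansion computations use these explicit values. -/
theorem sum_frameGram (a : FrameIndex n → ℝ) :
    (∑ i, a i * frameGram ε i (.inl 0) = -a (.inl 3)) ∧
    (∑ i, a i * frameGram ε i (.inl 1) = a (.inl 2) / 2) ∧
    (∑ i, a i * frameGram ε i (.inl 2) = a (.inl 1) / 2) ∧
    (∑ i, a i * frameGram ε i (.inl 3) = -a (.inl 0)) ∧
    ∀ β, ∑ i, a i * frameGram ε i (.inr β) = a (.inr β) * ε β := by
  refine ⟨?_, ?_, ?_, ?_, fun β => ?_⟩ <;>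
    simp [Fintype.sum_sum_type, Fin.sum_univ_four, frameGram, div_eq_mul_inv]

/-- The expansion of a vector in an adapted frame is determined by its inner products with the
frame. -/
theorem IsAdaptedFrame.eq_sum (hX : IsAdaptedFrame r ε X) (hε : ∀ α, ε α * ε α = 1) (hn : 2 ≤ n)
    {x : Ambient n} {a : FrameIndex n → ℝ}
    (h0 : ambientForm n r x (X (.inl 0)) = -a (.inl 3))
    (h1 : ambientForm n r x (X (.inl 1)) = a (.inl 2) / 2)
    (h2 : ambientForm n r x (X (.inl 2)) = a (.inl 1) / 2)
    (h3 : ambientForm n r x (X (.inl 3)) = -a (.inl 0))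
    (h4 : ∀ β, ambientForm n r x (X (.inr β)) = a (.inr β) * ε β) : x = ∑ i, a i • X i := by
  obtain ⟨g0, g1, g2, g3, g4⟩ := sum_frameGram (ε := ε) a
  refine hX.ext hε hn fun i => ?_
  rw [hX.form_sum_left]
  rcases i with i | β
  · fin_cases i
    exacts [h0.trans g0.symm, h1.trans g1.symm, h2.trans g2.symm, h3.trans g3.symm]
  · rw [h4, g4]

/-- The linear map between two adapted frames. -/
def frameMap (r : ℕ) (ε : Fin (n - 2) → ℝ) (X X' : FrameIndex n → Ambient n) :
    Ambient n →L[ℝ] Ambient n :=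
  ∑ i, dualWeight ε i •
    ContinuousLinearMap.smulRightL ℝ (Ambient n) (Ambient n) (ambientFormL n r (X (dualIndex i)))
      (X' i)

theorem frameMap_apply_apply (x : Ambient n) :
    frameMap r ε X X' x =
      ∑ i, (dualWeight ε i * ambientForm n r x (X (dualIndex i))) • X' i := by
  simp [frameMap, mul_smul, ambientFormL_apply,
    ambientForm_comm (r := r) x]

/-- The closed formula of `frameMap` depends smoothly on both frames, so it can be differentiated
along the surface. Invertibility is supplied separately by `IsAdaptedFrame.equiv`. -/
theorem IsAdaptedFrame.frameMap_apply (hX : IsAdaptedFrame r ε X) (hε : ∀ α, ε α * ε α = 1)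
    (j : FrameIndex n) : frameMap r ε X X' (X j) = X' j := by
  simp [frameMap_apply_apply, hX j _, frameGram_dual hε]

theorem IsAdaptedFrame.ext_linearMap (hX : IsAdaptedFrame r ε X) (hε : ∀ α, ε α * ε α = 1)
    (hn : 2 ≤ n) {F : Type*} [AddCommGroup F] [Module ℝ F] {S T : Ambient n →ₗ[ℝ] F}
    (h : ∀ i, S (X i) = T (X i)) : S = T :=
  (hX.basis hε hn).ext fun i => by simpa using h i

/-- The linear automorphism taking one adapted frame to another. -/
def IsAdaptedFrame.equiv (hX : IsAdaptedFrame r ε X) (hX' : IsAdaptedFrame r ε X')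
    (hε : ∀ α, ε α * ε α = 1) (hn : 2 ≤ n) : Ambient n ≃ₗ[ℝ] Ambient n :=
  (hX.basis hε hn).equiv (hX'.basis hε hn) (Equiv.refl _)

theorem IsAdaptedFrame.equiv_apply (hX : IsAdaptedFrame r ε X) (hX' : IsAdaptedFrame r ε X')
    (hε : ∀ α, ε α * ε α = 1) (hn : 2 ≤ n) (i : FrameIndex n) :
    hX.equiv hX' hε hn (X i) = X' i := by
  have := (hX.basis hε hn).equiv_apply i (hX'.basis hε hn) (Equiv.refl _)
  simpa [IsAdaptedFrame.equiv] using this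

/-- The two frames have the same Gram matrix, so the form and its pullback by T agree on a basis. -/
theorem IsAdaptedFrame.isPseudoOrthogonal (hX : IsAdaptedFrame r ε X)
    (hX' : IsAdaptedFrame r ε X') (hε : ∀ α, ε α * ε α = 1) (hn : 2 ≤ n)
    {T : Ambient n ≃ₗ[ℝ] Ambient n} (hT : ∀ i, T (X i) = X' i) : IsPseudoOrthogonal n r T := by
  have h : (ambientForm n r).compl₁₂ (T : Ambient n →ₗ[ℝ] Ambient n) T = ambientForm n r := by
    refine hX.ext_linearMap hε hn fun i => hX.ext_linearMap hε hn fun j => ?_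
    simp [hT, hX i j, hX' i j]
  exact fun x z => congrArg (fun B : LinearMap.BilinForm ℝ (Ambient n) => B x z) h

/-- The span of the normal frame vectors is the orthogonal complement of the span of the four
tangential ones. -/
theorem IsAdaptedFrame.span_normal (hX : IsAdaptedFrame r ε X) (hε : ∀ α, ε α * ε α = 1)
    (hn : 2 ≤ n) :
    Submodule.span ℝ (range fun α => X (.inr α)) = (ambientForm n r).orthogonal
      (Submodule.span ℝ {X (.inl 0), X (.inl 1), X (.inl 2), X (.inl 3)}) := by
  apply le_antisymm
  · rw [Submodule.span_le]
    rintro _ ⟨α, rfl⟩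
    refine (Submodule.span_le (p := LinearMap.ker ((ambientForm n r).flip (X (.inr α))))).2 ?_
    rintro x (rfl | rfl | rfl | rfl) <;> simp [hX _ _, frameGram]
  -- A vector orthogonal to the first four frame vectors has zero coefficients on them, since
  -- `dualIndex` permutes these four indices.
  · intro x hx
    have h : ∀ i : Fin 4, ambientForm n r x (X (.inl i)) = 0 := by
      intro i
      rw [ambientForm_comm]
      refine hx _ (Submodule.subset_span ?_)
      fin_cases i <;> simp
    rw [← hX.sum_dual hε hn x, Fintype.sum_sum_type]
    simp only [dualIndex, h]
    simp only [mul_zero, zero_smul, Finset.sum_const_zero, zero_add]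
    exact Submodule.sum_mem _ fun α _ => Submodule.smul_mem _ _ (Submodule.subset_span ⟨α, rfl⟩)

/-- A standard adapted frame. -/
def standardFrame (n : ℕ) : FrameIndex n → Ambient n
  | .inl i => ![Pi.single ⟨0, by omega⟩ 1 + Pi.single ⟨n, by omega⟩ 1,
      (1 / 2 : ℝ) • (Pi.single ⟨1, by omega⟩ 1 + Pi.single ⟨n + 1, by omega⟩ 1),
      (1 / 2 : ℝ) • (Pi.single ⟨1, by omega⟩ 1 - Pi.single ⟨n + 1, by omega⟩ 1),
      (-1 / 2 : ℝ) • (Pi.single ⟨0, by omega⟩ 1 - Pi.single ⟨n, by omega⟩ 1)] i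
  | .inr α => Pi.single ⟨α + 2, by omega⟩ 1

/-- The bounds on r make coordinates 0 and 1 positive and coordinates n and n + 1 negative. They
span two hyperbolic planes, which supply the four tangential vectors, and coordinates 2 to n - 1
supply the normal ones. The shift by 2 matches their signs with `normalSign`. -/
theorem isAdaptedFrame_standardFrame (hr : 1 ≤ r) (hn : r + 2 ≤ n) :
    IsAdaptedFrame r (normalSign n r) (standardFrame n) := by
  have h0 : r ≤ n := by omega
  have h1 : 1 + r < n + 1 := by omega
  have h2 : ¬ n + r < n + 1 := by omega
  have h3 : ¬ n + 1 + r < n + 1 := by omega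
  have h4 : n ≠ 0 := by omega
  have h5 : n ≠ 1 := by omega
  have h6 : n + 1 ≠ 1 := by omega
  rintro (i | α) (j | β)
  · fin_cases i <;> fin_cases j <;>
      simp [standardFrame, frameGram, ambientForm_single, h0, h1, h2, h3, h4, h5] <;> norm_num
  · have hβ := β.2
    have e2 : n ≠ (β : ℕ) + 2 := by omega
    have e3 : n ≠ (β : ℕ) + 1 := by omega
    fin_cases i <;> simp [standardFrame, frameGram, ambientForm_single, e2, e3]
  · have hβ := α.2
    have e2 : (α : ℕ) + 2 ≠ n := by omega
    have e3 : (α : ℕ) + 1 ≠ n := by omega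
    fin_cases j <;> simp [standardFrame, frameGram, ambientForm_single, e2, e3]
  · have e : (α : ℕ) + 2 + r < n + 1 ↔ (α : ℕ) + r + 1 < n := by omega
    simp [standardFrame, frameGram, ambientForm_single, normalSign, e, Fin.ext_iff]

theorem normalSign_mul_self (α : Fin (n - 2)) : normalSign n r α * normalSign n r α = 1 := by
  unfold normalSign
  split_ifs <;> norm_num

end Frames

/-! ### The structure equations of a timelike surface -/

section StructureEquations

open Set Filter Topology Module

variable {n r : ℕ}

/-- The coefficients of the `u`-derivative of the adapted frame. -/
def frameCoefU (ε : Fin (n - 2) → ℝ) (s c : ℝ) (k l : Fin (n - 2) → ℝ)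
    (Γ : Fin (n - 2) → Fin (n - 2) → ℝ) : FrameIndex n → FrameIndex n → ℝ
  | .inl i, .inl j => !![0, 1, 0, 0; -(s / 2), 0, 0, 0; -c, 0, 0, 1 / 2; 0, -(2 * c), -s, 0] i j
  | .inl i, .inr β => ![0, k β, 0, 2 * l β] i
  | .inr α, .inl j => ![2 * (ε α * l α), 0, -(2 * (ε α * k α)), 0] j
  | .inr α, .inr β => Γ α β

/-- The coefficients of the `v`-derivative of the adapted frame. -/
def frameCoefV (ε : Fin (n - 2) → ℝ) (s c : ℝ) (k l : Fin (n - 2) → ℝ)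
    (Γ : Fin (n - 2) → Fin (n - 2) → ℝ) : FrameIndex n → FrameIndex n → ℝ
  | .inl i, .inl j => !![0, 0, 1, 0; -c, 0, 0, 1 / 2; -(s / 2), 0, 0, 0; 0, -s, -(2 * c), 0] i j
  | .inl i, .inr β => ![0, 0, k β, 2 * l β] i
  | .inr α, .inl j => ![2 * (ε α * l α), -(2 * (ε α * k α)), 0, 0] j
  | .inr α, .inr β => Γ α β

variable {M : Type*} [TopologicalSpace M]

theorem ChartSmoothAt.form {e : Chart M} {f g : M → Ambient n} {p : M} (hf : ChartSmoothAt e f p)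
    (hg : ChartSmoothAt e g p) : ChartSmoothAt e (fun q => ambientForm n r (f q) (g q)) p :=
  hf.bilin hg (ambientFormL n r)

theorem coordDeriv_form {e : Chart M} {f g : M → Ambient n} {p : M} {w : ℝ × ℝ}
    (hp : p ∈ e.source) (hf : ChartSmoothAt e f p) (hg : ChartSmoothAt e g p) :
    coordDeriv w e (fun q => ambientForm n r (f q) (g q)) p =
      ambientForm n r (coordDeriv w e f p) (g p) + ambientForm n r (f p) (coordDeriv w e g p) :=
  coordDeriv_bilin hp hf hg (ambientFormL n r)

/-- The product rule for an inner product known near a point; most of the metric relations below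
come from it. -/
theorem form_coordDeriv_eq {e : Chart M} {f g : M → Ambient n} {p : M} {w : ℝ × ℝ} {a : M → ℝ}
    (hp : p ∈ e.source) (hf : ChartSmoothAt e f p) (hg : ChartSmoothAt e g p)
    (h : ∀ᶠ q in 𝓝 p, ambientForm n r (f q) (g q) = a q) :
    ambientForm n r (coordDeriv w e f p) (g p) + ambientForm n r (f p) (coordDeriv w e g p) =
      coordDeriv w e a p := by
  rw [← coordDeriv_form hp hf hg]
  exact coordDeriv_congr hp h

theorem form_coordDeriv_eq_zero {e : Chart M} {f g : M → Ambient n} {p : M} {w : ℝ × ℝ} {c : ℝ}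
    (hp : p ∈ e.source) (hf : ChartSmoothAt e f p) (hg : ChartSmoothAt e g p)
    (h : ∀ᶠ q in 𝓝 p, ambientForm n r (f q) (g q) = c) :
    ambientForm n r (coordDeriv w e f p) (g p) + ambientForm n r (f p) (coordDeriv w e g p) =
      0 := by
  rw [form_coordDeriv_eq hp hf hg h, coordDeriv_const]

/-- A timelike surface in the light cone, with canonical lift `Y` and a normal frame `ψ`, in the
asymptotic coordinates `e` over an open set `U`. -/
structure IsFramedSurface (r : ℕ) (e : Chart M) (U : Set M) (ε : Fin (n - 2) → ℝ)
    (s₁ s₂ : M → ℝ) (k₁ k₂ : M → Fin (n - 2) → ℝ) (Γu Γv : M → Fin (n - 2) → Fin (n - 2) → ℝ)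
    (Y : M → Ambient n) (ψ : Fin (n - 2) → M → Ambient n) : Prop where
  isOpen : IsOpen U
  subset : U ⊆ e.source
  sign : ∀ α, ε α * ε α = 1
  smooth : ∀ p ∈ U, ChartSmoothAt e Y p
  smooth_normal : ∀ p ∈ U, ∀ α, ChartSmoothAt e (ψ α) p
  null : ∀ p ∈ U, ambientForm n r (Y p) (Y p) = 0
  metric_uu : ∀ p ∈ U, ambientForm n r (pu e Y p) (pu e Y p) = 0
  metric_vv : ∀ p ∈ U, ambientForm n r (pv e Y p) (pv e Y p) = 0
  metric_uv : ∀ p ∈ U, ambientForm n r (pu e Y p) (pv e Y p) = 1 / 2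
  orthonormal : ∀ p ∈ U, ∀ α β, ambientForm n r (ψ α p) (ψ β p) = if α = β then ε α else 0
  normal : ∀ p ∈ U, ∀ α, ambientForm n r (Y p) (ψ α p) = 0
  normal_u : ∀ p ∈ U, ∀ α, ambientForm n r (pu e Y p) (ψ α p) = 0
  normal_v : ∀ p ∈ U, ∀ α, ambientForm n r (pv e Y p) (ψ α p) = 0
  normal_uv : ∀ p ∈ U, ∀ α, ambientForm n r (pv e (pu e Y) p) (ψ α p) = 0
  eq_uu : ∀ p ∈ U, pu e (pu e Y) p = -(s₁ p / 2) • Y p + ∑ α, k₁ p α • ψ α p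
  eq_vv : ∀ p ∈ U, pv e (pv e Y) p = -(s₂ p / 2) • Y p + ∑ α, k₂ p α • ψ α p
  conn_u : ∀ p ∈ U, ∀ α β, ambientForm n r (pu e (ψ α) p) (ψ β p) = Γu p α β * ε β
  conn_v : ∀ p ∈ U, ∀ α β, ambientForm n r (pv e (ψ α) p) (ψ β p) = Γv p α β * ε β

/-- The function `⟨κ₁, κ₂⟩` in terms of the components. -/
def hopfPairing (ε : Fin (n - 2) → ℝ) (k₁ k₂ : M → Fin (n - 2) → ℝ) (p : M) : ℝ :=
  ∑ α, k₁ p α * (k₂ p α * ε α)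

/-- The adapted frame `Y, Y_u, Y_v, N, ψ` of a timelike surface. -/
def surfaceFrame (e : Chart M) (c : M → ℝ) (Y : M → Ambient n) (ψ : Fin (n - 2) → M → Ambient n)
    (p : M) : FrameIndex n → Ambient n
  | .inl i => ![Y p, pu e Y p, pv e Y p,
      (2 : ℝ) • pv e (pu e Y) p + (2 * c p) • Y p] i
  | .inr α => ψ α p

/-- The components of the derivative of a section along the coordinate direction `w`. -/
def covDerivCoef (w : ℝ × ℝ) (e : Chart M) (k : M → Fin (n - 2) → ℝ)
    (Γ : M → Fin (n - 2) → Fin (n - 2) → ℝ) (p : M) (α : Fin (n - 2)) : ℝ :=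
  coordDeriv w e (fun q => k q α) p + ∑ β, k p β * Γ p β α

namespace IsFramedSurface

variable {e : Chart M} {U : Set M} {ε : Fin (n - 2) → ℝ} {s₁ s₂ : M → ℝ}
  {k₁ k₂ : M → Fin (n - 2) → ℝ} {Γu Γv : M → Fin (n - 2) → Fin (n - 2) → ℝ}
  {Y : M → Ambient n} {ψ : Fin (n - 2) → M → Ambient n}
  (h : IsFramedSurface r e U ε s₁ s₂ k₁ k₂ Γu Γv Y ψ) {p : M}

include h

theorem eventually {P : M → Prop} (hp : p ∈ U) (hP : ∀ q ∈ U, P q) : ∀ᶠ q in 𝓝 p, P q := by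
  filter_upwards [h.isOpen.mem_nhds hp] with q hq using hP q hq

theorem smooth_u (hp : p ∈ U) : ChartSmoothAt e (pu e Y) p :=
  (h.smooth p hp).coordDeriv (h.subset hp)

theorem smooth_v (hp : p ∈ U) : ChartSmoothAt e (pv e Y) p :=
  (h.smooth p hp).coordDeriv (h.subset hp)

theorem smooth_uv (hp : p ∈ U) : ChartSmoothAt e (pv e (pu e Y)) p :=
  (h.smooth_u hp).coordDeriv (h.subset hp)

theorem comm_uv (hp : p ∈ U) : pu e (pv e Y) p = pv e (pu e Y) p :=
  coordDeriv_comm (h.subset hp) (h.smooth p hp)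

theorem form_Y_u (hp : p ∈ U) : ambientForm n r (Y p) (pu e Y p) = 0 := by
  have := form_coordDeriv_eq_zero (w := (1, 0)) (h.subset hp) (h.smooth p hp) (h.smooth p hp)
    (h.eventually hp h.null)
  rw [ambientForm_comm (coordDeriv _ _ _ _)] at this
  exact (add_self_eq_zero).1 this

theorem form_Y_v (hp : p ∈ U) : ambientForm n r (Y p) (pv e Y p) = 0 := by
  have := form_coordDeriv_eq_zero (w := (0, 1)) (h.subset hp) (h.smooth p hp) (h.smooth p hp)
    (h.eventually hp h.null)
  rw [ambientForm_comm (coordDeriv _ _ _ _)] at this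
  exact (add_self_eq_zero).1 this

/-- Differentiating ⟨Y, Y_u⟩ = 0 in v gives ⟨Y, Y_uv⟩ = -⟨Y_u, Y_v⟩. -/
theorem form_Y_uv (hp : p ∈ U) : ambientForm n r (Y p) (pv e (pu e Y) p) = -1 / 2 := by
  have := form_coordDeriv_eq_zero (w := (0, 1)) (h.subset hp) (h.smooth p hp) (h.smooth_u hp)
    (h.eventually hp fun q hq => h.form_Y_u hq)
  have h2 := h.metric_uv p hp
  rw [ambientForm_comm] at h2
  linarith

theorem form_u_uv (hp : p ∈ U) : ambientForm n r (pu e Y p) (pv e (pu e Y) p) = 0 := by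
  have := form_coordDeriv_eq_zero (w := (0, 1)) (h.subset hp) (h.smooth_u hp) (h.smooth_u hp)
    (h.eventually hp h.metric_uu)
  rw [ambientForm_comm (coordDeriv _ _ _ _)] at this
  exact (add_self_eq_zero).1 this

theorem form_v_uv (hp : p ∈ U) : ambientForm n r (pv e Y p) (pv e (pu e Y) p) = 0 := by
  have := form_coordDeriv_eq_zero (w := (1, 0)) (h.subset hp) (h.smooth_v hp) (h.smooth_v hp)
    (h.eventually hp h.metric_vv)
  rw [ambientForm_comm (coordDeriv _ _ _ _)] at this
  rw [← h.comm_uv hp]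
  exact (add_self_eq_zero).1 this

theorem form_uu_of_normal (hp : p ∈ U) {x : Ambient n} (hx : ambientForm n r (Y p) x = 0) :
    ambientForm n r (pu e (pu e Y) p) x = ∑ α, k₁ p α * ambientForm n r (ψ α p) x := by
  simp [h.eq_uu p hp, hx]

theorem form_vv_of_normal (hp : p ∈ U) {x : Ambient n} (hx : ambientForm n r (Y p) x = 0) :
    ambientForm n r (pv e (pv e Y) p) x = ∑ α, k₂ p α * ambientForm n r (ψ α p) x := by
  simp [h.eq_vv p hp, hx]

theorem form_uu_normal (hp : p ∈ U) (α : Fin (n - 2)) :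
    ambientForm n r (pu e (pu e Y) p) (ψ α p) = k₁ p α * ε α := by
  simp [h.form_uu_of_normal hp (h.normal p hp α), h.orthonormal p hp]

theorem form_vv_normal (hp : p ∈ U) (α : Fin (n - 2)) :
    ambientForm n r (pv e (pv e Y) p) (ψ α p) = k₂ p α * ε α := by
  simp [h.form_vv_of_normal hp (h.normal p hp α), h.orthonormal p hp]

theorem form_uu_v (hp : p ∈ U) : ambientForm n r (pu e (pu e Y) p) (pv e Y p) = 0 := by
  simp [h.form_uu_of_normal hp (h.form_Y_v hp), ambientForm_comm (ψ _ p), h.normal_v p hp]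

theorem form_uu_vv (hp : p ∈ U) :
    ambientForm n r (pu e (pu e Y) p) (pv e (pv e Y) p) = hopfPairing ε k₁ k₂ p := by
  have h0 : ambientForm n r (Y p) (pv e (pv e Y) p) = 0 := by
    rw [ambientForm_comm, h.form_vv_of_normal hp (h.null p hp)]
    simp [ambientForm_comm (ψ _ p), h.normal p hp]
  rw [h.form_uu_of_normal hp h0, hopfPairing]
  simp only [ambientForm_comm (ψ _ p), h.form_vv_normal hp]

/-- Differentiate ⟨Y_uu, Y_v⟩ = 0 in v and ⟨Y_v, Y_uv⟩ = 0 in u. Both contain the term ⟨Y_v, Y_uuv⟩,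
so ⟨Y_uv, Y_uv⟩ = ⟨Y_uu, Y_vv⟩, and this is ⟨κ₁, κ₂⟩. -/
theorem form_uv_uv (hp : p ∈ U) :
    ambientForm n r (pv e (pu e Y) p) (pv e (pu e Y) p) = hopfPairing ε k₁ k₂ p := by
  have h1 := form_coordDeriv_eq_zero (w := (0, 1)) (h.subset hp)
    ((h.smooth_u hp).coordDeriv (w := (1, 0)) (h.subset hp)) (h.smooth_v hp)
    (h.eventually hp fun q hq => h.form_uu_v hq)
  have h2 := form_coordDeriv_eq_zero (w := (1, 0)) (h.subset hp) (h.smooth_v hp) (h.smooth_uv hp)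
    (h.eventually hp fun q hq => h.form_v_uv hq)
  have h3 : pu e (pv e (pu e Y)) p = pv e (pu e (pu e Y)) p :=
    coordDeriv_comm (h.subset hp) (h.smooth_u hp)
  have h4 := h.comm_uv hp
  have h5 := h.form_uu_vv hp
  simp only [pu, pv] at *
  rw [h4, h3, ambientForm_comm (coordDeriv (0, 1) e Y p)] at h2
  linarith

theorem smooth_hopfPairing (hp : p ∈ U) : ChartSmoothAt e (hopfPairing ε k₁ k₂) p :=
  ((h.smooth_uv hp).form (r := r) (h.smooth_uv hp)).congr (h.subset hp)
    (h.eventually hp fun _ hq => h.form_uv_uv hq)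

/-- Smoothness of the components is not part of `IsFramedSurface`; it is recovered from ε_α ⟨Y_uu,
ψ_α⟩. -/
theorem smooth_k₁ (hp : p ∈ U) (α : Fin (n - 2)) : ChartSmoothAt e (fun q => k₁ q α) p := by
  have h1 := (((h.smooth_u hp).coordDeriv (w := (1, 0)) (h.subset hp)).form (r := r)
    (h.smooth_normal p hp α)).mul (chartSmoothAt_const (ε α))
  refine h1.congr (h.subset hp) (h.eventually hp fun q hq => ?_)
  change ambientForm n r (pu e (pu e Y) q) (ψ α q) * ε α = k₁ q α
  rw [h.form_uu_normal hq, mul_assoc, h.sign, mul_one]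

theorem smooth_k₂ (hp : p ∈ U) (α : Fin (n - 2)) : ChartSmoothAt e (fun q => k₂ q α) p := by
  have h1 := (((h.smooth_v hp).coordDeriv (w := (0, 1)) (h.subset hp)).form (r := r)
    (h.smooth_normal p hp α)).mul (chartSmoothAt_const (ε α))
  refine h1.congr (h.subset hp) (h.eventually hp fun q hq => ?_)
  change ambientForm n r (pv e (pv e Y) q) (ψ α q) * ε α = k₂ q α
  rw [h.form_vv_normal hq, mul_assoc, h.sign, mul_one]

theorem isAdaptedFrame (hp : p ∈ U) :
    IsAdaptedFrame r ε (surfaceFrame e (hopfPairing ε k₁ k₂) Y ψ p) := by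
  have h1 := h.null p hp
  have h2 := h.form_Y_u hp
  have h3 := h.form_Y_v hp
  have h4 := h.form_Y_uv hp
  have h5 := h.metric_uu p hp
  have h6 := h.metric_vv p hp
  have h7 := h.metric_uv p hp
  have h8 := h.form_u_uv hp
  have h9 := h.form_v_uv hp
  have h10 := h.form_uv_uv hp
  have h2' := (ambientForm_comm _ _).trans h2
  have h3' := (ambientForm_comm _ _).trans h3
  have h4' := (ambientForm_comm _ _).trans h4
  have h7' := (ambientForm_comm _ _).trans h7
  have h8' := (ambientForm_comm _ _).trans h8
  have h9' := (ambientForm_comm _ _).trans h9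
  have n1 := h.normal p hp
  have n2 := h.normal_u p hp
  have n3 := h.normal_v p hp
  have n4 := h.normal_uv p hp
  have n1' := fun α => (ambientForm_comm _ _).trans (n1 α)
  have n2' := fun α => (ambientForm_comm _ _).trans (n2 α)
  have n3' := fun α => (ambientForm_comm _ _).trans (n3 α)
  have n4' := fun α => (ambientForm_comm _ _).trans (n4 α)
  rintro (i | α) (j | β)
  · fin_cases i <;> fin_cases j <;>
      simp [surfaceFrame, frameGram, h1, h2, h3, h4, h5, h6, h7, h8, h9, h10, h2', h3', h4', h7',
        h8', h9'] <;> ring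
  · fin_cases i <;> simp [surfaceFrame, frameGram, n1, n2, n3, n4]
  · fin_cases j <;> simp [surfaceFrame, frameGram, n1', n2', n3', n4']
  · exact h.orthonormal p hp α β

theorem smooth_frame (hp : p ∈ U) (i : FrameIndex n) :
    ChartSmoothAt e (fun q => surfaceFrame e (hopfPairing ε k₁ k₂) Y ψ q i) p := by
  rcases i with i | α
  · fin_cases i
    · exact h.smooth p hp
    · exact h.smooth_u hp
    · exact h.smooth_v hp
    · exact ((chartSmoothAt_const (2 : ℝ)).smul (h.smooth_uv hp)).add
        (((chartSmoothAt_const (2 : ℝ)).mul (h.smooth_hopfPairing hp)).smul (h.smooth p hp))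
  · exact h.smooth_normal p hp α

theorem conn_skew_u (hp : p ∈ U) (α β : Fin (n - 2)) : Γu p α β * ε β + Γu p β α * ε α = 0 := by
  have := form_coordDeriv_eq_zero (w := (1, 0)) (h.subset hp) (h.smooth_normal p hp α)
    (h.smooth_normal p hp β) (h.eventually hp fun q hq => h.orthonormal q hq α β)
  rwa [h.conn_u p hp, ambientForm_comm, h.conn_u p hp] at this

theorem conn_skew_v (hp : p ∈ U) (α β : Fin (n - 2)) : Γv p α β * ε β + Γv p β α * ε α = 0 := by
  have := form_coordDeriv_eq_zero (w := (0, 1)) (h.subset hp) (h.smooth_normal p hp α)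
    (h.smooth_normal p hp β) (h.eventually hp fun q hq => h.orthonormal q hq α β)
  rwa [h.conn_v p hp, ambientForm_comm, h.conn_v p hp] at this

/-- Since Y_uvu = (Y_uu)_v, its normal part comes from differentiating κ₁: the Y-term contributes
nothing, as Y and Y_v are orthogonal to ψ. Skewness of the connection coefficients turns the
derivative of ψ into the Γ-term of D_v κ₁. -/
theorem form_uvu_normal (hp : p ∈ U) (α : Fin (n - 2)) :
    ambientForm n r (pu e (pv e (pu e Y)) p) (ψ α p) =
      covDerivCoef (0, 1) e k₁ Γv p α * ε α := by
  have h1 := form_coordDeriv_eq (w := (0, 1)) (a := fun q => ε α * k₁ q α) (h.subset hp)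
    ((h.smooth_u hp).coordDeriv (w := (1, 0)) (h.subset hp)) (h.smooth_normal p hp α)
    (h.eventually hp fun q hq => (h.form_uu_normal hq α).trans (mul_comm _ _))
  rw [coordDeriv_const_mul (h.smooth_k₁ hp α)] at h1
  have h2 : ambientForm n r (Y p) (pv e (ψ α) p) = 0 := by
    have := form_coordDeriv_eq_zero (w := (0, 1)) (h.subset hp) (h.smooth p hp)
      (h.smooth_normal p hp α) (h.eventually hp fun q hq => h.normal q hq α)
    have h3 := h.normal_v p hp α
    linarith
  have h4 : ambientForm n r (pu e (pu e Y) p) (pv e (ψ α) p) =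
      -((∑ β, k₁ p β * Γv p β α) * ε α) := by
    rw [h.form_uu_of_normal hp h2, Finset.sum_mul, ← Finset.sum_neg_distrib]
    refine Finset.sum_congr rfl fun β _ => ?_
    have h5 := h.conn_skew_v hp α β
    rw [ambientForm_comm, h.conn_v p hp]
    linear_combination k₁ p β * h5
  have h6 : pu e (pv e (pu e Y)) p = pv e (pu e (pu e Y)) p :=
    coordDeriv_comm (h.subset hp) (h.smooth_u hp)
  rw [h6, covDerivCoef]
  simp only [pu, pv] at *
  linear_combination h1 - h4

theorem form_uvv_normal (hp : p ∈ U) (α : Fin (n - 2)) :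
    ambientForm n r (pv e (pv e (pu e Y)) p) (ψ α p) =
      covDerivCoef (1, 0) e k₂ Γu p α * ε α := by
  have h1 := form_coordDeriv_eq (w := (1, 0)) (a := fun q => ε α * k₂ q α) (h.subset hp)
    ((h.smooth_v hp).coordDeriv (w := (0, 1)) (h.subset hp)) (h.smooth_normal p hp α)
    (h.eventually hp fun q hq => (h.form_vv_normal hq α).trans (mul_comm _ _))
  rw [coordDeriv_const_mul (h.smooth_k₂ hp α)] at h1
  have h2 : ambientForm n r (Y p) (pu e (ψ α) p) = 0 := by
    have := form_coordDeriv_eq_zero (w := (1, 0)) (h.subset hp) (h.smooth p hp)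
      (h.smooth_normal p hp α) (h.eventually hp fun q hq => h.normal q hq α)
    have h3 := h.normal_u p hp α
    linarith
  have h4 : ambientForm n r (pv e (pv e Y) p) (pu e (ψ α) p) =
      -((∑ β, k₂ p β * Γu p β α) * ε α) := by
    rw [h.form_vv_of_normal hp h2, Finset.sum_mul, ← Finset.sum_neg_distrib]
    refine Finset.sum_congr rfl fun β _ => ?_
    have h5 := h.conn_skew_u hp α β
    rw [ambientForm_comm, h.conn_u p hp]
    linear_combination k₂ p β * h5
  have h6 : pv e (pv e (pu e Y)) p = pu e (pv e (pv e Y)) p := by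
    have h7 : pu e (pv e Y) =ᶠ[𝓝 p] pv e (pu e Y) := h.eventually hp fun q hq => h.comm_uv hq
    refine (coordDeriv_congr (h.subset hp) h7).symm.trans ?_
    exact coordDeriv_comm (h.subset hp) (h.smooth_v hp)
  rw [h6, covDerivCoef]
  simp only [pu, pv] at *
  linear_combination h1 - h4

/-- The inner products of the derivative of a frame vector with the frame are skew-symmetric. -/
theorem form_frame_deriv (hp : p ∈ U) (w : ℝ × ℝ) (i j : FrameIndex n) :
    ambientForm n r (coordDeriv w e
        (fun q => surfaceFrame e (hopfPairing ε k₁ k₂) Y ψ q i) p)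
        (surfaceFrame e (hopfPairing ε k₁ k₂) Y ψ p j) =
      -ambientForm n r (coordDeriv w e
        (fun q => surfaceFrame e (hopfPairing ε k₁ k₂) Y ψ q j) p)
        (surfaceFrame e (hopfPairing ε k₁ k₂) Y ψ p i) := by
  have := form_coordDeriv_eq_zero (w := w) (h.subset hp) (h.smooth_frame hp i)
    (h.smooth_frame hp j) (h.eventually hp fun q hq => h.isAdaptedFrame hq i j)
  rw [ambientForm_comm (surfaceFrame _ _ _ _ _ i)] at this
  linarith

/-- The derivative of the correction 2cY is a combination of Y and Y_w, both orthogonal to ψ, so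
derivatives of c do not matter here. -/
theorem form_deriv_N_normal (hp : p ∈ U) (w : ℝ × ℝ) (α : Fin (n - 2))
    (hw : ambientForm n r (coordDeriv w e Y p) (ψ α p) = 0) :
    ambientForm n r (coordDeriv w e
        (fun q => surfaceFrame e (hopfPairing ε k₁ k₂) Y ψ q (.inl 3)) p) (ψ α p) =
      2 * ambientForm n r (coordDeriv w e (pv e (pu e Y)) p) (ψ α p) := by
  have e1 : coordDeriv w e (fun q => surfaceFrame e (hopfPairing ε k₁ k₂) Y ψ q (.inl 3)) p =
      coordDeriv w e (fun q => (2 : ℝ) • pv e (pu e Y) q) p +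
        coordDeriv w e (fun q => (2 * hopfPairing ε k₁ k₂ q) • Y q) p :=
    coordDeriv_add ((chartSmoothAt_const (2 : ℝ)).smul (h.smooth_uv hp))
      (((chartSmoothAt_const (2 : ℝ)).mul (h.smooth_hopfPairing hp)).smul (h.smooth p hp))
  rw [e1, coordDeriv_const_smul (h.smooth_uv hp), coordDeriv_smul (h.subset hp)
    ((chartSmoothAt_const (2 : ℝ)).mul (h.smooth_hopfPairing hp)) (h.smooth p hp)]
  simp [hw, h.normal p hp]

/-- The derivatives of Y, Y_u and Y_v are known directly. Constancy of the Gram matrix makes the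
array ⟨∂X_i, X_j⟩ skew, which determines the derivatives of N and ψ up to the inner products ⟨N_u,
ψ⟩ and ⟨ψ_u, ψ⟩. These are D_v κ₁ and the connection coefficients. -/
theorem deriv_frame_u (hn : 2 ≤ n) (hp : p ∈ U) (i : FrameIndex n) :
    pu e (fun q => surfaceFrame e (hopfPairing ε k₁ k₂) Y ψ q i) p =
      ∑ j, frameCoefU ε (s₁ p) (hopfPairing ε k₁ k₂ p) (k₁ p) (covDerivCoef (0, 1) e k₁ Γv p)
        (Γu p) i j • surfaceFrame e (hopfPairing ε k₁ k₂) Y ψ p j := by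
  set c := hopfPairing ε k₁ k₂ with hc
  set X := surfaceFrame e c Y ψ with hX
  have hA : pu e (fun q => X q (.inl 0)) p = X p (.inl 1) := rfl
  have hAA : pu e (fun q => X q (.inl 1)) p =
      -(s₁ p / 2) • X p (.inl 0) + ∑ α, k₁ p α • X p (.inr α) := h.eq_uu p hp
  have hB : pu e (fun q => X q (.inl 2)) p = -c p • X p (.inl 0) + (1 / 2 : ℝ) • X p (.inl 3) := by
    refine (h.comm_uv hp).trans ?_
    simp only [hX, surfaceFrame, Matrix.cons_val]
    module
  have hf := h.isAdaptedFrame hp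
  have hs := h.form_frame_deriv hp (1, 0)
  have hNψ : ∀ α, ambientForm n r (pu e (fun q => X q (.inl 3)) p) (X p (.inr α)) =
      2 * covDerivCoef (0, 1) e k₁ Γv p α * ε α := fun α => by
    rw [mul_assoc, ← h.form_uvu_normal hp]
    exact h.form_deriv_N_normal hp _ α (h.normal_u p hp α)
  rw [← hc, ← hX] at hs hf
  simp only [pu] at *
  rcases i with i | α
  · fin_cases i
    · simp [hA, frameCoefU, Fintype.sum_sum_type, Fin.sum_univ_four]
    · simp [hAA, frameCoefU, Fintype.sum_sum_type, Fin.sum_univ_four]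
    · simp [hB, frameCoefU, Fintype.sum_sum_type, Fin.sum_univ_four]
    · refine hf.eq_sum h.sign hn ?_ ?_ ?_ ?_ fun β => ?_
      · change ambientForm n r (coordDeriv (1, 0) e (fun q => X q (.inl 3)) p) _ = _
        rw [hs, hA, hf]
        simp [frameGram, frameCoefU]
      · change ambientForm n r (coordDeriv (1, 0) e (fun q => X q (.inl 3)) p) _ = _
        rw [hs, hAA]
        simp [hf _ _, frameGram, frameCoefU]
        ring
      · change ambientForm n r (coordDeriv (1, 0) e (fun q => X q (.inl 3)) p) _ = _
        rw [hs, hB]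
        simp [hf _ _, frameGram, frameCoefU]
        ring
      · have := hs (.inl 3) (.inl 3)
        change ambientForm n r (coordDeriv (1, 0) e (fun q => X q (.inl 3)) p) _ = _
        simp [frameCoefU]
        linarith
      · exact (hNψ β).trans (by simp [frameCoefU])
  · refine hf.eq_sum h.sign hn ?_ ?_ ?_ ?_ fun β => ?_
    · rw [hs, hA, hf]
      simp [frameGram, frameCoefU]
    · rw [hs, hAA]
      simp [hf _ _, frameGram, frameCoefU]
      ring
    · rw [hs, hB]
      simp [hf _ _, frameGram, frameCoefU]
    · rw [hs, hNψ]
      simp [frameCoefU]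
      ring
    · exact h.conn_u p hp α β

theorem deriv_frame_v (hn : 2 ≤ n) (hp : p ∈ U) (i : FrameIndex n) :
    pv e (fun q => surfaceFrame e (hopfPairing ε k₁ k₂) Y ψ q i) p =
      ∑ j, frameCoefV ε (s₂ p) (hopfPairing ε k₁ k₂ p) (k₂ p) (covDerivCoef (1, 0) e k₂ Γu p)
        (Γv p) i j • surfaceFrame e (hopfPairing ε k₁ k₂) Y ψ p j := by
  set c := hopfPairing ε k₁ k₂ with hc
  set X := surfaceFrame e c Y ψ with hX
  have hA : pv e (fun q => X q (.inl 0)) p = X p (.inl 2) := rfl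
  have hAA : pv e (fun q => X q (.inl 2)) p =
      -(s₂ p / 2) • X p (.inl 0) + ∑ α, k₂ p α • X p (.inr α) := h.eq_vv p hp
  have hB : pv e (fun q => X q (.inl 1)) p = -c p • X p (.inl 0) + (1 / 2 : ℝ) • X p (.inl 3) := by
    change pv e (pu e Y) p = _
    simp only [hX, surfaceFrame, Matrix.cons_val]
    module
  have hf := h.isAdaptedFrame hp
  have hs := h.form_frame_deriv hp (0, 1)
  have hNψ : ∀ α, ambientForm n r (pv e (fun q => X q (.inl 3)) p) (X p (.inr α)) =
      2 * covDerivCoef (1, 0) e k₂ Γu p α * ε α := fun α => by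
    rw [mul_assoc, ← h.form_uvv_normal hp]
    exact h.form_deriv_N_normal hp _ α (h.normal_v p hp α)
  rw [← hc, ← hX] at hs hf
  simp only [pv] at *
  rcases i with i | α
  · fin_cases i
    · simp [hA, frameCoefV, Fintype.sum_sum_type, Fin.sum_univ_four]
    · simp [hB, frameCoefV, Fintype.sum_sum_type, Fin.sum_univ_four]
    · simp [hAA, frameCoefV, Fintype.sum_sum_type, Fin.sum_univ_four]
    · refine hf.eq_sum h.sign hn ?_ ?_ ?_ ?_ fun β => ?_
      · change ambientForm n r (coordDeriv (0, 1) e (fun q => X q (.inl 3)) p) _ = _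
        rw [hs, hA, hf]
        simp [frameGram, frameCoefV]
      · change ambientForm n r (coordDeriv (0, 1) e (fun q => X q (.inl 3)) p) _ = _
        rw [hs, hB]
        simp [hf _ _, frameGram, frameCoefV]
        ring
      · change ambientForm n r (coordDeriv (0, 1) e (fun q => X q (.inl 3)) p) _ = _
        rw [hs, hAA]
        simp [hf _ _, frameGram, frameCoefV]
        ring
      · have := hs (.inl 3) (.inl 3)
        change ambientForm n r (coordDeriv (0, 1) e (fun q => X q (.inl 3)) p) _ = _
        simp [frameCoefV]
        linarith
      · exact (hNψ β).trans (by simp [frameCoefV])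
  · refine hf.eq_sum h.sign hn ?_ ?_ ?_ ?_ fun β => ?_
    · rw [hs, hA, hf]
      simp [frameGram, frameCoefV]
    · rw [hs, hB]
      simp [hf _ _, frameGram, frameCoefV]
    · rw [hs, hAA]
      simp [hf _ _, frameGram, frameCoefV]
      ring
    · rw [hs, hNψ]
      simp [frameCoefV]
      ring
    · exact h.conn_v p hp α β

omit h in
-- Differentiate T X_i = X'_i, where T is the frame map. As both frames satisfy the same linear
-- equation, the terms with a cancel and T_w X_i = 0 for every vector X_i of a basis.
theorem coordDeriv_frameMap_eq_zero {ε : Fin (n - 2) → ℝ} (hε : ∀ α, ε α * ε α = 1)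
    (hn : 2 ≤ n) {X X' : M → FrameIndex n → Ambient n} {w : ℝ × ℝ} (hpe : p ∈ e.source)
    (hX : ∀ᶠ q in 𝓝 p, IsAdaptedFrame r ε (X q))
    (hs : ∀ i, ChartSmoothAt e (fun q => X q i) p)
    {a : FrameIndex n → FrameIndex n → ℝ}
    (hd : ∀ i, coordDeriv w e (fun q => X q i) p = ∑ j, a i j • X p j)
    (hd' : ∀ i, coordDeriv w e (fun q => X' q i) p = ∑ j, a i j • X' p j)
    (hT : ChartSmoothAt e (fun q => frameMap r ε (X q) (X' q)) p) :
    coordDeriv w e (fun q => frameMap r ε (X q) (X' q)) p = 0 := by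
  have hXp := hX.self_of_nhds
  have key : ∀ i, coordDeriv w e (fun q => frameMap r ε (X q) (X' q)) p (X p i) = 0 := by
    intro i
    have h1 := coordDeriv_bilin (w := w) hpe hT (hs i)
      (ContinuousLinearMap.id ℝ (Ambient n →L[ℝ] Ambient n))
    have h2 : coordDeriv w e (fun q => ContinuousLinearMap.id ℝ (Ambient n →L[ℝ] Ambient n)
        (frameMap r ε (X q) (X' q)) (X q i)) p = coordDeriv w e (fun q => X' q i) p := by
      refine coordDeriv_congr hpe ?_
      filter_upwards [hX] with q hq
      exact hq.frameMap_apply hε i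
    rw [h2, hd, hd'] at h1
    simpa [map_sum, hXp.frameMap_apply hε] using h1
  refine ContinuousLinearMap.coe_injective (hXp.ext_linearMap hε hn fun i => ?_)
  simpa using key i

omit h in
theorem chartSmoothAt_frameMap {ε : Fin (n - 2) → ℝ} {X X' : M → FrameIndex n → Ambient n}
    (hs : ∀ i, ChartSmoothAt e (fun q => X q i) p)
    (hs' : ∀ i, ChartSmoothAt e (fun q => X' q i) p) :
    ChartSmoothAt e (fun q => frameMap r ε (X q) (X' q)) p := by
  refine ChartSmoothAt.sum fun i _ => ChartSmoothAt.smul (chartSmoothAt_const _) ?_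
  exact ChartSmoothAt.bilin ((hs (dualIndex i)).clm_comp (ambientFormL n r)) (hs' i)
    (ContinuousLinearMap.smulRightL ℝ (Ambient n) (Ambient n))

/-- Two timelike surfaces with the same invariants are locally congruent. -/
theorem exists_congruence {Y' : M → Ambient n} {ψ' : Fin (n - 2) → M → Ambient n}
    (h' : IsFramedSurface r e U ε s₁ s₂ k₁ k₂ Γu Γv Y' ψ') (hn : 2 ≤ n) (hp : p ∈ U) :
    ∃ T : Ambient n ≃ₗ[ℝ] Ambient n, IsPseudoOrthogonal n r T ∧
      ∀ᶠ q in 𝓝 p, T (Y q) = Y' q ∧ ∀ α, T (ψ α q) = ψ' α q := by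
  set c := hopfPairing ε k₁ k₂ with hc
  set X := surfaceFrame e c Y ψ with hX
  set X' := surfaceFrame e c Y' ψ' with hX'
  have hf := h.isAdaptedFrame hp
  have hf' := h'.isAdaptedFrame hp
  have hT : ∀ q ∈ U, ChartSmoothAt e (fun q => frameMap r ε (X q) (X' q)) q := fun q hq =>
    chartSmoothAt_frameMap (h.smooth_frame hq) (h'.smooth_frame hq)
  have hconst := eventually_eq_of_coordDeriv_eq_zero (f := fun q => frameMap r ε (X q) (X' q))
    (h.subset hp) (h.eventually hp fun q hq => ⟨hT q hq,
      coordDeriv_frameMap_eq_zero h.sign hn (h.subset hq)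
        (h.eventually hq fun _ ht => h.isAdaptedFrame ht) (h.smooth_frame hq)
        (h.deriv_frame_u hn hq) (h'.deriv_frame_u hn hq) (hT q hq),
      coordDeriv_frameMap_eq_zero h.sign hn (h.subset hq)
        (h.eventually hq fun _ ht => h.isAdaptedFrame ht) (h.smooth_frame hq)
        (h.deriv_frame_v hn hq) (h'.deriv_frame_v hn hq) (hT q hq)⟩)
  have hE : ∀ i, hf.equiv hf' h.sign hn (X p i) = X' p i := hf.equiv_apply hf' h.sign hn
  refine ⟨hf.equiv hf' h.sign hn, hf.isPseudoOrthogonal hf' h.sign hn hE, ?_⟩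
  -- At p the automorphism agrees with the frame map. The frame map is constant near p, so the
  -- automorphism carries the whole frame at nearby points as well.
  have heq : (hf.equiv hf' h.sign hn : Ambient n →ₗ[ℝ] Ambient n) = frameMap r ε (X p) (X' p) :=
    hf.ext_linearMap h.sign hn fun i => (hE i).trans (hf.frameMap_apply h.sign i).symm
  filter_upwards [hconst, h.isOpen.mem_nhds hp] with q hq hqU
  have key : ∀ i, hf.equiv hf' h.sign hn (X q i) = X' q i := fun i => by
    have h1 := congrArg (fun L : Ambient n →ₗ[ℝ] Ambient n => L (X q i)) heq
    refine h1.trans ?_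
    have h2 := congrArg (fun L : Ambient n →L[ℝ] Ambient n => L (X q i)) hq
    exact h2.symm.trans ((h.isAdaptedFrame hqU).frameMap_apply h.sign i)
  exact ⟨key (.inl 0), fun α => key (.inr α)⟩

end IsFramedSurface

end StructureEquations

/-! ### Congruence of timelike surfaces with the same invariants -/

section Uniqueness

open Set Filter Topology Module

variable {n r : ℕ} {M : Type*} [TopologicalSpace M]

theorem confNormal_form {Y : Chart M → M → Ambient n} {e : Chart M} {p : M} {x : Ambient n}
    (hx : x ∈ confNormal r Y e p) : ambientForm n r (Y e p) x = 0 ∧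
      ambientForm n r (pu e (Y e) p) x = 0 ∧ ambientForm n r (pv e (Y e) p) x = 0 ∧
      ambientForm n r (pv e (pu e (Y e)) p) x = 0 := by
  refine ⟨?_, ?_, ?_, ?_⟩ <;> exact hx _ (Submodule.subset_span (by simp))

theorem IsNormalPart.form_eq {Y : Chart M → M → Ambient n} {e : Chart M} {p : M}
    {x η z : Ambient n} (h : IsNormalPart r Y e p x η) (hz : z ∈ confNormal r Y e p) :
    ambientForm n r x z = ambientForm n r η z := by
  have : ambientForm n r (x - η) z = 0 := hz _ h.2
  rw [map_sub, LinearMap.sub_apply] at this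
  linarith

/-- Translates conditions on V and V^⊥ into scalar products with the frame. It serves both given
canonical lifts and abstract realisations. -/
theorem isFramedSurface_of {e : Chart M} {U : Set M} {ε : Fin (n - 2) → ℝ} {s₁ s₂ : M → ℝ}
    {k₁ k₂ : M → Fin (n - 2) → ℝ} {Γu Γv : M → Fin (n - 2) → Fin (n - 2) → ℝ}
    {Y : Chart M → M → Ambient n} {ψ : Fin (n - 2) → M → Ambient n} (hU : IsOpen U)
    (hUe : U ⊆ e.source) (hε : ∀ α, ε α * ε α = 1) (hY : ∀ p ∈ U, ChartSmoothAt e (Y e) p)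
    (hψ : ∀ p ∈ U, ∀ α, ChartSmoothAt e (ψ α) p)
    (hnull : ∀ p ∈ U, ambientForm n r (Y e p) (Y e p) = 0)
    (huu : ∀ p ∈ U, ambientForm n r (pu e (Y e) p) (pu e (Y e) p) = 0)
    (hvv : ∀ p ∈ U, ambientForm n r (pv e (Y e) p) (pv e (Y e) p) = 0)
    (huv : ∀ p ∈ U, ambientForm n r (pu e (Y e) p) (pv e (Y e) p) = 1 / 2)
    (hort : ∀ p ∈ U, ∀ α β, ambientForm n r (ψ α p) (ψ β p) = if α = β then ε α else 0)
    (hnor : ∀ p ∈ U, ∀ α, ψ α p ∈ confNormal r Y e p)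
    (heu : ∀ p ∈ U, pu e (pu e (Y e)) p = -(s₁ p / 2) • Y e p + ∑ α, k₁ p α • ψ α p)
    (hev : ∀ p ∈ U, pv e (pv e (Y e)) p = -(s₂ p / 2) • Y e p + ∑ α, k₂ p α • ψ α p)
    (hcu : ∀ p ∈ U, ∀ α, IsNormalPart r Y e p (pu e (ψ α) p) (∑ β, Γu p α β • ψ β p))
    (hcv : ∀ p ∈ U, ∀ α, IsNormalPart r Y e p (pv e (ψ α) p) (∑ β, Γv p α β • ψ β p)) :
    IsFramedSurface r e U ε s₁ s₂ k₁ k₂ Γu Γv (Y e) ψ where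
  isOpen := hU
  subset := hUe
  sign := hε
  smooth := hY
  smooth_normal := hψ
  null := hnull
  metric_uu := huu
  metric_vv := hvv
  metric_uv := huv
  orthonormal := hort
  normal p hp α := (confNormal_form (hnor p hp α)).1
  normal_u p hp α := (confNormal_form (hnor p hp α)).2.1
  normal_v p hp α := (confNormal_form (hnor p hp α)).2.2.1
  normal_uv p hp α := (confNormal_form (hnor p hp α)).2.2.2
  eq_uu := heu
  eq_vv := hev
  conn_u p hp α β := by
    rw [(hcu p hp α).form_eq (hnor p hp β)]
    simp [hort p hp]
  conn_v p hp α β := by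
    rw [(hcv p hp α).form_eq (hnor p hp β)]
    simp [hort p hp]

/-- Representatives of a projective point differ by a scalar, so nullity of one of them passes to
all. -/
theorem form_self_eq_zero_of_mk {l : ℙ ℝ (Ambient n)} (hl : l ∈ ProjLightCone n r) {x : Ambient n}
    {hx : x ≠ 0} (hxl : Projectivization.mk ℝ x hx = l) : ambientForm n r x x = 0 := by
  obtain ⟨z, hz, hz0, rfl⟩ := hl
  obtain ⟨a, rfl⟩ := (Projectivization.mk_eq_mk_iff' ℝ _ _ _ _).1 hxl
  simp [hz0]

/-- A linear map is determined by its values on the lift and on a normal frame near a point. -/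
theorem IsFramedSurface.linearMap_ext {e : Chart M} {U : Set M} {ε : Fin (n - 2) → ℝ}
    {s₁ s₂ : M → ℝ} {k₁ k₂ : M → Fin (n - 2) → ℝ} {Γu Γv : M → Fin (n - 2) → Fin (n - 2) → ℝ}
    {Y : M → Ambient n} {ψ : Fin (n - 2) → M → Ambient n}
    (h : IsFramedSurface r e U ε s₁ s₂ k₁ k₂ Γu Γv Y ψ) (hn : 2 ≤ n) {p : M} (hp : p ∈ U)
    {S T : Ambient n →ₗ[ℝ] Ambient n} (hY : ∀ᶠ q in 𝓝 p, S (Y q) = T (Y q))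
    (hψ : ∀ α, S (ψ α p) = T (ψ α p)) : S = T := by
  -- An identity S f = T f near p may be differentiated. Agreement on Y near p thus gives agreement
  -- on Y_u, Y_v and Y_uv, and hence on N.
  have hd : ∀ (w : ℝ × ℝ) (f : M → Ambient n), (∀ q ∈ U, ChartSmoothAt e f q) →
      (∀ᶠ q in 𝓝 p, S (f q) = T (f q)) →
      ∀ᶠ q in 𝓝 p, S (coordDeriv w e f q) = T (coordDeriv w e f q) := by
    intro w f hf hST
    filter_upwards [hST.eventually_nhds, h.isOpen.mem_nhds hp] with q hq hqU
    have h1 := coordDeriv_clm_comp (w := w) (hf q hqU) S.toContinuousLinearMap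
    have h2 := coordDeriv_clm_comp (w := w) (hf q hqU) T.toContinuousLinearMap
    have h3 := coordDeriv_congr (w := w) (h.subset hqU) hq
    exact h1.symm.trans (h3.trans h2)
  have hu := hd (1, 0) Y h.smooth hY
  have hv := (hd (0, 1) Y h.smooth hY).self_of_nhds
  have huv := (hd (0, 1) (pu e Y) (fun q hq => h.smooth_u hq) hu).self_of_nhds
  refine (h.isAdaptedFrame hp).ext_linearMap h.sign hn fun i => ?_
  rcases i with i | α
  · fin_cases i
    · exact hY.self_of_nhds
    · exact hu.self_of_nhds
    · exact hv
    · have e1 : surfaceFrame e (hopfPairing ε k₁ k₂) Y ψ p (.inl 3) =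
        (2 : ℝ) • pv e (pu e Y) p + (2 * hopfPairing ε k₁ k₂ p) • Y p := rfl
      change S (surfaceFrame e (hopfPairing ε k₁ k₂) Y ψ p (.inl 3)) =
        T (surfaceFrame e (hopfPairing ε k₁ k₂) Y ψ p (.inl 3))
      rw [e1, map_add, map_add, map_smul, map_smul, map_smul, map_smul, hY.self_of_nhds]
      congr 2
  · exact hψ α

variable [ChartedSpace (ℝ × ℝ) M]

theorem IsCanonicalLift.null {y : M → ProjLightCone n r} {Y : Chart M → M → Ambient n}
    (hY : IsCanonicalLift y Y) {e : Chart M} (he : e ∈ atlas (ℝ × ℝ) M) {p : M}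
    (hp : p ∈ e.source) : ambientForm n r (Y e p) (Y e p) = 0 :=
  let ⟨_, h⟩ := hY.isLift e he p hp
  form_self_eq_zero_of_mk (y p).2 h

theorem IsCanonicalLift.isFramedSurface {y : M → ProjLightCone n r}
    {Y κ₁ κ₂ : Chart M → M → Ambient n} {s₁ s₂ : Chart M → M → ℝ} (hY : IsCanonicalLift y Y)
    (hinv : HasConformalInvariants r Y κ₁ κ₂ s₁ s₂) {ε : Fin (n - 2) → ℝ}
    {ψ : Fin (n - 2) → M → Ambient n} (hψ : IsNormalFrame r Y ε ψ)
    {Γu Γv : Chart M → M → Fin (n - 2) → Fin (n - 2) → ℝ}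
    (hΓ : HasConnectionCoefficients r Y ψ Γu Γv) {k₁ k₂ : Chart M → M → Fin (n - 2) → ℝ}
    (hk : ∀ e ∈ atlas (ℝ × ℝ) M, ∀ p ∈ e.source,
      κ₁ e p = ∑ α, k₁ e p α • ψ α p ∧ κ₂ e p = ∑ α, k₂ e p α • ψ α p)
    {e : Chart M} (he : e ∈ atlas (ℝ × ℝ) M) :
    IsFramedSurface r e e.source ε (s₁ e) (s₂ e) (k₁ e) (k₂ e) (Γu e) (Γv e) (Y e) ψ :=
  isFramedSurface_of e.open_source le_rfl
    (fun α => by rcases hψ.sign α with h | h <;> simp [h])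
    (fun _ hp => (hY.smooth e he).chartSmoothAt e.open_source hp he hp)
    (fun _ hp α => (hψ.smooth α).chartSmoothAt isOpen_univ (mem_univ _) he hp)
    (fun _ hp => hY.null he hp) (hY.metric_uu e he) (hY.metric_vv e he) (hY.metric_uv e he)
    (fun p _ => hψ.orthonormal p)
    (fun p hp α => by
      rw [← hψ.span_eq e he p hp]
      exact Submodule.subset_span ⟨α, rfl⟩)
    (fun p hp => by rw [hinv.eq_uu e he p hp, (hk e he p hp).1])
    (fun p hp => by rw [hinv.eq_vv e he p hp, (hk e he p hp).2])
    (fun p hp α => (hΓ e he p hp α).1) (fun p hp α => (hΓ e he p hp α).2)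

/-- Uniqueness in the Bonnet theorem. -/
theorem exists_mobius_of_invariants_eq [ConnectedSpace M] (hn : 2 ≤ n)
    {y y' : M → ProjLightCone n r} {Y Y' : Chart M → M → Ambient n}
    (hY : IsCanonicalLift y Y) (hY' : IsCanonicalLift y' Y') {ε : Fin (n - 2) → ℝ}
    {ψ ψ' : Fin (n - 2) → M → Ambient n} {s₁ s₂ : Chart M → M → ℝ}
    {k₁ k₂ : Chart M → M → Fin (n - 2) → ℝ}
    {Γu Γv : Chart M → M → Fin (n - 2) → Fin (n - 2) → ℝ}
    (h : ∀ e ∈ atlas (ℝ × ℝ) M,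
      IsFramedSurface r e e.source ε (s₁ e) (s₂ e) (k₁ e) (k₂ e) (Γu e) (Γv e) (Y e) ψ)
    (h' : ∀ e ∈ atlas (ℝ × ℝ) M,
      IsFramedSurface r e e.source ε (s₁ e) (s₂ e) (k₁ e) (k₂ e) (Γu e) (Γv e) (Y' e) ψ') :
    ∃ T : Ambient n ≃ₗ[ℝ] Ambient n, IsPseudoOrthogonal n r T ∧
      ∀ p, mobiusMap T (y p) = y' p := by
  -- Including the normal frame makes the congruence near a point unique, and quantifying over all
  -- charts makes the condition independent of coordinates.
  let Cong : (Ambient n ≃ₗ[ℝ] Ambient n) → M → Prop := fun T p =>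
    ∀ᶠ q in 𝓝 p, (∀ e ∈ atlas (ℝ × ℝ) M, q ∈ e.source → T (Y e q) = Y' e q) ∧
      ∀ α, T (ψ α q) = ψ' α q
  have hex : ∀ p, ∃ T : Ambient n ≃ₗ[ℝ] Ambient n, IsPseudoOrthogonal n r T ∧ Cong T p := by
    intro p
    have he := chart_mem_atlas (ℝ × ℝ) p
    have hp := mem_chart_source (ℝ × ℝ) p
    obtain ⟨T, hT, hc⟩ := (h _ he).exists_congruence (h' _ he) hn hp
    refine ⟨T, hT, ?_⟩
    filter_upwards [hc, (chartAt (ℝ × ℝ) p).open_source.mem_nhds hp] with q hq hqe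
    refine ⟨fun e' he' hqe' => ?_, hq.2⟩
    -- Both canonical lifts acquire the same factor e^{-ρ} under a change of chart, so a congruence
    -- in one chart is a congruence in every chart.
    rw [hY.change _ he e' he' q ⟨hqe, hqe'⟩, hY'.change _ he e' he' q ⟨hqe, hqe'⟩, map_smul, hq.1]
  have huniq : ∀ p S T, Cong S p → Cong T p → S = T := by
    intro p S T hS hT
    have he := chart_mem_atlas (ℝ × ℝ) p
    have hp := mem_chart_source (ℝ × ℝ) p
    refine LinearEquiv.toLinearMap_injective ((h _ he).linearMap_ext hn hp ?_ fun α => ?_)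
    · filter_upwards [hS, hT, (chartAt (ℝ × ℝ) p).open_source.mem_nhds hp] with q h1 h2 hqe
      exact (h1.1 _ he hqe).trans (h2.1 _ he hqe).symm
    · exact (hS.self_of_nhds.2 α).trans (hT.self_of_nhds.2 α).symm
  obtain ⟨p₀⟩ : Nonempty M := inferInstance
  obtain ⟨T, hT, hT₀⟩ := hex p₀
  have hclopen : IsClopen {p | Cong T p} := by
    constructor
    -- Let S be the congruence near p. If T were a congruence at a nearby q, uniqueness at q would
    -- give S = T, so T would be one at p.
    · rw [← isOpen_compl_iff, isOpen_iff_mem_nhds]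
      intro p hp
      obtain ⟨S, -, hS⟩ := hex p
      filter_upwards [hS.eventually_nhds] with q hq hqT
      obtain rfl := huniq q _ _ hq hqT
      exact hp hS
    · exact isOpen_iff_mem_nhds.2 fun p hp => hp.eventually_nhds
  have hall : ∀ p, Cong T p := fun p => by
    have : p ∈ {p | Cong T p} := hclopen.eq_univ ⟨p₀, hT₀⟩ ▸ mem_univ p
    exact this
  refine ⟨T, hT, fun p => ?_⟩
  have he := chart_mem_atlas (ℝ × ℝ) p
  have hp := mem_chart_source (ℝ × ℝ) p
  obtain ⟨h1, h2⟩ := hY.isLift _ he p hp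
  obtain ⟨h1', h2'⟩ := hY'.isLift _ he p hp
  rw [← h2, ← h2', mobiusMap, Projectivization.map_mk]
  congr 1
  exact (hall p).self_of_nhds.1 _ he hp

end Uniqueness

/-! ### Integration of the structure equations -/

section Integration

open Set Filter Topology Module

variable {n r : ℕ}

/-- The coefficient matrix lies in the Lie algebra of the orthogonal group of `frameGram`; this is
what preserves the Gram matrix during integration. -/
theorem frameCoefU_skew {ε : Fin (n - 2) → ℝ} {s c : ℝ}
    {k l : Fin (n - 2) → ℝ} {Γ : Fin (n - 2) → Fin (n - 2) → ℝ}
    (hΓ : ∀ α β, Γ α β * ε β + Γ β α * ε α = 0) (i j : FrameIndex n) :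
    ∑ m, frameCoefU ε s c k l Γ i m * frameGram ε m j +
      ∑ m, frameCoefU ε s c k l Γ j m * frameGram ε m i = 0 := by
  obtain ⟨g0, g1, g2, g3, g4⟩ := sum_frameGram (ε := ε) (frameCoefU ε s c k l Γ i)
  obtain ⟨g0', g1', g2', g3', g4'⟩ := sum_frameGram (ε := ε) (frameCoefU ε s c k l Γ j)
  rcases i with i | α <;> rcases j with j | β
  · fin_cases i <;> fin_cases j <;>
      simp only [Fin.zero_eta, Fin.mk_one, Fin.reduceFinMk] at * <;>
      simp only [g0, g1, g2, g3, g0', g1', g2', g3'] <;> simp [frameCoefU] <;> ring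
  · fin_cases i <;> simp only [Fin.zero_eta, Fin.mk_one, Fin.reduceFinMk] at * <;>
      simp only [g4, g0', g1', g2', g3'] <;> simp [frameCoefU] <;> ring
  · fin_cases j <;> simp only [Fin.zero_eta, Fin.mk_one, Fin.reduceFinMk] at * <;>
      simp only [g4', g0, g1, g2, g3] <;> simp [frameCoefU] <;> ring
  · rw [g4, g4']
    exact hΓ α β

theorem frameCoefV_skew {ε : Fin (n - 2) → ℝ} {s c : ℝ}
    {k l : Fin (n - 2) → ℝ} {Γ : Fin (n - 2) → Fin (n - 2) → ℝ}
    (hΓ : ∀ α β, Γ α β * ε β + Γ β α * ε α = 0) (i j : FrameIndex n) :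
    ∑ m, frameCoefV ε s c k l Γ i m * frameGram ε m j +
      ∑ m, frameCoefV ε s c k l Γ j m * frameGram ε m i = 0 := by
  obtain ⟨g0, g1, g2, g3, g4⟩ := sum_frameGram (ε := ε) (frameCoefV ε s c k l Γ i)
  obtain ⟨g0', g1', g2', g3', g4'⟩ := sum_frameGram (ε := ε) (frameCoefV ε s c k l Γ j)
  rcases i with i | α <;> rcases j with j | β
  · fin_cases i <;> fin_cases j <;>
      simp only [Fin.zero_eta, Fin.mk_one, Fin.reduceFinMk] at * <;>
      simp only [g0, g1, g2, g3, g0', g1', g2', g3'] <;> simp [frameCoefV] <;> ring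
  · fin_cases i <;> simp only [Fin.zero_eta, Fin.mk_one, Fin.reduceFinMk] at * <;>
      simp only [g4, g0', g1', g2', g3'] <;> simp [frameCoefV] <;> ring
  · fin_cases j <;> simp only [Fin.zero_eta, Fin.mk_one, Fin.reduceFinMk] at * <;>
      simp only [g4', g0, g1, g2, g3] <;> simp [frameCoefV] <;> ring
  · rw [g4, g4']
    exact hΓ α β

/-- The derivative of `frameCoefU` in terms of the derivatives of its entries. -/
def frameCoefU' (ε : Fin (n - 2) → ℝ) (s c : ℝ) (k l : Fin (n - 2) → ℝ)
    (Γ : Fin (n - 2) → Fin (n - 2) → ℝ) : FrameIndex n → FrameIndex n → ℝ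
  | .inl i, .inl j => !![0, 0, 0, 0; -(s / 2), 0, 0, 0; -c, 0, 0, 0; 0, -(2 * c), -s, 0] i j
  | .inl i, .inr β => ![0, k β, 0, 2 * l β] i
  | .inr α, .inl j => ![2 * (ε α * l α), 0, -(2 * (ε α * k α)), 0] j
  | .inr α, .inr β => Γ α β

/-- The derivative of `frameCoefV` in terms of the derivatives of its entries. -/
def frameCoefV' (ε : Fin (n - 2) → ℝ) (s c : ℝ) (k l : Fin (n - 2) → ℝ)
    (Γ : Fin (n - 2) → Fin (n - 2) → ℝ) : FrameIndex n → FrameIndex n → ℝ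
  | .inl i, .inl j => !![0, 0, 0, 0; -c, 0, 0, 0; -(s / 2), 0, 0, 0; 0, -s, -(2 * c), 0] i j
  | .inl i, .inr β => ![0, 0, k β, 2 * l β] i
  | .inr α, .inl j => ![2 * (ε α * l α), -(2 * (ε α * k α)), 0, 0] j
  | .inr α, .inr β => Γ α β

/-- The Gauss, Codazzi and Ricci equations are the integrability conditions of the structure
equations. -/
theorem frameCoef_compat {ε : Fin (n - 2) → ℝ} {s₁ s₂ c s₁' s₂' cu cv : ℝ}
    {k₁ k₂ l₁ l₂ k₁' k₂' l₁' l₂' : Fin (n - 2) → ℝ}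
    {Γu Γv Γu' Γv' : Fin (n - 2) → Fin (n - 2) → ℝ}
    (hc : c = ∑ α, k₁ α * (k₂ α * ε α))
    (hl₁ : ∀ α, l₁ α = k₁' α + ∑ β, k₁ β * Γv β α)
    (hl₂ : ∀ α, l₂ α = k₂' α + ∑ β, k₂ β * Γu β α)
    (hΓu : ∀ α β, Γu α β * ε β + Γu β α * ε α = 0)
    (hΓv : ∀ α β, Γv α β * ε β + Γv β α * ε α = 0)
    (hs₁ : s₁' / 2 = 2 * ∑ α, k₁ α * (l₂ α * ε α) + cu)
    (hs₂ : s₂' / 2 = 2 * ∑ α, k₂ α * (l₁ α * ε α) + cv)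
    (hcod : ∀ α, l₁' α + ∑ β, l₁ β * Γv β α + s₂ / 2 * k₁ α =
      l₂' α + ∑ β, l₂ β * Γu β α + s₁ / 2 * k₂ α)
    (hric : ∀ α β, (Γu' α β + ∑ γ, Γu α γ * Γv γ β) - (Γv' α β + ∑ γ, Γv α γ * Γu γ β) =
      2 * (ε α * k₁ α) * k₂ β - 2 * (ε α * k₂ α) * k₁ β) (i j : FrameIndex n) :
    frameCoefU' ε s₁' cv k₁' l₁' Γu' i j +
        ∑ m, frameCoefU ε s₁ c k₁ l₁ Γu i m * frameCoefV ε s₂ c k₂ l₂ Γv m j =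
      frameCoefV' ε s₂' cu k₂' l₂' Γv' i j +
        ∑ m, frameCoefV ε s₂ c k₂ l₂ Γv i m * frameCoefU ε s₁ c k₁ l₁ Γu m j := by
  have skew : ∀ {Γ : Fin (n - 2) → Fin (n - 2) → ℝ}
      (_ : ∀ α β, Γ α β * ε β + Γ β α * ε α = 0) (x : Fin (n - 2) → ℝ) (α : Fin (n - 2)),
      ∑ β, Γ α β * (2 * (ε β * x β)) = -(2 * ε α * ∑ β, x β * Γ β α) := by
    intro Γ hΓ x α
    rw [Finset.mul_sum, ← Finset.sum_neg_distrib]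
    refine Finset.sum_congr rfl fun β _ => ?_
    linear_combination 2 * x β * hΓ α β
  have pull : ∀ x y : Fin (n - 2) → ℝ,
      ∑ α, x α * (2 * (ε α * y α)) = 2 * ∑ α, x α * (y α * ε α) := by
    intro x y
    rw [Finset.mul_sum]
    exact Finset.sum_congr rfl fun α _ => by ring
  have swap : ∀ x y : Fin (n - 2) → ℝ,
      ∑ α, x α * (y α * ε α) = ∑ α, y α * (x α * ε α) := fun x y =>
    Finset.sum_congr rfl fun α _ => by ring
  have two : ∀ x y : Fin (n - 2) → ℝ, ∑ α, 2 * x α * y α = 2 * ∑ α, x α * y α := by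
    intro x y
    rw [Finset.mul_sum]
    exact Finset.sum_congr rfl fun α _ => by ring
  -- In the tangential block the nontrivial entries are the Gauss equations and the definition of c.
  -- The mixed blocks contain the definitions of l₁ and l₂ and the Codazzi equation, and the normal
  -- block is the Ricci equation.
  rcases i with i | α
  · rcases j with j | β
    · fin_cases i <;> fin_cases j <;>
        simp [Fintype.sum_sum_type, Fin.sum_univ_four, frameCoefU, frameCoefV, frameCoefU',
          frameCoefV', two, pull]
      · linear_combination -hs₁
      · rw [hc]; ring
      · ring
      · linear_combination hs₂
      · ring
      · rw [hc, swap k₂ k₁]; ring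
      · rw [swap l₂ l₁]; ring
      · rw [swap l₁ k₂]; linear_combination 2 * hs₂
      · rw [swap l₂ k₁]; linear_combination -2 * hs₁
    · fin_cases i <;>
        simp [Fintype.sum_sum_type, Fin.sum_univ_four, frameCoefU, frameCoefV, frameCoefU',
          frameCoefV', two]
      · linear_combination -hl₁ β
      · linear_combination hl₂ β
      · linear_combination 2 * hcod β
  · rcases j with j | β
    · fin_cases j <;>
        simp [Fintype.sum_sum_type, Fin.sum_univ_four, frameCoefU, frameCoefV, frameCoefU',
          frameCoefV', skew hΓu, skew hΓv]
      · linear_combination 2 * ε α * hcod α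
      · linear_combination -2 * ε α * hl₂ α
      · linear_combination 2 * ε α * hl₁ α
    · simp [Fintype.sum_sum_type, Fin.sum_univ_four, frameCoefU, frameCoefV, frameCoefU',
          frameCoefV']
      linear_combination hric α β

end Integration

/-! ### Local existence of adapted frames with given coefficients -/

section FrameExistence

open Set Filter Topology Module

variable {ι : Type*} [Fintype ι] {F : Type*} [NormedAddCommGroup F] [NormedSpace ℝ F]

/-- The action of a matrix of coefficients on families of vectors. -/
def coefOp (ι : Type*) [Fintype ι] (F : Type*) [NormedAddCommGroup F] [NormedSpace ℝ F] :
    (ι → ι → ℝ) →L[ℝ] (ι → F) →L[ℝ] (ι → F) :=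
  LinearMap.toContinuousLinearMap
    { toFun := fun a => ContinuousLinearMap.pi fun i => ∑ j, a i j • ContinuousLinearMap.proj j
      map_add' := fun a b => by ext; simp [add_smul, Finset.sum_add_distrib]
      map_smul' := fun c a => by ext; simp [mul_smul, Finset.smul_sum] }

@[simp]
theorem coefOp_apply (a : ι → ι → ℝ) (X : ι → F) (i : ι) :
    coefOp ι F a X i = ∑ j, a i j • X j := by
  simp [coefOp]

/-- The derivative of the Gram matrix of a family of vectors. -/
def gramOp (ι : Type*) [Fintype ι] :
    (ι → ι → ℝ) →L[ℝ] (ι → ι → ℝ) →L[ℝ] (ι → ι → ℝ) :=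
  (LinearMap.mk₂ ℝ
    (fun (a Z : ι → ι → ℝ) i j => ∑ m, a i m * Z m j + ∑ m, a j m * Z m i)
    (fun a b Z => by
      funext i j
      simp only [Pi.add_apply, add_mul, Finset.sum_add_distrib]
      ring)
    (fun c a Z => by
      funext i j
      simp only [Pi.smul_apply, smul_eq_mul, mul_assoc, ← Finset.mul_sum, mul_add])
    (fun a Y Z => by
      funext i j
      simp only [Pi.add_apply, mul_add, Finset.sum_add_distrib]
      ring)
    (fun c a Z => by
      funext i j
      simp only [Pi.smul_apply, smul_eq_mul, mul_left_comm _ c, ← Finset.mul_sum,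
        mul_add])).toContinuousBilinearMap

@[simp]
theorem gramOp_apply (a Z : ι → ι → ℝ) (i j : ι) :
    gramOp ι a Z i j = ∑ m, a i m * Z m j + ∑ m, a j m * Z m i := rfl

variable {M : Type*} [TopologicalSpace M]

theorem chartSmoothAt_pi {e : Chart M} {p : M} {f : M → ι → F} :
    ChartSmoothAt e f p ↔ ∀ i, ChartSmoothAt e (fun q => f q i) p :=
  contDiffAt_pi

theorem coordDeriv_pi {e : Chart M} {p : M} {f : M → ι → F} (hf : ChartSmoothAt e f p)
    (w : ℝ × ℝ) (i : ι) : coordDeriv w e f p i = coordDeriv w e (fun q => f q i) p :=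
  (coordDeriv_clm_comp hf (ContinuousLinearMap.proj (R := ℝ) (φ := fun _ : ι => F) i)).symm

/-- Local solvability of an integrable linear system for families of vectors. -/
theorem exists_family_solution [CompleteSpace F] {e : Chart M} {U : Set M} (hU : IsOpen U)
    (hUe : U ⊆ e.source) {a b : M → ι → ι → ℝ}
    (ha : ∀ q ∈ U, ∀ i j, ChartSmoothAt e (fun q => a q i j) q)
    (hb : ∀ q ∈ U, ∀ i j, ChartSmoothAt e (fun q => b q i j) q)
    (hab : ∀ q ∈ U, ∀ i j, pv e (fun q => a q i j) q + ∑ m, a q i m * b q m j =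
      pu e (fun q => b q i j) q + ∑ m, b q i m * a q m j) {p : M} (hp : p ∈ U) (X₀ : ι → F) :
    ∃ W : Set (ℝ × ℝ), IsOpen W ∧ Convex ℝ W ∧ e p ∈ W ∧ W ⊆ e.target ∩ e.symm ⁻¹' U ∧
      ∃ X : M → ι → F, X p = X₀ ∧ ∀ q ∈ e.source ∩ e ⁻¹' W, ChartSmoothAt e X q ∧
        pu e X q = coefOp ι F (a q) (X q) ∧ pv e X q = coefOp ι F (b q) (X q) := by
  have ha' : ∀ q ∈ U, ChartSmoothAt e a q := fun q hq =>
    chartSmoothAt_pi.2 fun i => chartSmoothAt_pi.2 fun j => ha q hq i j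
  have hb' : ∀ q ∈ U, ChartSmoothAt e b q := fun q hq =>
    chartSmoothAt_pi.2 fun i => chartSmoothAt_pi.2 fun j => hb q hq i j
  set Ω := e.target ∩ e.symm ⁻¹' U with hΩ
  have hΩo : IsOpen Ω := e.isOpen_inter_preimage_symm hU
  have hcont : ∀ {a : M → ι → ι → ℝ}, (∀ q ∈ U, ChartSmoothAt e a q) →
      ContDiffOn ℝ ∞ (fun x => coefOp ι F (a (e.symm x))) Ω := by
    intro a ha x hx
    have := ha _ hx.2
    rw [ChartSmoothAt, e.right_inv hx.1] at this
    exact ((coefOp ι F).contDiff.contDiffAt.comp x this).contDiffWithinAt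
  have hder : ∀ {a : M → ι → ι → ℝ}, (∀ q ∈ U, ChartSmoothAt e a q) → ∀ x ∈ Ω, ∀ w,
      fderiv ℝ (fun x => coefOp ι F (a (e.symm x))) x w =
        coefOp ι F (coordDeriv w e a (e.symm x)) := by
    intro a ha x hx w
    rw [← coordDeriv_clm_comp (ha _ hx.2), coordDeriv, e.right_inv hx.1]
  have hcompat : ∀ x ∈ Ω, fderiv ℝ (fun x => coefOp ι F (a (e.symm x))) x (0, 1) +
      coefOp ι F (a (e.symm x)) ∘L coefOp ι F (b (e.symm x)) =
      fderiv ℝ (fun x => coefOp ι F (b (e.symm x))) x (1, 0) +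
      coefOp ι F (b (e.symm x)) ∘L coefOp ι F (a (e.symm x)) := by
    intro x hx
    -- Composition of the operators is the matrix product in the same order, so the hypothesis on
    -- coefficients is exactly the Frobenius condition.
    have hcomp : ∀ a b : ι → ι → ℝ, coefOp ι F a ∘L coefOp ι F b =
        coefOp ι F fun i j => ∑ m, a i m * b m j := by
      intro a b
      refine ContinuousLinearMap.ext fun X => funext fun i => ?_
      simp only [ContinuousLinearMap.comp_apply, coefOp_apply, Finset.smul_sum, Finset.sum_smul,
        smul_smul]
      exact Finset.sum_comm
    rw [hder ha' x hx, hder hb' x hx, hcomp, hcomp, ← map_add, ← map_add]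
    congr 1
    funext i j
    have h1 := hab _ hx.2 i j
    simp only [Pi.add_apply]
    rw [coordDeriv_pi (ha' _ hx.2), coordDeriv_pi (chartSmoothAt_pi.1 (ha' _ hx.2) i),
      coordDeriv_pi (hb' _ hx.2), coordDeriv_pi (chartSmoothAt_pi.1 (hb' _ hx.2) i)]
    exact h1
  have hpΩ : e p ∈ Ω := ⟨e.map_source (hUe hp), by simpa [e.left_inv (hUe hp)] using hp⟩
  obtain ⟨W, hWo, hWc, hpW, hWΩ, X, hX0, hXs, hXd⟩ := exists_local_solution_of_compat hΩo
    (hcont ha') (hcont hb') hcompat hpΩ X₀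
  refine ⟨W, hWo, hWc, hpW, hWΩ, fun q => X (e q), hX0, fun q hq => ⟨?_, ?_, ?_⟩⟩
  · exact chartSmoothAt_of_comp hq.1 (hXs.contDiffAt (hWo.mem_nhds hq.2))
  · rw [pu, coordDeriv_of_comp hq.1, (hXd _ hq.2).1, e.left_inv hq.1]
  · rw [pv, coordDeriv_of_comp hq.1, (hXd _ hq.2).2, e.left_inv hq.1]

/-- Local existence of adapted frames with prescribed integrable skew-symmetric coefficients. -/
theorem exists_adaptedFrame_solution {n r : ℕ} {ε : Fin (n - 2) → ℝ} {e : Chart M} {U : Set M}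
    (hU : IsOpen U) (hUe : U ⊆ e.source) {a b : M → FrameIndex n → FrameIndex n → ℝ}
    (ha : ∀ q ∈ U, ∀ i j, ChartSmoothAt e (fun q => a q i j) q)
    (hb : ∀ q ∈ U, ∀ i j, ChartSmoothAt e (fun q => b q i j) q)
    (hab : ∀ q ∈ U, ∀ i j, pv e (fun q => a q i j) q + ∑ m, a q i m * b q m j =
      pu e (fun q => b q i j) q + ∑ m, b q i m * a q m j)
    (ha0 : ∀ q ∈ U, ∀ i j,
      ∑ m, a q i m * frameGram ε m j + ∑ m, a q j m * frameGram ε m i = 0)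
    (hb0 : ∀ q ∈ U, ∀ i j,
      ∑ m, b q i m * frameGram ε m j + ∑ m, b q j m * frameGram ε m i = 0)
    {p : M} (hp : p ∈ U) {X₀ : FrameIndex n → Ambient n} (hX₀ : IsAdaptedFrame r ε X₀) :
    ∃ B : Set M, IsOpen B ∧ p ∈ B ∧ B ⊆ U ∧ ∃ X : M → FrameIndex n → Ambient n, ∀ q ∈ B,
      IsAdaptedFrame r ε (X q) ∧ ∀ i, ChartSmoothAt e (fun q => X q i) q ∧
        pu e (fun q => X q i) q = ∑ j, a q i j • X q j ∧
        pv e (fun q => X q i) q = ∑ j, b q i j • X q j := by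
  obtain ⟨W, hWo, hWc, hpW, hWΩ, X, hX0, hX⟩ :=
    exists_family_solution (F := Ambient n) hU hUe ha hb hab hp X₀
  have hXi : ∀ q ∈ e.source ∩ e ⁻¹' W, ∀ i, ChartSmoothAt e (fun q => X q i) q ∧
      pu e (fun q => X q i) q = ∑ j, a q i j • X q j ∧
      pv e (fun q => X q i) q = ∑ j, b q i j • X q j := by
    intro q hq i
    obtain ⟨h1, h2, h3⟩ := hX q hq
    refine ⟨chartSmoothAt_pi.1 h1 i, ?_, ?_⟩
    · rw [pu, ← coordDeriv_pi h1, ← coefOp_apply, ← h2]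
    · rw [pv, ← coordDeriv_pi h1, ← coefOp_apply, ← h3]
  have hmem : ∀ x ∈ W, e.symm x ∈ e.source ∩ e ⁻¹' W := fun x hx =>
    ⟨e.map_target (hWΩ hx).1, by simpa [e.right_inv (hWΩ hx).1] using hx⟩
  -- Z is the defect of the Gram matrix. Skewness removes the inhomogeneous terms from its equation,
  -- so Z solves a homogeneous linear system with value zero at p and vanishes.
  set Z : M → FrameIndex n → FrameIndex n → ℝ := fun q i j =>
    ambientForm n r (X q i) (X q j) - frameGram ε i j with hZ
  have hZij : ∀ q ∈ e.source ∩ e ⁻¹' W, ∀ i j, ChartSmoothAt e (fun q => Z q i j) q :=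
    fun q hq i j => ((hXi q hq i).1.form (hXi q hq j).1).sub (chartSmoothAt_const _)
  have hZs : ∀ q ∈ e.source ∩ e ⁻¹' W, ChartSmoothAt e Z q := fun q hq =>
    chartSmoothAt_pi.2 fun i => chartSmoothAt_pi.2 fun j => hZij q hq i j
  have hZd : ∀ q ∈ e.source ∩ e ⁻¹' W, ∀ (w : ℝ × ℝ) (c : FrameIndex n → FrameIndex n → ℝ),
      (∀ i, coordDeriv w e (fun q => X q i) q = ∑ j, c i j • X q j) →
      (∀ i j, ∑ m, c i m * frameGram ε m j + ∑ m, c j m * frameGram ε m i = 0) →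
      coordDeriv w e Z q = gramOp _ c (Z q) := by
    intro q hq w c hc hc0
    funext i j
    rw [coordDeriv_pi (hZs q hq), coordDeriv_pi (chartSmoothAt_pi.1 (hZs q hq) i), hZ,
      coordDeriv_sub ((hXi q hq i).1.form (hXi q hq j).1) (chartSmoothAt_const _),
      coordDeriv_const, coordDeriv_form hq.1 (hXi q hq i).1 (hXi q hq j).1, hc, hc,
      gramOp_apply]
    have h0 := hc0 i j
    simp only [mul_sub, Finset.sum_sub_distrib, map_sum, LinearMap.sum_apply, map_smul,
      LinearMap.smul_apply, smul_eq_mul, ambientForm_comm (X q i)]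
    linarith
  have hcont : ∀ {a : M → FrameIndex n → FrameIndex n → ℝ},
      (∀ q ∈ U, ∀ i j, ChartSmoothAt e (fun q => a q i j) q) →
      ContinuousOn (fun x => gramOp _ (a (e.symm x))) W := by
    intro a ha x hx
    have h1 : ChartSmoothAt e a (e.symm x) :=
      chartSmoothAt_pi.2 fun i => chartSmoothAt_pi.2 fun j => ha _ (hWΩ hx).2 i j
    rw [ChartSmoothAt, e.right_inv (hWΩ hx).1] at h1
    exact ((gramOp _).continuous.continuousAt.comp (f := fun x => a (e.symm x))
      h1.continuousAt).continuousWithinAt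
  have hzero := eq_zero_of_linear_system (Z := fun x => Z (e.symm x)) hWo hWc (hcont ha)
    (hcont hb)
    (fun x hx => by
      have := (hZs _ (hmem x hx)).differentiableAt
      rw [e.right_inv (hWΩ hx).1] at this
      exact this.differentiableWithinAt)
    (fun x hx => by
      have := hZd _ (hmem x hx) (1, 0) _ (fun i => (hXi _ (hmem x hx) i).2.1)
        (ha0 _ (hWΩ hx).2)
      rwa [coordDeriv, e.right_inv (hWΩ hx).1] at this)
    (fun x hx => by
      have := hZd _ (hmem x hx) (0, 1) _ (fun i => (hXi _ (hmem x hx) i).2.2)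
        (hb0 _ (hWΩ hx).2)
      rwa [coordDeriv, e.right_inv (hWΩ hx).1] at this) hpW
    (by
      funext i j
      simp [hZ, e.left_inv (hUe hp), hX0, hX₀ i j])
  refine ⟨e.source ∩ e ⁻¹' W, e.isOpen_inter_preimage hWo, ⟨hUe hp, hpW⟩, fun q hq => ?_, X,
    fun q hq => ⟨fun i j => ?_, hXi q hq⟩⟩
  · simpa [e.left_inv hq.1] using (hWΩ hq.2).2
  · have := congrFun (congrFun (hzero _ hq.2) i) j
    simp only [e.left_inv hq.1] at this
    exact sub_eq_zero.1 this

end FrameExistence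

/-! ### Components of sections and connections in a local frame -/

section LocalFrames

open Set Filter Topology Module

variable {n r : ℕ} {M : Type*} [TopologicalSpace M]

section Entries

variable {e : Chart M} {p : M} {w : ℝ × ℝ} {ε : Fin (n - 2) → ℝ} {s c : M → ℝ}
  {k l : M → Fin (n - 2) → ℝ} {Γ : M → Fin (n - 2) → Fin (n - 2) → ℝ}

theorem ChartSmoothAt.const_mul {a : M → ℝ} (ha : ChartSmoothAt e a p) (b : ℝ) :
    ChartSmoothAt e (fun q => b * a q) p :=
  (chartSmoothAt_const b).mul ha

theorem chartSmoothAt_frameCoef (hs : ChartSmoothAt e s p) (hc : ChartSmoothAt e c p)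
    (hk : ∀ α, ChartSmoothAt e (fun q => k q α) p) (hl : ∀ α, ChartSmoothAt e (fun q => l q α) p)
    (hΓ : ∀ α β, ChartSmoothAt e (fun q => Γ q α β) p) (i j : FrameIndex n) :
    ChartSmoothAt e (fun q => frameCoefU ε (s q) (c q) (k q) (l q) (Γ q) i j) p ∧
      ChartSmoothAt e (fun q => frameCoefV ε (s q) (c q) (k q) (l q) (Γ q) i j) p := by
  have h0 : ∀ a : ℝ, ChartSmoothAt e (fun _ => a) p := fun a => chartSmoothAt_const a
  have h1 : ChartSmoothAt e (fun q => -(s q / 2)) p := by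
    simpa only [div_eq_inv_mul] using (hs.const_mul 2⁻¹).neg
  have h2 := hc.neg
  have h3 := (hc.const_mul 2).neg
  have h4 := hs.neg
  have h5 := fun α => (hl α).const_mul 2
  have h6 := fun α => ((hl α).const_mul (ε α)).const_mul 2
  have h7 := fun α => (((hk α).const_mul (ε α)).const_mul 2).neg
  rcases i with i | α <;> rcases j with j | β
  · fin_cases i <;> fin_cases j <;> simp [frameCoefU, frameCoefV, h0, h1, h2, h3, h4]
  · fin_cases i <;> simp [frameCoefU, frameCoefV, h0, hk, h5]
  · fin_cases j <;> simp [frameCoefU, frameCoefV, h0, h6, h7]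
  · exact ⟨hΓ α β, hΓ α β⟩

theorem coordDeriv_frameCoef (hs : ChartSmoothAt e s p) (hc : ChartSmoothAt e c p)
    (hk : ∀ α, ChartSmoothAt e (fun q => k q α) p) (hl : ∀ α, ChartSmoothAt e (fun q => l q α) p)
    (i j : FrameIndex n) :
    coordDeriv w e (fun q => frameCoefU ε (s q) (c q) (k q) (l q) (Γ q) i j) p =
        frameCoefU' ε (coordDeriv w e s p) (coordDeriv w e c p)
          (fun α => coordDeriv w e (fun q => k q α) p)
          (fun α => coordDeriv w e (fun q => l q α) p)
          (fun α β => coordDeriv w e (fun q => Γ q α β) p) i j ∧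
      coordDeriv w e (fun q => frameCoefV ε (s q) (c q) (k q) (l q) (Γ q) i j) p =
        frameCoefV' ε (coordDeriv w e s p) (coordDeriv w e c p)
          (fun α => coordDeriv w e (fun q => k q α) p)
          (fun α => coordDeriv w e (fun q => l q α) p)
          (fun α β => coordDeriv w e (fun q => Γ q α β) p) i j := by
  have h0 : ∀ a : ℝ, coordDeriv w e (fun _ => a) p = 0 := fun a => coordDeriv_const a
  have h1 : coordDeriv w e (fun q => -(s q / 2)) p = -(coordDeriv w e s p / 2) := by
    simp only [div_eq_inv_mul]
    rw [coordDeriv_neg (hs.const_mul 2⁻¹), coordDeriv_const_mul hs]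
  have h2 := coordDeriv_neg (w := w) hc
  have h3 : coordDeriv w e (fun q => -(2 * c q)) p = -(2 * coordDeriv w e c p) := by
    rw [coordDeriv_neg (hc.const_mul 2), coordDeriv_const_mul hc]
  have h4 := coordDeriv_neg (w := w) hs
  have h5 := fun α => coordDeriv_const_mul (w := w) (hl α) 2
  have h6 : ∀ α, coordDeriv w e (fun q => 2 * (ε α * l q α)) p =
      2 * (ε α * coordDeriv w e (fun q => l q α) p) := fun α => by
    rw [coordDeriv_const_mul ((hl α).const_mul (ε α)), coordDeriv_const_mul (hl α)]
  have h7 : ∀ α, coordDeriv w e (fun q => -(2 * (ε α * k q α))) p =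
      -(2 * (ε α * coordDeriv w e (fun q => k q α) p)) := fun α => by
    rw [coordDeriv_neg (((hk α).const_mul (ε α)).const_mul 2),
      coordDeriv_const_mul ((hk α).const_mul (ε α)), coordDeriv_const_mul (hk α)]
  rcases i with i | α <;> rcases j with j | β
  · fin_cases i <;> fin_cases j <;>
      simp [frameCoefU, frameCoefV, frameCoefU', frameCoefV', h0, h1, h2, h3, h4]
  · fin_cases i <;> simp [frameCoefU, frameCoefV, frameCoefU', frameCoefV', h0, h5]
  · fin_cases j <;> simp [frameCoefU, frameCoefV, frameCoefU', frameCoefV', h0, h6, h7]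
  · exact ⟨rfl, rfl⟩

end Entries

variable [ChartedSpace (ℝ × ℝ) M]

/-- `f` is a smooth orthonormal frame of the bundle `NM` over the open set `U`. -/
structure IsLocalFrame (r : ℕ) (NM : M → Submodule ℝ (Ambient n)) (U : Set M)
    (ε : Fin (n - 2) → ℝ) (f : Fin (n - 2) → M → Ambient n) : Prop where
  isOpen : IsOpen U
  sign : ∀ α, ε α * ε α = 1
  isSectionOn : ∀ α, IsSectionOn NM U (f α)
  eq_span : ∀ q ∈ U, NM q = Submodule.span ℝ (range fun α => f α q)
  orthonormal : ∀ q ∈ U, ∀ α β, ambientForm n r (f α q) (f β q) = if α = β then ε α else 0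

theorem IsSectionOn.mono {NM : M → Submodule ℝ (Ambient n)} {U V : Set M} {σ : M → Ambient n}
    (h : IsSectionOn NM U σ) (hVU : V ⊆ U) : IsSectionOn NM V σ :=
  ⟨h.1.mono hVU, fun p hp => h.2 p (hVU hp)⟩

theorem IsNormalSubbundle.exists_isLocalFrame {NM : M → Submodule ℝ (Ambient n)}
    (h : IsNormalSubbundle n r NM) {e : Chart M} {p : M} (hp : p ∈ e.source) :
    ∃ U, p ∈ U ∧ U ⊆ e.source ∧ ∃ f, IsLocalFrame r NM U (normalSign n r) f := by
  obtain ⟨U, hU, hpU, f, hf, hf'⟩ := h p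
  refine ⟨U ∩ e.source, ⟨hpU, hp⟩, inter_subset_right, f, hU.inter e.open_source,
    normalSign_mul_self, fun α => ⟨(hf α).mono inter_subset_left, fun q hq => ?_⟩,
    fun q hq => (hf' q hq.1).1, fun q hq => (hf' q hq.1).2⟩
  rw [(hf' q hq.1).1]
  exact Submodule.subset_span ⟨α, rfl⟩

/-- The components of a section in an orthonormal frame. -/
def sectionCoef (r : ℕ) (ε : Fin (n - 2) → ℝ) (f : Fin (n - 2) → M → Ambient n)
    (σ : M → Ambient n) (q : M) (α : Fin (n - 2)) : ℝ :=
  ε α * ambientForm n r (σ q) (f α q)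

namespace IsLocalFrame

variable {NM : M → Submodule ℝ (Ambient n)} {U : Set M} {ε : Fin (n - 2) → ℝ}
  {f : Fin (n - 2) → M → Ambient n} (hf : IsLocalFrame r NM U ε f)

include hf

theorem mono {V : Set M} (hV : IsOpen V) (hVU : V ⊆ U) : IsLocalFrame r NM V ε f where
  isOpen := hV
  sign := hf.sign
  isSectionOn α := (hf.isSectionOn α).mono hVU
  eq_span q hq := hf.eq_span q (hVU hq)
  orthonormal q hq := hf.orthonormal q (hVU hq)

theorem form_sum_left {q : M} (hq : q ∈ U) (c : Fin (n - 2) → ℝ) (α : Fin (n - 2)) :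
    ambientForm n r (∑ β, c β • f β q) (f α q) = c α * ε α := by
  simp [hf.orthonormal q hq]

theorem form_sum {q : M} (hq : q ∈ U) (c d : Fin (n - 2) → ℝ) :
    ambientForm n r (∑ β, c β • f β q) (∑ β, d β • f β q) = ∑ α, c α * (d α * ε α) := by
  rw [map_sum]
  refine Finset.sum_congr rfl fun α _ => ?_
  rw [map_smul, hf.form_sum_left hq, smul_eq_mul]
  ring

theorem sum_injective {q : M} (hq : q ∈ U) {c d : Fin (n - 2) → ℝ}
    (h : ∑ β, c β • f β q = ∑ β, d β • f β q) (α : Fin (n - 2)) : c α = d α := by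
  have := congrArg (fun x => ambientForm n r x (f α q) * ε α) h
  simpa only [hf.form_sum_left hq, mul_assoc, hf.sign, mul_one] using this

theorem eq_sum_of_mem {q : M} (hq : q ∈ U) {x : Ambient n} (hx : x ∈ NM q) :
    x = ∑ α, (ε α * ambientForm n r x (f α q)) • f α q := by
  rw [hf.eq_span q hq] at hx
  obtain ⟨c, rfl⟩ := (Submodule.mem_span_range_iff_exists_fun ℝ).1 hx
  refine Finset.sum_congr rfl fun α _ => ?_
  rw [hf.form_sum_left hq, mul_left_comm, hf.sign, mul_one]

theorem sectionCoef_sum {q : M} (hq : q ∈ U) {σ : M → Ambient n} (hσ : σ q ∈ NM q) :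
    σ q = ∑ α, sectionCoef r ε f σ q α • f α q :=
  hf.eq_sum_of_mem hq hσ

variable (hM : IsLorentzSurface M) {e : Chart M} (he : e ∈ atlas (ℝ × ℝ) M) (hUe : U ⊆ e.source)

include hM he hUe

omit hf in
theorem _root_.IsOpen.smoothOnSurface_of {F : Type*} [NormedAddCommGroup F] [NormedSpace ℝ F]
    (hU : IsOpen U) {g : M → F} (h : ∀ q ∈ U, ChartSmoothAt e g q) : SmoothOnSurface U g :=
  (smoothOnSurface_iff hM hU).2 fun q hq => ⟨e, he, hUe hq, h q hq⟩

omit hM in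
theorem smooth {q : M} (hq : q ∈ U) (α : Fin (n - 2)) : ChartSmoothAt e (f α) q :=
  (hf.isSectionOn α).1.chartSmoothAt hf.isOpen hq he (hUe hq)

omit hM in
theorem chartSmoothAt_sectionCoef {V : Set M} (hV : IsOpen V) (hVU : V ⊆ U) {σ : M → Ambient n}
    (hσ : IsSectionOn NM V σ) {q : M} (hq : q ∈ V) (α : Fin (n - 2)) :
    ChartSmoothAt e (fun q => sectionCoef r ε f σ q α) q :=
  ((hσ.1.chartSmoothAt hV hq he (hUe (hVU hq))).form (hf.smooth he hUe (hVU hq) α)).const_mul _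

theorem isSectionOn_sum {c : M → Fin (n - 2) → ℝ}
    (hc : ∀ q ∈ U, ∀ α, ChartSmoothAt e (fun q => c q α) q) (s : Finset (Fin (n - 2))) :
    IsSectionOn NM U fun q => ∑ α ∈ s, c q α • f α q :=
  ⟨hf.isOpen.smoothOnSurface_of hM he hUe fun q hq => ChartSmoothAt.sum fun α _ =>
    (hc q hq α).smul (hf.smooth he hUe hq α), fun q hq =>
    Submodule.sum_mem _ fun β _ => Submodule.smul_mem _ _ ((hf.isSectionOn β).2 q hq)⟩

variable {w : ℝ × ℝ} {D : Chart M → (M → Ambient n) → M → Ambient n}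
  (hD : IsCovariantDeriv n r NM w D)

include hD

theorem covariantDeriv_sum {c : M → Fin (n - 2) → ℝ}
    (hc : ∀ q ∈ U, ∀ α, ChartSmoothAt e (fun q => c q α) q) (s : Finset (Fin (n - 2)))
    {q : M} (hq : q ∈ U) :
    D e (fun q => ∑ α ∈ s, c q α • f α q) q =
      ∑ α ∈ s, (coordDeriv w e (fun q => c q α) q • f α q + c q α • D e (f α) q) := by
  classical
  induction s using Finset.induction_on with
  | empty =>
    have h0 := hf.isSectionOn_sum hM he hUe hc ∅
    -- The connection axioms do not list D 0 = 0; it follows from additivity applied to 0 + 0.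
    have := hD.add e he U hf.isOpen hUe _ _ h0 h0 q hq
    simpa using this
  | insert α s hα ih =>
    have h1 : IsSectionOn NM U fun q => c q α • f α q := by
      simpa using hf.isSectionOn_sum hM he hUe hc {α}
    have := hD.add e he U hf.isOpen hUe _ _ h1 (hf.isSectionOn_sum hM he hUe hc s) q hq
    simp only [Finset.sum_insert hα]
    rw [this, ih, hD.leibniz e he U hf.isOpen hUe _ _ (hf.isOpen.smoothOnSurface_of hM he hUe
      fun q hq => hc q hq α) (hf.isSectionOn α) q hq]

/-- Locality replaces σ by its frame expansion, with which it agrees only on U; additivity and the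
Leibniz rule then give the components. -/
theorem covariantDeriv_eq {c : M → Fin (n - 2) → ℝ} {σ : M → Ambient n}
    {Γ : M → Fin (n - 2) → Fin (n - 2) → ℝ}
    (hc : ∀ q ∈ U, ∀ α, ChartSmoothAt e (fun q => c q α) q)
    (hσ : ∀ q ∈ U, σ q = ∑ α, c q α • f α q)
    (hΓ : ∀ q ∈ U, ∀ α, D e (f α) q = ∑ β, Γ q α β • f β q) {q : M} (hq : q ∈ U) :
    D e σ q = ∑ α, covDerivCoef w e c Γ q α • f α q := by
  have hs := hf.isSectionOn_sum hM he hUe hc Finset.univ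
  have hs' : IsSectionOn NM U σ :=
    ⟨hf.isOpen.smoothOnSurface_of hM he hUe fun q hq =>
      (hs.1.chartSmoothAt hf.isOpen hq he (hUe hq)).congr (hUe hq)
        ((hf.isOpen.eventually_mem hq).mono fun x hx => (hσ x hx).symm),
      fun q hq => by rw [hσ q hq]; exact hs.2 q hq⟩
  rw [hD.locality e he U hf.isOpen hUe _ _ hs' hs (fun q hq => hσ q hq) hq,
    hf.covariantDeriv_sum hM he hUe hD hc _ hq]
  simp only [covDerivCoef, add_smul, Finset.sum_add_distrib, Finset.sum_smul]
  congr 1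
  rw [Finset.sum_comm]
  refine Finset.sum_congr rfl fun α _ => ?_
  rw [hΓ q hq, Finset.smul_sum]
  simp only [smul_smul]

omit hM in
theorem covariantDeriv_frame {q : M} (hq : q ∈ U) (α : Fin (n - 2)) :
    D e (f α) q = ∑ β, sectionCoef r ε f (D e (f α)) q β • f β q :=
  hf.sectionCoef_sum hq ((hD.isSectionOn e he U hf.isOpen hUe _ (hf.isSectionOn α)).2 q hq)

omit hM in
theorem connection_skew {q : M} (hq : q ∈ U) (α β : Fin (n - 2)) :
    sectionCoef r ε f (D e (f α)) q β * ε β + sectionCoef r ε f (D e (f β)) q α * ε α = 0 := by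
  have h1 := hD.metric e he U hf.isOpen hUe _ _ (hf.isSectionOn α) (hf.isSectionOn β) q hq
  have h2 : coordDeriv w e (fun q => ambientForm n r (f α q) (f β q)) q = 0 := by
    rw [coordDeriv_congr (hUe hq) ((hf.isOpen.eventually_mem hq).mono fun x hx =>
      hf.orthonormal x hx α β), coordDeriv_const]
  rw [h2, ambientForm_comm (f α q)] at h1
  simp only [sectionCoef]
  linear_combination -h1 + ambientForm n r (D e (f α) q) (f β q) * hf.sign β +
    ambientForm n r (D e (f β) q) (f α q) * hf.sign α

omit hM in
theorem chartSmoothAt_connection {q : M} (hq : q ∈ U) (α β : Fin (n - 2)) :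
    ChartSmoothAt e (fun q => sectionCoef r ε f (D e (f α)) q β) q :=
  hf.chartSmoothAt_sectionCoef he hUe hf.isOpen le_rfl
    (hD.isSectionOn e he U hf.isOpen hUe _ (hf.isSectionOn α)) hq β

end IsLocalFrame

omit [ChartedSpace (ℝ × ℝ) M] in
theorem ChartSmoothAt.covDerivCoef {e : Chart M} {w : ℝ × ℝ} {k : M → Fin (n - 2) → ℝ}
    {Γ : M → Fin (n - 2) → Fin (n - 2) → ℝ} {q : M} (hq : q ∈ e.source)
    (hk : ∀ α, ChartSmoothAt e (fun q => k q α) q)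
    (hΓ : ∀ α β, ChartSmoothAt e (fun q => Γ q α β) q) (α : Fin (n - 2)) :
    ChartSmoothAt e (fun q => covDerivCoef w e k Γ q α) q :=
  ((hk α).coordDeriv hq).add (ChartSmoothAt.sum fun β _ => (hk β).mul (hΓ β α))

end LocalFrames

/-! ### Local realisation of integrable conformal data -/

section LocalExistence

open Set Filter Topology Module

variable {n r : ℕ} {M : Type*} [TopologicalSpace M] [ChartedSpace (ℝ × ℝ) M]
  {𝒟 : ConformalData M n r} {e : Chart M} {U : Set M} {ε : Fin (n - 2) → ℝ}
  {f : Fin (n - 2) → M → Ambient n}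

/-- The coefficients in the frame `f` of the connection with covariant derivative `D`. -/
abbrev connCoef (r : ℕ) (ε : Fin (n - 2) → ℝ) (f : Fin (n - 2) → M → Ambient n)
    (D : (M → Ambient n) → M → Ambient n) (q : M) (α β : Fin (n - 2)) : ℝ :=
  sectionCoef r ε f (D (f α)) q β

/-- The coefficients of the structure equations, for given conformal data, in `u`-direction. -/
def ConformalData.coefU (𝒟 : ConformalData M n r) (e : Chart M) (ε : Fin (n - 2) → ℝ)
    (f : Fin (n - 2) → M → Ambient n) (q : M) : FrameIndex n → FrameIndex n → ℝ :=
  frameCoefU ε (𝒟.s₁ e q)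
    (hopfPairing ε (sectionCoef r ε f (𝒟.κ₁ e)) (sectionCoef r ε f (𝒟.κ₂ e)) q)
    (sectionCoef r ε f (𝒟.κ₁ e) q)
    (covDerivCoef (0, 1) e (sectionCoef r ε f (𝒟.κ₁ e)) (connCoef r ε f (𝒟.Dv e)) q)
    (connCoef r ε f (𝒟.Du e) q)

/-- The coefficients of the structure equations, for given conformal data, in `v`-direction. -/
def ConformalData.coefV (𝒟 : ConformalData M n r) (e : Chart M) (ε : Fin (n - 2) → ℝ)
    (f : Fin (n - 2) → M → Ambient n) (q : M) : FrameIndex n → FrameIndex n → ℝ :=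
  frameCoefV ε (𝒟.s₂ e q)
    (hopfPairing ε (sectionCoef r ε f (𝒟.κ₁ e)) (sectionCoef r ε f (𝒟.κ₂ e)) q)
    (sectionCoef r ε f (𝒟.κ₂ e) q)
    (covDerivCoef (1, 0) e (sectionCoef r ε f (𝒟.κ₂ e)) (connCoef r ε f (𝒟.Du e)) q)
    (connCoef r ε f (𝒟.Dv e) q)

variable (hM : IsLorentzSurface M) (he : e ∈ atlas (ℝ × ℝ) M) (hUe : U ⊆ e.source)
  (hf : IsLocalFrame r 𝒟.NM U ε f)

include hM he hUe hf

omit hM in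
theorem ConformalData.chartSmoothAt_coef {q : M} (hq : q ∈ U) (i j : FrameIndex n) :
    ChartSmoothAt e (fun q => 𝒟.coefU e ε f q i j) q ∧
      ChartSmoothAt e (fun q => 𝒟.coefV e ε f q i j) q := by
  have hk₁ := fun α => hf.chartSmoothAt_sectionCoef he hUe hf.isOpen le_rfl
    ((𝒟.isSection_κ₁ e he).mono hUe) hq α
  have hk₂ := fun α => hf.chartSmoothAt_sectionCoef he hUe hf.isOpen le_rfl
    ((𝒟.isSection_κ₂ e he).mono hUe) hq α
  have hu := hf.chartSmoothAt_connection he hUe 𝒟.isCovariantDeriv_u hq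
  have hv := hf.chartSmoothAt_connection he hUe 𝒟.isCovariantDeriv_v hq
  have hc : ChartSmoothAt e (hopfPairing ε (sectionCoef r ε f (𝒟.κ₁ e))
      (sectionCoef r ε f (𝒟.κ₂ e))) q :=
    ChartSmoothAt.sum fun α _ => (hk₁ α).mul ((hk₂ α).mul (chartSmoothAt_const _))
  exact ⟨(chartSmoothAt_frameCoef ((𝒟.smooth_s₁ e he).chartSmoothAt e.open_source (hUe hq) he
      (hUe hq)) hc hk₁ (ChartSmoothAt.covDerivCoef (hUe hq) hk₁ hv) hu i j).1,
    (chartSmoothAt_frameCoef ((𝒟.smooth_s₂ e he).chartSmoothAt e.open_source (hUe hq) he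
      (hUe hq)) hc hk₂ (ChartSmoothAt.covDerivCoef (hUe hq) hk₂ hu) hv i j).2⟩

/-- Each integrability equation is written in the components of a local orthonormal frame, which
supplies the hypotheses of `frameCoef_compat`. -/
theorem ConformalData.IsIntegrable.compat (h𝒟 : 𝒟.IsIntegrable) {q : M} (hq : q ∈ U)
    (i j : FrameIndex n) :
    pv e (fun q => 𝒟.coefU e ε f q i j) q + ∑ m, 𝒟.coefU e ε f q i m * 𝒟.coefV e ε f q m j =
      pu e (fun q => 𝒟.coefV e ε f q i j) q +
        ∑ m, 𝒟.coefV e ε f q i m * 𝒟.coefU e ε f q m j := by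
  have hs₁ := (𝒟.smooth_s₁ e he).chartSmoothAt e.open_source (hUe hq) he (hUe hq)
  have hs₂ := (𝒟.smooth_s₂ e he).chartSmoothAt e.open_source (hUe hq) he (hUe hq)
  have hκ₁ := (𝒟.isSection_κ₁ e he).mono hUe
  have hκ₂ := (𝒟.isSection_κ₂ e he).mono hUe
  set k₁ := sectionCoef r ε f (𝒟.κ₁ e) with hk₁_def
  set k₂ := sectionCoef r ε f (𝒟.κ₂ e) with hk₂_def
  set Γu := connCoef r ε f (𝒟.Du e) with hΓu_def
  set Γv := connCoef r ε f (𝒟.Dv e) with hΓv_def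
  have hk₁ : ∀ q ∈ U, ∀ α, ChartSmoothAt e (fun q => k₁ q α) q := fun q hq α =>
    hf.chartSmoothAt_sectionCoef he hUe hf.isOpen le_rfl hκ₁ hq α
  have hk₂ : ∀ q ∈ U, ∀ α, ChartSmoothAt e (fun q => k₂ q α) q := fun q hq α =>
    hf.chartSmoothAt_sectionCoef he hUe hf.isOpen le_rfl hκ₂ hq α
  have hΓu : ∀ q ∈ U, ∀ α β, ChartSmoothAt e (fun q => Γu q α β) q := fun q hq =>
    hf.chartSmoothAt_connection he hUe 𝒟.isCovariantDeriv_u hq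
  have hΓv : ∀ q ∈ U, ∀ α β, ChartSmoothAt e (fun q => Γv q α β) q := fun q hq =>
    hf.chartSmoothAt_connection he hUe 𝒟.isCovariantDeriv_v hq
  set l₁ := covDerivCoef (0, 1) e k₁ Γv with hl₁_def
  set l₂ := covDerivCoef (1, 0) e k₂ Γu with hl₂_def
  set m₁ := covDerivCoef (1, 0) e k₁ Γu with hm₁_def
  set m₂ := covDerivCoef (0, 1) e k₂ Γv with hm₂_def
  have hl₁ : ∀ q ∈ U, ∀ α, ChartSmoothAt e (fun q => l₁ q α) q := fun q hq =>
    ChartSmoothAt.covDerivCoef (hUe hq) (hk₁ q hq) (hΓv q hq)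
  have hl₂ : ∀ q ∈ U, ∀ α, ChartSmoothAt e (fun q => l₂ q α) q := fun q hq =>
    ChartSmoothAt.covDerivCoef (hUe hq) (hk₂ q hq) (hΓu q hq)
  have eu : ∀ {c : M → Fin (n - 2) → ℝ} {σ : M → Ambient n},
      (∀ q ∈ U, ∀ α, ChartSmoothAt e (fun q => c q α) q) →
      (∀ q ∈ U, σ q = ∑ α, c q α • f α q) → ∀ q ∈ U,
      𝒟.Du e σ q = ∑ α, covDerivCoef (1, 0) e c Γu q α • f α q := fun hc hσ q hq =>
    hf.covariantDeriv_eq hM he hUe 𝒟.isCovariantDeriv_u hc hσ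
      (fun q hq => hf.covariantDeriv_frame he hUe 𝒟.isCovariantDeriv_u hq) hq
  have ev : ∀ {c : M → Fin (n - 2) → ℝ} {σ : M → Ambient n},
      (∀ q ∈ U, ∀ α, ChartSmoothAt e (fun q => c q α) q) →
      (∀ q ∈ U, σ q = ∑ α, c q α • f α q) → ∀ q ∈ U,
      𝒟.Dv e σ q = ∑ α, covDerivCoef (0, 1) e c Γv q α • f α q := fun hc hσ q hq =>
    hf.covariantDeriv_eq hM he hUe 𝒟.isCovariantDeriv_v hc hσ
      (fun q hq => hf.covariantDeriv_frame he hUe 𝒟.isCovariantDeriv_v hq) hq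
  have eκ₁ : ∀ q ∈ U, 𝒟.κ₁ e q = ∑ α, k₁ q α • f α q := fun q hq =>
    hf.sectionCoef_sum hq (hκ₁.2 q hq)
  have eκ₂ : ∀ q ∈ U, 𝒟.κ₂ e q = ∑ α, k₂ q α • f α q := fun q hq =>
    hf.sectionCoef_sum hq (hκ₂.2 q hq)
  have euf : ∀ α, ∀ q ∈ U, 𝒟.Du e (f α) q = ∑ β, Γu q α β • f β q := fun α q hq =>
    hf.covariantDeriv_frame he hUe 𝒟.isCovariantDeriv_u hq α
  have evf : ∀ α, ∀ q ∈ U, 𝒟.Dv e (f α) q = ∑ β, Γv q α β • f β q := fun α q hq =>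
    hf.covariantDeriv_frame he hUe 𝒟.isCovariantDeriv_v hq α
  have el₁ := ev hk₁ eκ₁
  have el₂ := eu hk₂ eκ₂
  have em₁ := eu hk₁ eκ₁
  have em₂ := ev hk₂ eκ₂
  have hcs : ChartSmoothAt e (hopfPairing ε k₁ k₂) q :=
    ChartSmoothAt.sum fun α _ => (hk₁ q hq α).mul ((hk₂ q hq α).mul (chartSmoothAt_const _))
  have ec : ∀ᶠ q in 𝓝 q, hopfPairing ε k₁ k₂ q = ambientForm n r (𝒟.κ₁ e q) (𝒟.κ₂ e q) := by
    filter_upwards [hf.isOpen.mem_nhds hq] with x hx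
    rw [eκ₁ x hx, eκ₂ x hx, hf.form_sum hx, hopfPairing]
  have swap : ∀ x y : Fin (n - 2) → ℝ,
      ∑ α, x α * (y α * ε α) = ∑ α, y α * (x α * ε α) := fun x y =>
    Finset.sum_congr rfl fun α _ => by ring
  -- Metric compatibility gives c_u = ⟨D_u κ₁, κ₂⟩ + ⟨κ₁, D_u κ₂⟩, so the Gauss equation takes the
  -- form (s₁)_v / 2 = 2⟨κ₁, D_u κ₂⟩ + c_u required by the matrix identity.
  have ecu : pu e (hopfPairing ε k₁ k₂) q =
      ∑ α, m₁ q α * (k₂ q α * ε α) + ∑ α, k₁ q α * (l₂ q α * ε α) := by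
    rw [pu, coordDeriv_congr (hUe hq) ec,
      𝒟.isCovariantDeriv_u.metric e he U hf.isOpen hUe _ _ hκ₁ hκ₂ q hq, em₁ q hq, el₂ q hq,
      eκ₁ q hq, eκ₂ q hq, hf.form_sum hq, hf.form_sum hq]
  have ecv : pv e (hopfPairing ε k₁ k₂) q =
      ∑ α, l₁ q α * (k₂ q α * ε α) + ∑ α, k₁ q α * (m₂ q α * ε α) := by
    rw [pv, coordDeriv_congr (hUe hq) ec,
      𝒟.isCovariantDeriv_v.metric e he U hf.isOpen hUe _ _ hκ₁ hκ₂ q hq, el₁ q hq, em₂ q hq,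
      eκ₁ q hq, eκ₂ q hq, hf.form_sum hq, hf.form_sum hq]
  have g₁ := h𝒟.gauss₁ e he q (hUe hq)
  have g₂ := h𝒟.gauss₂ e he q (hUe hq)
  rw [el₂ q hq, em₁ q hq, eκ₁ q hq, eκ₂ q hq, hf.form_sum hq, hf.form_sum hq] at g₁
  rw [el₁ q hq, em₂ q hq, eκ₁ q hq, eκ₂ q hq, hf.form_sum hq, hf.form_sum hq] at g₂
  have cod := h𝒟.codazzi e he q (hUe hq)
  rw [ev hl₁ el₁ q hq, eu hl₂ el₂ q hq, eκ₁ q hq, eκ₂ q hq, Finset.smul_sum, Finset.smul_sum,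
    ← Finset.sum_add_distrib, ← Finset.sum_add_distrib] at cod
  simp only [smul_smul, ← add_smul] at cod
  have ric := fun α => h𝒟.ricci e he U hf.isOpen hUe (f α) (hf.isSectionOn α) q hq
  have hform : ∀ (c : Fin (n - 2) → ℝ) α, ambientForm n r (f α q) (∑ β, c β • f β q) =
      ε α * c α := fun c α => by
    rw [ambientForm_comm, hf.form_sum_left hq, mul_comm]
  have ric' : ∀ α, ∑ β, ((covDerivCoef (0, 1) e (fun q => Γu q α) Γv q β -
      covDerivCoef (1, 0) e (fun q => Γv q α) Γu q β) • f β q) =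
      ∑ β, (2 * (ε α * k₁ q α) * k₂ q β - 2 * (ε α * k₂ q α) * k₁ q β) • f β q := by
    intro α
    have := ric α
    rw [ev (fun q hq => hΓu q hq α) (euf α) q hq, eu (fun q hq => hΓv q hq α) (evf α) q hq,
      eκ₁ q hq, eκ₂ q hq, hform, hform, Finset.smul_sum, Finset.smul_sum,
      ← Finset.sum_sub_distrib, ← Finset.sum_sub_distrib] at this
    simpa only [smul_smul, ← sub_smul] using this
  have key := frameCoef_compat (ε := ε) (s₁ := 𝒟.s₁ e q) (s₂ := 𝒟.s₂ e q)
    (c := hopfPairing ε k₁ k₂ q) (k₁ := k₁ q) (k₂ := k₂ q) (l₁ := l₁ q) (l₂ := l₂ q)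
    (Γu := Γu q) (Γv := Γv q)
    (s₁' := pv e (𝒟.s₁ e) q) (s₂' := pu e (𝒟.s₂ e) q)
    (cu := pu e (hopfPairing ε k₁ k₂) q) (cv := pv e (hopfPairing ε k₁ k₂) q)
    (k₁' := fun α => pv e (fun q => k₁ q α) q) (k₂' := fun α => pu e (fun q => k₂ q α) q)
    (l₁' := fun α => pv e (fun q => l₁ q α) q) (l₂' := fun α => pu e (fun q => l₂ q α) q)
    (Γu' := fun α β => pv e (fun q => Γu q α β) q)
    (Γv' := fun α β => pu e (fun q => Γv q α β) q)
    rfl (fun _ => rfl) (fun _ => rfl)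
    (hf.connection_skew he hUe 𝒟.isCovariantDeriv_u hq)
    (hf.connection_skew he hUe 𝒟.isCovariantDeriv_v hq)
    (by rw [ecu, g₁, swap (l₂ q)]; ring)
    (by rw [ecv, g₂, swap (k₂ q)]; ring)
    (hf.sum_injective hq cod) (fun α => hf.sum_injective hq (ric' α)) i j
  rw [← (coordDeriv_frameCoef hs₁ hcs (hk₁ q hq) (hl₁ q hq) i j).1,
    ← (coordDeriv_frameCoef hs₂ hcs (hk₂ q hq) (hl₂ q hq) i j).2] at key
  exact key

/-- Integrable conformal data are realised near every point by a surface with a normal frame. -/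
theorem ConformalData.IsIntegrable.exists_isFramedSurface (h𝒟 : 𝒟.IsIntegrable) (hr : 1 ≤ r)
    (hn : r + 2 ≤ n) (hfs : IsLocalFrame r 𝒟.NM U (normalSign n r) f) {p : M} (hp : p ∈ U) :
    ∃ B, p ∈ B ∧ B ⊆ U ∧ ∃ Y ψ, IsFramedSurface r e B (normalSign n r) (𝒟.s₁ e) (𝒟.s₂ e)
      (sectionCoef r (normalSign n r) f (𝒟.κ₁ e)) (sectionCoef r (normalSign n r) f (𝒟.κ₂ e))
      (connCoef r (normalSign n r) f (𝒟.Du e)) (connCoef r (normalSign n r) f (𝒟.Dv e)) Y ψ := by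
  obtain ⟨B, hB, hpB, hBU, X, hX⟩ := exists_adaptedFrame_solution hf.isOpen hUe
    (fun q hq i j => (𝒟.chartSmoothAt_coef he hUe hfs hq i j).1)
    (fun q hq i j => (𝒟.chartSmoothAt_coef he hUe hfs hq i j).2)
    (fun q hq i j => h𝒟.compat hM he hUe hfs hq i j)
    (fun q hq i j => frameCoefU_skew
      (hfs.connection_skew he hUe 𝒟.isCovariantDeriv_u hq) i j)
    (fun q hq i j => frameCoefV_skew
      (hfs.connection_skew he hUe 𝒟.isCovariantDeriv_v hq) i j) hp
    (isAdaptedFrame_standardFrame hr hn)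
  have hg : ∀ q ∈ B, ∀ i j, ambientForm n r (X q i) (X q j) = frameGram (normalSign n r) i j :=
    fun q hq => (hX q hq).1
  -- The first row of each system says that the second and third frame vectors are the partial
  -- derivatives of the first. The constant Gram matrix then gives the metric conditions on Y = X₀.
  have hu : ∀ q ∈ B, pu e (fun q => X q (.inl 0)) q = X q (.inl 1) := fun q hq => by
    rw [((hX q hq).2 _).2.1]
    simp [coefU, frameCoefU, Fintype.sum_sum_type, Fin.sum_univ_four]
  have hv : ∀ q ∈ B, pv e (fun q => X q (.inl 0)) q = X q (.inl 2) := fun q hq => by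
    rw [((hX q hq).2 _).2.2]
    simp [coefV, frameCoefV, Fintype.sum_sum_type, Fin.sum_univ_four]
  have hd : ∀ {w : ℝ × ℝ} {g h : M → Ambient n}, (∀ q ∈ B, g q = h q) → ∀ q ∈ B,
      coordDeriv w e g q = coordDeriv w e h q := fun hgh q hq =>
    coordDeriv_congr (hUe (hBU hq)) ((hB.eventually_mem hq).mono hgh)
  refine ⟨B, hpB, hBU, fun q => X q (.inl 0), fun α q => X q (.inr α), hB, hBU.trans hUe,
    hfs.sign, fun q hq => ((hX q hq).2 _).1, fun q hq α => ((hX q hq).2 _).1,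
    fun q hq => ?_, fun q hq => ?_, fun q hq => ?_, fun q hq => ?_, fun q hq α β => ?_,
    fun q hq α => ?_, fun q hq α => ?_, fun q hq α => ?_, fun q hq α => ?_, fun q hq => ?_,
    fun q hq => ?_, fun q hq α β => ?_, fun q hq α β => ?_⟩
  · simp [hg q hq, frameGram]
  · simp [hu q hq, hg q hq, frameGram]
  · simp [hv q hq, hg q hq, frameGram]
  · simp [hu q hq, hv q hq, hg q hq, frameGram]
  · simp [hg q hq, frameGram]
  · simp [hg q hq, frameGram]
  · simp [hu q hq, hg q hq, frameGram]
  · simp [hv q hq, hg q hq, frameGram]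
  · rw [pv, hd hu q hq, ← pv, ((hX q hq).2 _).2.2]
    simp [coefV, frameCoefV, Fintype.sum_sum_type, Fin.sum_univ_four, hg q hq, frameGram]
  · rw [pu, hd hu q hq, ← pu, ((hX q hq).2 _).2.1]
    simp [coefU, frameCoefU, Fintype.sum_sum_type, Fin.sum_univ_four]
  · rw [pv, hd hv q hq, ← pv, ((hX q hq).2 _).2.2]
    simp [coefV, frameCoefV, Fintype.sum_sum_type, Fin.sum_univ_four]
  · rw [((hX q hq).2 _).2.1]
    simp [coefU, frameCoefU, Fintype.sum_sum_type, Fin.sum_univ_four, hg q hq, frameGram]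
  · rw [((hX q hq).2 _).2.2]
    simp [coefV, frameCoefV, Fintype.sum_sum_type, Fin.sum_univ_four, hg q hq, frameGram]

end LocalExistence

/-! ### Realisations of conformal data over open sets -/

section Realisation

open Set Filter Topology Module

variable {n r : ℕ} {M : Type*} [TopologicalSpace M] [ChartedSpace (ℝ × ℝ) M]

/-- The lift `Y` and the bundle map `Φ` realise the conformal data in the asymptotic coordinates `e`
over the open set `U`. -/
structure RealizesOn (𝒟 : ConformalData M n r) (e : Chart M) (U : Set M) (Y : M → Ambient n)
    (Φ : M → Ambient n →ₗ[ℝ] Ambient n) : Prop where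
  isOpen : IsOpen U
  subset : U ⊆ e.source
  smooth : ∀ p ∈ U, ChartSmoothAt e Y p
  ne_zero : ∀ p ∈ U, Y p ≠ 0
  null : ∀ p ∈ U, ambientForm n r (Y p) (Y p) = 0
  metric_uu : ∀ p ∈ U, ambientForm n r (pu e Y p) (pu e Y p) = 0
  metric_vv : ∀ p ∈ U, ambientForm n r (pv e Y p) (pv e Y p) = 0
  metric_uv : ∀ p ∈ U, ambientForm n r (pu e Y p) (pv e Y p) = 1 / 2
  map_eq : ∀ p ∈ U, (𝒟.NM p).map (Φ p) = confNormal r (fun _ => Y) e p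
  isometry : ∀ p ∈ U, ∀ x ∈ 𝒟.NM p, ∀ z ∈ 𝒟.NM p,
    ambientForm n r (Φ p x) (Φ p z) = ambientForm n r x z
  smooth_section : ∀ V ⊆ U, IsOpen V → ∀ σ, IsSectionOn 𝒟.NM V σ → ∀ p ∈ V,
    ChartSmoothAt e (fun q => Φ q (σ q)) p
  connection_u : ∀ V ⊆ U, IsOpen V → ∀ σ, IsSectionOn 𝒟.NM V σ → ∀ p ∈ V,
    IsNormalPart r (fun _ => Y) e p (pu e (fun q => Φ q (σ q)) p) (Φ p (𝒟.Du e σ p))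
  connection_v : ∀ V ⊆ U, IsOpen V → ∀ σ, IsSectionOn 𝒟.NM V σ → ∀ p ∈ V,
    IsNormalPart r (fun _ => Y) e p (pv e (fun q => Φ q (σ q)) p) (Φ p (𝒟.Dv e σ p))
  eq_uu : ∀ p ∈ U, pu e (pu e Y) p = -(𝒟.s₁ e p / 2) • Y p + Φ p (𝒟.κ₁ e p)
  eq_vv : ∀ p ∈ U, pv e (pv e Y) p = -(𝒟.s₂ e p / 2) • Y p + Φ p (𝒟.κ₂ e p)

/-- The map of normal bundles which sends the orthonormal frame `f` to `ψ`. -/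
def normalFrameMap (r : ℕ) (ε : Fin (n - 2) → ℝ) (f ψ : Fin (n - 2) → M → Ambient n) (q : M) :
    Ambient n →ₗ[ℝ] Ambient n :=
  ∑ α, (ε α • (ambientForm n r).flip (f α q)).smulRight (ψ α q)

omit [TopologicalSpace M] [ChartedSpace (ℝ × ℝ) M] in
theorem normalFrameMap_apply (ε : Fin (n - 2) → ℝ) (f ψ : Fin (n - 2) → M → Ambient n) (q : M)
    (x : Ambient n) :
    normalFrameMap r ε f ψ q x = ∑ α, (ε α * ambientForm n r x (f α q)) • ψ α q := by
  simp [normalFrameMap]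

omit [ChartedSpace (ℝ × ℝ) M] in
-- N differs from 2 Y_uv by a multiple of Y, so replacing Y_uv by N leaves the span V unchanged.
theorem IsFramedSurface.confNormal_eq {e : Chart M} {U : Set M} {ε : Fin (n - 2) → ℝ}
    {s₁ s₂ : M → ℝ} {k₁ k₂ : M → Fin (n - 2) → ℝ} {Γu Γv : M → Fin (n - 2) → Fin (n - 2) → ℝ}
    {Y : M → Ambient n} {ψ : Fin (n - 2) → M → Ambient n}
    (h : IsFramedSurface r e U ε s₁ s₂ k₁ k₂ Γu Γv Y ψ) (hn : 2 ≤ n) {p : M} (hp : p ∈ U) :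
    Submodule.span ℝ (range fun α => ψ α p) = confNormal r (fun _ => Y) e p := by
  refine ((h.isAdaptedFrame hp).span_normal h.sign hn).trans ?_
  rw [confNormal, confTangent]
  congr 1
  set X := surfaceFrame e (hopfPairing ε k₁ k₂) Y ψ p with hX
  have h3 : X (.inl 3) = (2 : ℝ) • pv e (pu e Y) p + (2 * hopfPairing ε k₁ k₂ p) • Y p := rfl
  have h0 : X (.inl 0) = Y p := rfl
  have h1 : X (.inl 1) = pu e Y p := rfl
  have h2 : X (.inl 2) = pv e Y p := rfl
  rw [h0, h1, h2, h3]
  apply le_antisymm <;> rw [Submodule.span_le]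
  · rintro x (rfl | rfl | rfl | rfl)
    · exact Submodule.subset_span (by simp)
    · exact Submodule.subset_span (by simp)
    · exact Submodule.subset_span (by simp)
    · exact Submodule.add_mem _ (Submodule.smul_mem _ _ (Submodule.subset_span (by simp)))
        (Submodule.smul_mem _ _ (Submodule.subset_span (by simp)))
  · rintro x (rfl | rfl | rfl | rfl)
    · exact Submodule.subset_span (by simp)
    · exact Submodule.subset_span (by simp)
    · exact Submodule.subset_span (by simp)
    · have : pv e (pu e Y) p = (1 / 2 : ℝ) • ((2 : ℝ) • pv e (pu e Y) p +
          (2 * hopfPairing ε k₁ k₂ p) • Y p) - hopfPairing ε k₁ k₂ p • Y p := by module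
      exact mem_of_eq_of_mem this (Submodule.sub_mem _
        (Submodule.smul_mem _ _ (Submodule.subset_span (by simp)))
        (Submodule.smul_mem _ _ (Submodule.subset_span (by simp))))

variable {𝒟 : ConformalData M n r} {e : Chart M} {U : Set M} {Y : M → Ambient n}
  {Φ : M → Ambient n →ₗ[ℝ] Ambient n} {ε : Fin (n - 2) → ℝ} {f : Fin (n - 2) → M → Ambient n}

/-- The bundle map sends f to ψ. Both frames are orthonormal with the same signs and have the same
connection coefficients, so metric and connection are carried over. -/
theorem IsFramedSurface.realizesOn (hM : IsLorentzSurface M) (hn : 2 ≤ n)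
    (he : e ∈ atlas (ℝ × ℝ) M) (hf : IsLocalFrame r 𝒟.NM U ε f)
    {ψ : Fin (n - 2) → M → Ambient n}
    (h : IsFramedSurface r e U ε (𝒟.s₁ e) (𝒟.s₂ e) (sectionCoef r ε f (𝒟.κ₁ e))
      (sectionCoef r ε f (𝒟.κ₂ e)) (connCoef r ε f (𝒟.Du e)) (connCoef r ε f (𝒟.Dv e)) Y ψ) :
    RealizesOn 𝒟 e U Y (normalFrameMap r ε f ψ) := by
  have hsec : ∀ σ : M → Ambient n, (fun q => normalFrameMap r ε f ψ q (σ q)) =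
      fun q => ∑ α, sectionCoef r ε f σ q α • ψ α q := fun σ =>
    funext fun q => normalFrameMap_apply ε f ψ q (σ q)
  have hsum : ∀ q ∈ U, ∀ c : Fin (n - 2) → ℝ,
      normalFrameMap r ε f ψ q (∑ α, c α • f α q) = ∑ α, c α • ψ α q := by
    intro q hq c
    rw [normalFrameMap_apply]
    refine Finset.sum_congr rfl fun α _ => ?_
    rw [hf.form_sum_left hq, mul_left_comm, hf.sign, mul_one]
  have hnor : ∀ q ∈ U, ∀ c : Fin (n - 2) → ℝ,
      ∑ α, c α • ψ α q ∈ confNormal r (fun _ => Y) e q := by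
    intro q hq c
    rw [← h.confNormal_eq hn hq]
    exact Submodule.sum_mem _ fun α _ =>
      Submodule.smul_mem _ _ (Submodule.subset_span ⟨α, rfl⟩)
  have hform : ∀ q ∈ U, ∀ c d : Fin (n - 2) → ℝ,
      ambientForm n r (∑ α, c α • ψ α q) (∑ α, d α • ψ α q) = ∑ α, c α * (d α * ε α) := by
    intro q hq c d
    rw [map_sum]
    refine Finset.sum_congr rfl fun α _ => ?_
    simp [h.orthonormal q hq]
    ring
  -- The difference between the derivative of the image of σ and the image of Dσ is linear over
  -- functions in σ. It is therefore enough that it is tangential for the frame vectors.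
  have hconn : ∀ (w : ℝ × ℝ) (D : Chart M → (M → Ambient n) → M → Ambient n),
      IsCovariantDeriv n r 𝒟.NM w D →
      (∀ q ∈ U, ∀ α, coordDeriv w e (ψ α) q - ∑ β, connCoef r ε f (D e) q α β • ψ β q ∈
        confTangent (fun _ => Y) e q) →
      ∀ V ⊆ U, IsOpen V → ∀ σ, IsSectionOn 𝒟.NM V σ → ∀ q ∈ V,
        IsNormalPart r (fun _ => Y) e q
          (coordDeriv w e (fun q => normalFrameMap r ε f ψ q (σ q)) q)
          (normalFrameMap r ε f ψ q (D e σ q)) := by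
    intro w D hD hψ V hVU hV σ hσ q hq
    have hfV := hf.mono hV hVU
    have hVe := hVU.trans h.subset
    have hc : ∀ q ∈ V, ∀ α, ChartSmoothAt e (fun q => sectionCoef r ε f σ q α) q :=
      fun q hq α => hfV.chartSmoothAt_sectionCoef he hVe hV le_rfl hσ hq α
    have h1 : D e σ q = ∑ α, covDerivCoef w e (sectionCoef r ε f σ) (connCoef r ε f (D e)) q α •
        f α q :=
      hfV.covariantDeriv_eq hM he hVe hD hc (fun q hq => hfV.sectionCoef_sum hq (hσ.2 q hq))
        (fun q hq => hfV.covariantDeriv_frame he hVe hD hq) hq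
    rw [h1, hsum q (hVU hq), hsec]
    refine ⟨hnor q (hVU hq) _, ?_⟩
    have h2 : coordDeriv w e (fun q => ∑ α, sectionCoef r ε f σ q α • ψ α q) q -
        ∑ α, covDerivCoef w e (sectionCoef r ε f σ) (connCoef r ε f (D e)) q α • ψ α q =
        ∑ α, sectionCoef r ε f σ q α •
          (coordDeriv w e (ψ α) q - ∑ β, connCoef r ε f (D e) q α β • ψ β q) := by
      rw [coordDeriv_sum fun α _ => (hc q hq α).smul (h.smooth_normal q (hVU hq) α)]
      simp only [covDerivCoef, add_smul, Finset.sum_add_distrib, smul_sub,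
        Finset.sum_sub_distrib, Finset.sum_smul, Finset.smul_sum, smul_smul]
      rw [Finset.sum_comm (f := fun α β => (sectionCoef r ε f σ q β *
        connCoef r ε f (D e) q β α) • ψ α q), Finset.sum_congr rfl fun α _ =>
        coordDeriv_smul (hVe hq) (hc q hq α) (h.smooth_normal q (hVU hq) α),
        Finset.sum_add_distrib]
      abel
    rw [h2]
    exact Submodule.sum_mem _ fun α _ => Submodule.smul_mem _ _ (hψ q (hVU hq) α)
  refine ⟨h.isOpen, h.subset, h.smooth, fun q hq h0 => ?_, h.null, h.metric_uu, h.metric_vv,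
    h.metric_uv, fun q hq => ?_, fun q hq x hx z hz => ?_, fun V hVU hV σ hσ q hq => ?_,
    hconn _ _ 𝒟.isCovariantDeriv_u fun q hq α => ?_,
    hconn _ _ 𝒟.isCovariantDeriv_v fun q hq α => ?_, fun q hq => ?_, fun q hq => ?_⟩
  -- Y cannot vanish, because ⟨Y, Y_uv⟩ = -1/2.
  · have := h.form_Y_uv hq
    rw [h0] at this
    norm_num at this
  · rw [← h.confNormal_eq hn hq, hf.eq_span q hq, Submodule.map_span, ← range_comp]
    congr 2
    funext α
    have := hsum q hq (Pi.single α 1)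
    simpa [Pi.single_apply] using this
  · rw [hf.eq_sum_of_mem hq hx, hf.eq_sum_of_mem hq hz, hsum q hq, hsum q hq, hform q hq,
      hf.form_sum hq]
  · rw [hsec]
    exact ChartSmoothAt.sum fun α _ => ((hf.mono hV hVU).chartSmoothAt_sectionCoef he
      (hVU.trans h.subset) hV le_rfl hσ hq α).smul (h.smooth_normal q (hVU hq) α)
  · have h1 := h.deriv_frame_u hn hq (.inr α)
    simp only [Fintype.sum_sum_type, Fin.sum_univ_four, surfaceFrame, frameCoefU, pu] at h1
    rw [h1, add_sub_cancel_right]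
    simp only [Matrix.cons_val, zero_smul, add_zero]
    exact Submodule.add_mem _ (Submodule.smul_mem _ _ (Submodule.subset_span (by simp)))
      (Submodule.smul_mem _ _ (Submodule.subset_span (by simp)))
  · have h1 := h.deriv_frame_v hn hq (.inr α)
    simp only [Fintype.sum_sum_type, Fin.sum_univ_four, surfaceFrame, frameCoefV, pv] at h1
    rw [h1, add_sub_cancel_right]
    simp only [Matrix.cons_val, zero_smul, add_zero]
    exact Submodule.add_mem _ (Submodule.smul_mem _ _ (Submodule.subset_span (by simp)))
      (Submodule.smul_mem _ _ (Submodule.subset_span (by simp)))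
  · rw [h.eq_uu q hq, normalFrameMap_apply]
    rfl
  · rw [h.eq_vv q hq, normalFrameMap_apply]
    rfl

namespace RealizesOn

variable (h : RealizesOn 𝒟 e U Y Φ)

include h

theorem mono {V : Set M} (hV : IsOpen V) (hVU : V ⊆ U) : RealizesOn 𝒟 e V Y Φ where
  isOpen := hV
  subset := hVU.trans h.subset
  smooth p hp := h.smooth p (hVU hp)
  ne_zero p hp := h.ne_zero p (hVU hp)
  null p hp := h.null p (hVU hp)
  metric_uu p hp := h.metric_uu p (hVU hp)
  metric_vv p hp := h.metric_vv p (hVU hp)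
  metric_uv p hp := h.metric_uv p (hVU hp)
  map_eq p hp := h.map_eq p (hVU hp)
  isometry p hp := h.isometry p (hVU hp)
  smooth_section W hW := h.smooth_section W (hW.trans hVU)
  connection_u W hW := h.connection_u W (hW.trans hVU)
  connection_v W hW := h.connection_v W (hW.trans hVU)
  eq_uu p hp := h.eq_uu p (hVU hp)
  eq_vv p hp := h.eq_vv p (hVU hp)

theorem mem_confNormal {p : M} (hp : p ∈ U) {x : Ambient n} (hx : x ∈ 𝒟.NM p) :
    Φ p x ∈ confNormal r (fun _ => Y) e p := by
  rw [← h.map_eq p hp]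
  exact Submodule.mem_map_of_mem hx

/-- A realisation carries any local frame of NM to a normal frame with the prescribed coefficients,
so the rigidity results for framed surfaces apply to it. -/
theorem isFramedSurface (he : e ∈ atlas (ℝ × ℝ) M) (hf : IsLocalFrame r 𝒟.NM U ε f) :
    IsFramedSurface r e U ε (𝒟.s₁ e) (𝒟.s₂ e) (sectionCoef r ε f (𝒟.κ₁ e))
      (sectionCoef r ε f (𝒟.κ₂ e)) (connCoef r ε f (𝒟.Du e)) (connCoef r ε f (𝒟.Dv e)) Y
      fun α q => Φ q (f α q) := by
  have hsum : ∀ q ∈ U, ∀ x ∈ 𝒟.NM q,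
      Φ q x = ∑ α, (ε α * ambientForm n r x (f α q)) • Φ q (f α q) := fun q hq x hx => by
    conv_lhs => rw [hf.eq_sum_of_mem hq hx, map_sum]
    simp only [map_smul]
  have hmem : ∀ q ∈ U, ∀ α, f α q ∈ 𝒟.NM q := fun q hq α => (hf.isSectionOn α).2 q hq
  refine isFramedSurface_of (Y := fun _ => Y) h.isOpen h.subset hf.sign h.smooth
    (fun q hq α => h.smooth_section U le_rfl h.isOpen _ (hf.isSectionOn α) q hq)
    h.null h.metric_uu h.metric_vv h.metric_uv
    (fun q hq α β => by rw [h.isometry q hq _ (hmem q hq α) _ (hmem q hq β),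
      hf.orthonormal q hq])
    (fun q hq α => h.mem_confNormal hq (hmem q hq α))
    (fun q hq => by
      rw [h.eq_uu q hq, hsum q hq _ ((𝒟.isSection_κ₁ e he).2 q (h.subset hq))]; rfl)
    (fun q hq => by
      rw [h.eq_vv q hq, hsum q hq _ ((𝒟.isSection_κ₂ e he).2 q (h.subset hq))]; rfl)
    (fun q hq α => ?_) (fun q hq α => ?_)
  · have h1 := h.connection_u U le_rfl h.isOpen _ (hf.isSectionOn α) q hq
    rwa [hsum q hq _ ((𝒟.isCovariantDeriv_u.isSectionOn e he U h.isOpen h.subset _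
      (hf.isSectionOn α)).2 q hq)] at h1
  · have h1 := h.connection_v U le_rfl h.isOpen _ (hf.isSectionOn α) q hq
    rwa [hsum q hq _ ((𝒟.isCovariantDeriv_v.isSectionOn e he U h.isOpen h.subset _
      (hf.isSectionOn α)).2 q hq)] at h1

/-- Two realisations of the same conformal data differ near every point by an isometry. -/
theorem exists_congruence (hn : 2 ≤ n) (he : e ∈ atlas (ℝ × ℝ) M) {Y' : M → Ambient n}
    {Φ' : M → Ambient n →ₗ[ℝ] Ambient n} (h' : RealizesOn 𝒟 e U Y' Φ') {p : M} (hp : p ∈ U) :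
    ∃ T : Ambient n ≃ₗ[ℝ] Ambient n, IsPseudoOrthogonal n r T ∧
      ∀ᶠ q in 𝓝 p, T (Y q) = Y' q ∧ ∀ x ∈ 𝒟.NM q, T (Φ q x) = Φ' q x := by
  obtain ⟨V, hpV, -, f, hf⟩ := 𝒟.isNormalSubbundle.exists_isLocalFrame (h.subset hp)
  have hVU := hf.isOpen.inter h.isOpen
  have hf' := hf.mono hVU inter_subset_left
  obtain ⟨T, hT, hTY⟩ := ((h.mono hVU inter_subset_right).isFramedSurface he hf').exists_congruence
    ((h'.mono hVU inter_subset_right).isFramedSurface he hf') hn ⟨hpV, hp⟩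
  refine ⟨T, hT, ?_⟩
  filter_upwards [hTY, hVU.mem_nhds ⟨hpV, hp⟩] with q hq hqV
  refine ⟨hq.1, fun x hx => ?_⟩
  rw [hf'.eq_sum_of_mem hqV hx]
  simp only [map_sum, map_smul, hq.2]

/-- Uniqueness of the comparison isometry is what makes these isometries locally constant and
multiplicative on overlaps. -/
theorem linearEquiv_ext (hn : 2 ≤ n) (he : e ∈ atlas (ℝ × ℝ) M) {p : M} (hp : p ∈ U)
    {S T : Ambient n ≃ₗ[ℝ] Ambient n} (hY : ∀ᶠ q in 𝓝 p, S (Y q) = T (Y q))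
    (hΦ : ∀ x ∈ 𝒟.NM p, S (Φ p x) = T (Φ p x)) : S = T := by
  obtain ⟨V, hpV, -, f, hf⟩ := 𝒟.isNormalSubbundle.exists_isLocalFrame (h.subset hp)
  have hVU := hf.isOpen.inter h.isOpen
  have hf' := hf.mono hVU inter_subset_left
  exact LinearEquiv.toLinearMap_injective
    (((h.mono hVU inter_subset_right).isFramedSurface he hf').linearMap_ext hn ⟨hpV, hp⟩ hY
      fun α => hΦ _ ((hf'.isSectionOn α).2 p ⟨hpV, hp⟩))

end RealizesOn

theorem ConformalData.IsIntegrable.exists_realizesOn (h𝒟 : 𝒟.IsIntegrable)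
    (hM : IsLorentzSurface M) (hr : 1 ≤ r) (hn : r + 2 ≤ n) (he : e ∈ atlas (ℝ × ℝ) M) {p : M}
    (hp : p ∈ e.source) : ∃ B Y Φ, p ∈ B ∧ RealizesOn 𝒟 e B Y Φ := by
  obtain ⟨V, hpV, hVe, f, hf⟩ := 𝒟.isNormalSubbundle.exists_isLocalFrame hp
  obtain ⟨B, hpB, hBV, Y, ψ, h⟩ := h𝒟.exists_isFramedSurface hM he hVe hf hr hn hf hpV
  exact ⟨B, Y, _, hpB, h.realizesOn hM (by omega) he (hf.mono h.isOpen hBV)⟩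

end Realisation

/-! ### Realisations under isometries and coordinate changes -/

section RealisationChange

open Set Filter Topology Module

variable {n r : ℕ} {M : Type*} [TopologicalSpace M]

theorem confTangent_congr {e : Chart M} {p : M} (hp : p ∈ e.source) {Y Y' : M → Ambient n}
    (h : Y =ᶠ[𝓝 p] Y') :
    confTangent (fun _ => Y) e p = confTangent (fun _ => Y') e p := by
  simp only [confTangent, pu, pv, h.self_of_nhds, coordDeriv_congr hp h,
    coordDeriv_congr hp (eventually_coordDeriv_congr hp h)]

theorem IsPseudoOrthogonal.map_orthogonal {T : Ambient n ≃ₗ[ℝ] Ambient n}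
    (hT : IsPseudoOrthogonal n r T) (W : Submodule ℝ (Ambient n)) :
    (ambientForm n r).orthogonal (W.map (T : Ambient n →ₗ[ℝ] Ambient n)) =
      ((ambientForm n r).orthogonal W).map (T : Ambient n →ₗ[ℝ] Ambient n) := by
  ext x
  constructor
  · intro hx
    refine ⟨T.symm x, fun w hw => ?_, T.apply_symm_apply x⟩
    have := hx _ (Submodule.mem_map_of_mem hw)
    rw [← T.apply_symm_apply x] at this
    exact (hT _ _).symm.trans this
  · rintro ⟨x, hx, rfl⟩ _ ⟨w, hw, rfl⟩
    exact (hT _ _).trans (hx w hw)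

theorem coordDeriv_equiv_comp {e : Chart M} {p : M} {w : ℝ × ℝ} {f : M → Ambient n}
    (T : Ambient n ≃ₗ[ℝ] Ambient n) (hf : ChartSmoothAt e f p) :
    coordDeriv w e (fun q => T (f q)) p = T (coordDeriv w e f p) :=
  coordDeriv_clm_comp hf (T : Ambient n →ₗ[ℝ] Ambient n).toContinuousLinearMap

variable [ChartedSpace (ℝ × ℝ) M] {𝒟 : ConformalData M n r} {e e' : Chart M} {U : Set M}
  {Y : M → Ambient n} {Φ : M → Ambient n →ₗ[ℝ] Ambient n}

namespace RealizesOn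

/-- Every clause can be checked near each point; in the clauses about sections, the domain V is
shrunk by intersection. -/
theorem of_locally (hU : IsOpen U) (hUe : U ⊆ e.source)
    (h : ∀ p ∈ U, ∃ V, p ∈ V ∧ RealizesOn 𝒟 e V Y Φ) : RealizesOn 𝒟 e U Y Φ where
  isOpen := hU
  subset := hUe
  smooth p hp := let ⟨_, hpV, hV⟩ := h p hp; hV.smooth p hpV
  ne_zero p hp := let ⟨_, hpV, hV⟩ := h p hp; hV.ne_zero p hpV
  null p hp := let ⟨_, hpV, hV⟩ := h p hp; hV.null p hpV
  metric_uu p hp := let ⟨_, hpV, hV⟩ := h p hp; hV.metric_uu p hpV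
  metric_vv p hp := let ⟨_, hpV, hV⟩ := h p hp; hV.metric_vv p hpV
  metric_uv p hp := let ⟨_, hpV, hV⟩ := h p hp; hV.metric_uv p hpV
  map_eq p hp := let ⟨_, hpV, hV⟩ := h p hp; hV.map_eq p hpV
  isometry p hp := let ⟨_, hpV, hV⟩ := h p hp; hV.isometry p hpV
  smooth_section _ hWU hW σ hσ p hp :=
    let ⟨_, hpV, hV⟩ := h p (hWU hp)
    hV.smooth_section _ inter_subset_right (hW.inter hV.isOpen) σ (hσ.mono inter_subset_left) p
      ⟨hp, hpV⟩
  connection_u _ hWU hW σ hσ p hp :=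
    let ⟨_, hpV, hV⟩ := h p (hWU hp)
    hV.connection_u _ inter_subset_right (hW.inter hV.isOpen) σ (hσ.mono inter_subset_left) p
      ⟨hp, hpV⟩
  connection_v _ hWU hW σ hσ p hp :=
    let ⟨_, hpV, hV⟩ := h p (hWU hp)
    hV.connection_v _ inter_subset_right (hW.inter hV.isOpen) σ (hσ.mono inter_subset_left) p
      ⟨hp, hpV⟩
  eq_uu p hp := let ⟨_, hpV, hV⟩ := h p hp; hV.eq_uu p hpV
  eq_vv p hp := let ⟨_, hpV, hV⟩ := h p hp; hV.eq_vv p hpV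

variable (h : RealizesOn 𝒟 e U Y Φ)

include h

/-- The maps Φ and Φ' need to agree only on the fibres of NM, since they are evaluated only on
sections; membership of Dσ and κ in NM is used for this. -/
theorem congr (he : e ∈ atlas (ℝ × ℝ) M) {Y' : M → Ambient n}
    {Φ' : M → Ambient n →ₗ[ℝ] Ambient n} (hY : EqOn Y Y' U)
    (hΦ : ∀ q ∈ U, ∀ x ∈ 𝒟.NM q, Φ q x = Φ' q x) : RealizesOn 𝒟 e U Y' Φ' := by
  have hY0 : ∀ q ∈ U, Y =ᶠ[𝓝 q] Y' := fun q hq => hY.eventuallyEq_of_mem (h.isOpen.mem_nhds hq)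
  have hY1 : ∀ q ∈ U, ∀ w, coordDeriv w e Y' q = coordDeriv w e Y q := fun q hq w =>
    (coordDeriv_congr (h.subset hq) (hY0 q hq)).symm
  have hY2 : ∀ q ∈ U, ∀ w w', coordDeriv w e (coordDeriv w' e Y') q =
      coordDeriv w e (coordDeriv w' e Y) q := fun q hq w w' =>
    (coordDeriv_congr (h.subset hq) (eventually_coordDeriv_congr (h.subset hq) (hY0 q hq))).symm
  have hσ : ∀ V ⊆ U, IsOpen V → ∀ σ, IsSectionOn 𝒟.NM V σ → ∀ q ∈ V,
      (fun q => Φ q (σ q)) =ᶠ[𝓝 q] fun q => Φ' q (σ q) := fun V hVU hV σ hσ q hq =>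
    (hV.eventually_mem hq).mono fun x hx => hΦ x (hVU hx) _ (hσ.2 x hx)
  have hcT : ∀ q ∈ U, confTangent (fun _ => Y) e q = confTangent (fun _ => Y') e q :=
    fun q hq => confTangent_congr (h.subset hq) (hY0 q hq)
  have hcN : ∀ q ∈ U, confNormal r (fun _ => Y) e q = confNormal r (fun _ => Y') e q :=
    fun q hq => by rw [confNormal, confNormal, hcT q hq]
  constructor
  · exact h.isOpen
  · exact h.subset
  · exact fun q hq => (h.smooth q hq).congr (h.subset hq) (hY0 q hq)
  · exact fun q hq => hY hq ▸ h.ne_zero q hq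
  · exact fun q hq => hY hq ▸ h.null q hq
  · exact fun q hq => by rw [pu, hY1 q hq]; exact h.metric_uu q hq
  · exact fun q hq => by rw [pv, hY1 q hq]; exact h.metric_vv q hq
  · exact fun q hq => by rw [pu, pv, hY1 q hq, hY1 q hq]; exact h.metric_uv q hq
  · intro q hq
    rw [← hcN q hq, ← h.map_eq q hq]
    exact SetLike.coe_injective (image_congr fun x hx => (hΦ q hq x hx).symm)
  · intro q hq x hx z hz
    rw [← hΦ q hq x hx, ← hΦ q hq z hz, h.isometry q hq x hx z hz]
  · exact fun V hVU hV σ hs q hq => (h.smooth_section V hVU hV σ hs q hq).congr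
      (h.subset (hVU hq)) (hσ V hVU hV σ hs q hq)
  · intro V hVU hV σ hs q hq
    have h1 := h.connection_u V hVU hV σ hs q hq
    rwa [IsNormalPart, pu, coordDeriv_congr (h.subset (hVU hq)) (hσ V hVU hV σ hs q hq),
      hΦ q (hVU hq) _ ((𝒟.isCovariantDeriv_u.isSectionOn e he V hV (hVU.trans h.subset) σ hs).2
        q hq), hcT q (hVU hq), hcN q (hVU hq)] at h1
  · intro V hVU hV σ hs q hq
    have h1 := h.connection_v V hVU hV σ hs q hq
    rwa [IsNormalPart, pv, coordDeriv_congr (h.subset (hVU hq)) (hσ V hVU hV σ hs q hq),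
      hΦ q (hVU hq) _ ((𝒟.isCovariantDeriv_v.isSectionOn e he V hV (hVU.trans h.subset) σ hs).2
        q hq), hcT q (hVU hq), hcN q (hVU hq)] at h1
  · intro q hq
    rw [pu, pu, hY2 q hq, ← hY hq,
      ← hΦ q hq _ ((𝒟.isSection_κ₁ e he).2 q (h.subset hq))]
    exact h.eq_uu q hq
  · intro q hq
    rw [pv, pv, hY2 q hq, ← hY hq,
      ← hΦ q hq _ ((𝒟.isSection_κ₂ e he).2 q (h.subset hq))]
    exact h.eq_vv q hq

theorem comp_isometry {T : Ambient n ≃ₗ[ℝ] Ambient n} (hT : IsPseudoOrthogonal n r T) :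
    RealizesOn 𝒟 e U (fun q => T (Y q)) fun q => (T : Ambient n →ₗ[ℝ] Ambient n) ∘ₗ Φ q := by
  have hT1 : ∀ q ∈ U, ∀ w, coordDeriv w e (fun q => T (Y q)) q = T (coordDeriv w e Y q) :=
    fun q hq w => coordDeriv_equiv_comp T (h.smooth q hq)
  have hT2 : ∀ q ∈ U, ∀ w w', coordDeriv w e (coordDeriv w' e fun q => T (Y q)) q =
      T (coordDeriv w e (coordDeriv w' e Y) q) := by
    intro q hq w w'
    rw [coordDeriv_congr (h.subset hq) ((h.isOpen.eventually_mem hq).mono fun x hx =>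
      hT1 x hx w'), coordDeriv_equiv_comp T ((h.smooth q hq).coordDeriv (h.subset hq))]
  have hcT : ∀ q ∈ U, confTangent (fun _ q => T (Y q)) e q =
      (confTangent (fun _ => Y) e q).map (T : Ambient n →ₗ[ℝ] Ambient n) := by
    intro q hq
    simp only [confTangent, pu, pv, hT1 q hq, hT2 q hq, Submodule.map_span, image_insert_eq,
      image_singleton]
    rfl
  have hcN : ∀ q ∈ U, confNormal r (fun _ q => T (Y q)) e q =
      (confNormal r (fun _ => Y) e q).map (T : Ambient n →ₗ[ℝ] Ambient n) := by
    intro q hq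
    rw [confNormal, hcT q hq, hT.map_orthogonal]
    rfl
  have hnp : ∀ q ∈ U, ∀ x η, IsNormalPart r (fun _ => Y) e q x η →
      IsNormalPart r (fun _ q => T (Y q)) e q (T x) (T η) := by
    intro q hq x η hx
    rw [IsNormalPart, hcN q hq, hcT q hq, ← map_sub]
    exact ⟨Submodule.mem_map_of_mem hx.1, Submodule.mem_map_of_mem hx.2⟩
  constructor
  · exact h.isOpen
  · exact h.subset
  · exact fun q hq => (h.smooth q hq).clm_comp
      (T : Ambient n →ₗ[ℝ] Ambient n).toContinuousLinearMap
  · exact fun q hq => T.map_ne_zero_iff.2 (h.ne_zero q hq)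
  · exact fun q hq => (hT _ _).trans (h.null q hq)
  · exact fun q hq => by rw [pu, hT1 q hq, hT]; exact h.metric_uu q hq
  · exact fun q hq => by rw [pv, hT1 q hq, hT]; exact h.metric_vv q hq
  · exact fun q hq => by rw [pu, pv, hT1 q hq, hT1 q hq, hT]; exact h.metric_uv q hq
  · intro q hq
    rw [hcN q hq, ← h.map_eq q hq, Submodule.map_comp]
  · exact fun q hq x hx z hz => (hT _ _).trans (h.isometry q hq x hx z hz)
  · exact fun V hVU hV σ hs q hq => (h.smooth_section V hVU hV σ hs q hq).clm_comp
      (T : Ambient n →ₗ[ℝ] Ambient n).toContinuousLinearMap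
  · intro V hVU hV σ hs q hq
    have h1 := hnp q (hVU hq) _ _ (h.connection_u V hVU hV σ hs q hq)
    rwa [pu, ← coordDeriv_equiv_comp T (h.smooth_section V hVU hV σ hs q hq)] at h1
  · intro V hVU hV σ hs q hq
    have h1 := hnp q (hVU hq) _ _ (h.connection_v V hVU hV σ hs q hq)
    rwa [pv, ← coordDeriv_equiv_comp T (h.smooth_section V hVU hV σ hs q hq)] at h1
  · intro q hq
    have h1 := congrArg T (h.eq_uu q hq)
    rw [map_add, map_smul] at h1
    rw [pu, pu, hT2 q hq]
    exact h1
  · intro q hq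
    have h1 := congrArg T (h.eq_vv q hq)
    rw [map_add, map_smul] at h1
    rw [pv, pv, hT2 q hq]
    exact h1

end RealizesOn

end RealisationChange

/-! ### Realisations under changes of asymptotic coordinates -/

section CoordinateChange

open Set Filter Topology Module

variable {n r : ℕ} {M : Type*} [TopologicalSpace M]

theorem ChartSmoothAt.exp_neg {e : Chart M} {p : M} {a : M → ℝ} (ha : ChartSmoothAt e a p) :
    ChartSmoothAt e (fun q => Real.exp (-a q)) p :=
  ContDiffAt.exp ha.neg

theorem coordDeriv_exp_neg {e : Chart M} {p : M} (hp : p ∈ e.source) {w : ℝ × ℝ} {a : M → ℝ}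
    (ha : ChartSmoothAt e a p) :
    coordDeriv w e (fun q => Real.exp (-a q)) p =
      -coordDeriv w e a p * Real.exp (-a p) := by
  have := (ha.neg.hasFDerivAt.exp).fderiv
  have h2 := congrArg (fun T : ℝ × ℝ →L[ℝ] ℝ => T w) this
  have h3 := coordDeriv_neg (w := w) ha
  simp only [e.left_inv hp, smul_apply, smul_eq_mul] at h2
  rw [← h3, mul_comm]
  exact h2

variable [ChartedSpace (ℝ × ℝ) M] {e e' : Chart M} {U : Set M}

section

variable (hM : IsLorentzSurface M) (he : e ∈ atlas (ℝ × ℝ) M) (he' : e' ∈ atlas (ℝ × ℝ) M)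

include hM he he'

theorem IsLorentzSurface.exp_confFactor_mul {p : M} (hp : p ∈ e.source ∩ e'.source) :
    Real.exp (-confFactor e e' p) * Real.exp (-confFactor e e' p) *
      (jacU e e' p * jacV e e' p) = 1 := by
  have h := hM.conformal e he e' he' p hp
  rw [← Real.exp_add, confFactor, show -(Real.log (jacU e e' p * jacV e e' p) / 2) +
    -(Real.log (jacU e e' p * jacV e e' p) / 2) = -Real.log (jacU e e' p * jacV e e' p) by ring,
    Real.exp_neg, Real.exp_log h, inv_mul_cancel₀ h.ne']

/-- Links the factor of the lift with the line bundles: the weights are (∂u/∂ũ)² e^{-ρ} and (∂v/∂ṽ)²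
e^{-ρ}. -/
theorem IsLorentzSurface.exp_confFactor_eq {p : M} (hp : p ∈ e.source ∩ e'.source) :
    Real.exp (-confFactor e e' p) = (Real.sqrt (jacU e e' p * jacV e e' p))⁻¹ := by
  have h := hM.conformal e he e' he' p hp
  rw [Real.sqrt_eq_rpow, ← Real.rpow_neg h.le, Real.rpow_def_of_pos h, confFactor]
  congr 1
  ring

theorem IsLorentzSurface.exp_confFactor_symm {p : M} (hp : p ∈ e.source ∩ e'.source) :
    Real.exp (-confFactor e' e p) * Real.exp (-confFactor e e' p) = 1 := by
  have h1 := hM.confFactor_add he he' he ⟨hp, hp.1⟩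
  rw [confFactor_self hp.1] at h1
  rw [← Real.exp_add, show -confFactor e' e p + -confFactor e e' p = 0 by linarith, Real.exp_zero]

/-- Commuting the partial derivatives reduces this to the vanishing of ∂v/∂ũ. -/
theorem IsLorentzSurface.pu_jacV {p : M} (hp : p ∈ e.source ∩ e'.source) :
    pu e' (jacV e e') p = 0 := by
  have h1 : pu e' (jacV e e') p = pv e' (pu e' fun q => (e q).2) p :=
    coordDeriv_comm hp.2
      ((hM.chartSmoothAt_chart he he' hp).clm_comp (ContinuousLinearMap.snd ℝ ℝ ℝ))
  rw [h1, pv, coordDeriv_congr hp.2 (((e.open_source.inter e'.open_source).eventually_mem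
    hp).mono fun q hq => hM.null_v e he e' he' q hq), coordDeriv_const]

theorem IsLorentzSurface.pv_jacU {p : M} (hp : p ∈ e.source ∩ e'.source) :
    pv e' (jacU e e') p = 0 := by
  have h1 : pv e' (jacU e e') p = pu e' (pv e' fun q => (e q).1) p :=
    coordDeriv_comm hp.2
      ((hM.chartSmoothAt_chart he he' hp).clm_comp (ContinuousLinearMap.fst ℝ ℝ ℝ))
  rw [h1, pu, coordDeriv_congr hp.2 (((e.open_source.inter e'.open_source).eventually_mem
    hp).mono fun q hq => hM.null_u e he e' he' q hq), coordDeriv_const]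

/-- Differentiate the identity e^{-2ρ} (∂u/∂ũ)(∂v/∂ṽ) = 1 and cancel the exponential. -/
theorem IsLorentzSurface.coordDeriv_jac_mul {p : M} (hp : p ∈ e.source ∩ e'.source)
    (w : ℝ × ℝ) :
    coordDeriv w e' (jacU e e') p * jacV e e' p + jacU e e' p * coordDeriv w e' (jacV e e') p =
      2 * coordDeriv w e' (confFactor e e') p * (jacU e e' p * jacV e e' p) := by
  have hE := (hM.chartSmoothAt_confFactor he he' hp).exp_neg
  have ha := hM.chartSmoothAt_jacU he he' hp
  have hb := hM.chartSmoothAt_jacV he he' hp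
  have h1 := coordDeriv_congr (w := w) hp.2
    (((e.open_source.inter e'.open_source).eventually_mem hp).mono fun q hq =>
      hM.exp_confFactor_mul he he' hq)
  rw [coordDeriv_const, coordDeriv_mul hp.2 (hE.mul hE) (ha.mul hb), coordDeriv_mul hp.2 hE hE,
    coordDeriv_mul hp.2 ha hb,
    coordDeriv_exp_neg hp.2 (hM.chartSmoothAt_confFactor he he' hp)] at h1
  have h2 := (Real.exp_pos (-confFactor e e' p)).ne'
  refine mul_left_cancel₀ (mul_ne_zero h2 h2) ?_
  linear_combination h1

theorem IsLorentzSurface.pu_jacU {p : M} (hp : p ∈ e.source ∩ e'.source) :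
    pu e' (jacU e e') p = 2 * pu e' (confFactor e e') p * jacU e e' p := by
  have h1 := hM.coordDeriv_jac_mul he he' hp (1, 0)
  have h2 : coordDeriv (1, 0) e' (jacV e e') p = 0 := hM.pu_jacV he he' hp
  rw [h2] at h1
  refine mul_right_cancel₀ (right_ne_zero_of_mul (hM.conformal e he e' he' p hp).ne') ?_
  simp only [pu]
  linear_combination h1

theorem IsLorentzSurface.pv_jacV {p : M} (hp : p ∈ e.source ∩ e'.source) :
    pv e' (jacV e e') p = 2 * pv e' (confFactor e e') p * jacV e e' p := by
  have h1 := hM.coordDeriv_jac_mul he he' hp (0, 1)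
  have h2 : coordDeriv (0, 1) e' (jacU e e') p = 0 := hM.pv_jacU he he' hp
  rw [h2] at h1
  refine mul_left_cancel₀ (left_ne_zero_of_mul (hM.conformal e he e' he' p hp).ne') ?_
  simp only [pv]
  linear_combination h1

end

omit [ChartedSpace (ℝ × ℝ) M] in
theorem coordDeriv_smul_add_smul {e : Chart M} {p : M} (hp : p ∈ e.source) {w : ℝ × ℝ}
    {a b : M → ℝ} {f g : M → Ambient n} (ha : ChartSmoothAt e a p) (hf : ChartSmoothAt e f p)
    (hb : ChartSmoothAt e b p) (hg : ChartSmoothAt e g p) :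
    coordDeriv w e (fun q => a q • f q + b q • g q) p =
      coordDeriv w e a p • f p + a p • coordDeriv w e f p +
        (coordDeriv w e b p • g p + b p • coordDeriv w e g p) := by
  rw [coordDeriv_add (ha.smul hf) (hb.smul hg), coordDeriv_smul hp ha hf, coordDeriv_smul hp hb hg]

section

variable (hM : IsLorentzSurface M) (he : e ∈ atlas (ℝ × ℝ) M) (he' : e' ∈ atlas (ℝ × ℝ) M)
  (hU : IsOpen U) (hUe : U ⊆ e.source ∩ e'.source) {Y : M → Ambient n}
  (hY : ∀ q ∈ U, ChartSmoothAt e Y q) {E : M → ℝ} (hE : ∀ q ∈ U, ChartSmoothAt e' E q)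
  {p : M} (hp : p ∈ U)

include hM he he' hUe hY hE hp

theorem IsLorentzSurface.pu_smul_change :
    pu e' (fun q => E q • Y q) p = pu e' E p • Y p + (E p * jacU e e' p) • pu e Y p := by
  have h1 : coordDeriv (1, 0) e' Y p = _ := hM.pu_change he he' (hUe hp) (hY p hp)
  rw [pu, coordDeriv_smul (hUe hp).2 (hE p hp) (hM.chartSmoothAt_change he he' (hUe hp) (hY p hp)),
    h1, smul_smul]

theorem IsLorentzSurface.pv_smul_change :
    pv e' (fun q => E q • Y q) p = pv e' E p • Y p + (E p * jacV e e' p) • pv e Y p := by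
  have h1 : coordDeriv (0, 1) e' Y p = _ := hM.pv_change he he' (hUe hp) (hY p hp)
  rw [pv, coordDeriv_smul (hUe hp).2 (hE p hp) (hM.chartSmoothAt_change he he' (hUe hp) (hY p hp)),
    h1, smul_smul]

include hU

theorem IsLorentzSurface.pv_pu_smul_change :
    pv e' (pu e' fun q => E q • Y q) p = pv e' (pu e' E) p • Y p +
      (pu e' E p * jacV e e' p) • pv e Y p +
      (pv e' (fun q => E q * jacU e e' q) p • pu e Y p +
        (E p * jacU e e' p * jacV e e' p) • pv e (pu e Y) p) := by
  have hp' := hUe hp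
  have hYu := (hY p hp).coordDeriv (w := (1, 0)) hp'.1
  have hv : coordDeriv (0, 1) e' Y p = _ := hM.pv_change he he' hp' (hY p hp)
  have hv' : coordDeriv (0, 1) e' (coordDeriv (1, 0) e Y) p = _ := hM.pv_change he he' hp' hYu
  rw [pv, coordDeriv_congr hp'.2 ((hU.eventually_mem hp).mono fun q hq =>
    hM.pu_smul_change he he' hUe hY hE hq), coordDeriv_smul_add_smul hp'.2
    ((hE p hp).coordDeriv hp'.2) (hM.chartSmoothAt_change he he' hp' (hY p hp))
    ((hE p hp).mul (hM.chartSmoothAt_jacU he he' hp'))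
    (hM.chartSmoothAt_change he he' hp' hYu), hv, hv', smul_smul, smul_smul]

theorem IsLorentzSurface.pu_pu_smul_change :
    pu e' (pu e' fun q => E q • Y q) p = pu e' (pu e' E) p • Y p +
      (pu e' E p * jacU e e' p) • pu e Y p +
      (pu e' (fun q => E q * jacU e e' q) p • pu e Y p +
        (E p * jacU e e' p * jacU e e' p) • pu e (pu e Y) p) := by
  have hp' := hUe hp
  have hYu := (hY p hp).coordDeriv (w := (1, 0)) hp'.1
  have hu : coordDeriv (1, 0) e' Y p = _ := hM.pu_change he he' hp' (hY p hp)
  have hu' : coordDeriv (1, 0) e' (coordDeriv (1, 0) e Y) p = _ := hM.pu_change he he' hp' hYu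
  rw [pu, coordDeriv_congr hp'.2 ((hU.eventually_mem hp).mono fun q hq =>
    hM.pu_smul_change he he' hUe hY hE hq), coordDeriv_smul_add_smul hp'.2
    ((hE p hp).coordDeriv hp'.2) (hM.chartSmoothAt_change he he' hp' (hY p hp))
    ((hE p hp).mul (hM.chartSmoothAt_jacU he he' hp'))
    (hM.chartSmoothAt_change he he' hp' hYu), hu, hu', smul_smul, smul_smul]

theorem IsLorentzSurface.pv_pv_smul_change :
    pv e' (pv e' fun q => E q • Y q) p = pv e' (pv e' E) p • Y p +
      (pv e' E p * jacV e e' p) • pv e Y p +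
      (pv e' (fun q => E q * jacV e e' q) p • pv e Y p +
        (E p * jacV e e' p * jacV e e' p) • pv e (pv e Y) p) := by
  have hp' := hUe hp
  have hYu := (hY p hp).coordDeriv (w := (0, 1)) hp'.1
  have hv : coordDeriv (0, 1) e' Y p = _ := hM.pv_change he he' hp' (hY p hp)
  have hv' : coordDeriv (0, 1) e' (coordDeriv (0, 1) e Y) p = _ := hM.pv_change he he' hp' hYu
  rw [pv, coordDeriv_congr hp'.2 ((hU.eventually_mem hp).mono fun q hq =>
    hM.pv_smul_change he he' hUe hY hE hq), coordDeriv_smul_add_smul hp'.2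
    ((hE p hp).coordDeriv hp'.2) (hM.chartSmoothAt_change he he' hp' (hY p hp))
    ((hE p hp).mul (hM.chartSmoothAt_jacV he he' hp'))
    (hM.chartSmoothAt_change he he' hp' hYu), hv, hv', smul_smul, smul_smul]

/-- Rescaling and diagonal coordinate changes add only terms already in V. It is stated for a
general factor E so that the reverse inclusion follows by exchanging the charts. -/
theorem IsLorentzSurface.confTangent_change_le :
    confTangent (fun _ q => E q • Y q) e' p ≤ confTangent (fun _ => Y) e p := by
  have h0 : Y p ∈ confTangent (fun _ => Y) e p := Submodule.subset_span (by simp)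
  have h1 : pu e Y p ∈ confTangent (fun _ => Y) e p := Submodule.subset_span (by simp)
  have h2 : pv e Y p ∈ confTangent (fun _ => Y) e p := Submodule.subset_span (by simp)
  have h3 : pv e (pu e Y) p ∈ confTangent (fun _ => Y) e p := Submodule.subset_span (by simp)
  rw [confTangent, Submodule.span_le]
  rintro x (rfl | rfl | rfl | rfl)
  · exact Submodule.smul_mem _ _ h0
  · rw [hM.pu_smul_change he he' hUe hY hE hp]
    exact add_mem (Submodule.smul_mem _ _ h0) (Submodule.smul_mem _ _ h1)
  · rw [hM.pv_smul_change he he' hUe hY hE hp]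
    exact add_mem (Submodule.smul_mem _ _ h0) (Submodule.smul_mem _ _ h2)
  · rw [hM.pv_pu_smul_change he he' hU hUe hY hE hp]
    exact add_mem (add_mem (Submodule.smul_mem _ _ h0) (Submodule.smul_mem _ _ h2))
      (add_mem (Submodule.smul_mem _ _ h1) (Submodule.smul_mem _ _ h3))

end

theorem IsLorentzSurface.confTangent_change (hM : IsLorentzSurface M)
    (he : e ∈ atlas (ℝ × ℝ) M) (he' : e' ∈ atlas (ℝ × ℝ) M) (hU : IsOpen U)
    (hUe : U ⊆ e.source ∩ e'.source) {Y : M → Ambient n}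
    (hY : ∀ q ∈ U, ChartSmoothAt e Y q) {p : M} (hp : p ∈ U) :
    confTangent (fun _ q => Real.exp (-confFactor e e' q) • Y q) e' p =
      confTangent (fun _ => Y) e p := by
  have hE : ∀ q ∈ U, ChartSmoothAt e' (fun q => Real.exp (-confFactor e e' q)) q :=
    fun q hq => (hM.chartSmoothAt_confFactor he he' (hUe hq)).exp_neg
  have hE' : ∀ q ∈ U, ChartSmoothAt e (fun q => Real.exp (-confFactor e' e q)) q :=
    fun q hq => (hM.chartSmoothAt_confFactor he' he (hUe hq).symm).exp_neg
  refine le_antisymm (hM.confTangent_change_le he he' hU hUe hY hE hp) ?_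
  have h1 := hM.confTangent_change_le he' he hU (fun q hq => (hUe hq).symm)
    (Y := fun q => Real.exp (-confFactor e e' q) • Y q)
    (fun q hq => (hE q hq).smul (hM.chartSmoothAt_change he he' (hUe hq) (hY q hq))) hE' hp
  rwa [confTangent_congr (hUe hp).1 ((hU.eventually_mem hp).mono fun q hq => by
    rw [smul_smul, hM.exp_confFactor_symm he he' (hUe hq), one_smul]) (Y' := Y)] at h1

/-- The bundle map stays the same while Y becomes e^{-ρ} Y; the prescribed transformation laws are
precisely what keeps the structure equations true. -/
theorem RealizesOn.change {𝒟 : ConformalData M n r} {Y : M → Ambient n}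
    {Φ : M → Ambient n →ₗ[ℝ] Ambient n} (h : RealizesOn 𝒟 e U Y Φ) (hM : IsLorentzSurface M)
    (he : e ∈ atlas (ℝ × ℝ) M) (he' : e' ∈ atlas (ℝ × ℝ) M) :
    RealizesOn 𝒟 e' (U ∩ e'.source) (fun q => Real.exp (-confFactor e e' q) • Y q) Φ := by
  set W := U ∩ e'.source with hW_def
  set E : M → ℝ := fun q => Real.exp (-confFactor e e' q) with hE_def
  have hW : IsOpen W := h.isOpen.inter e'.open_source
  have hWU : W ⊆ U := inter_subset_left
  have hWe : W ⊆ e.source ∩ e'.source := fun q hq => ⟨h.subset hq.1, hq.2⟩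
  have hρ : ∀ q ∈ W, ChartSmoothAt e' (confFactor e e') q := fun q hq =>
    hM.chartSmoothAt_confFactor he he' (hWe hq)
  have hE : ∀ q ∈ W, ChartSmoothAt e' E q := fun q hq => (hρ q hq).exp_neg
  have hY : ∀ q ∈ W, ChartSmoothAt e Y q := fun q hq => h.smooth q hq.1
  have hE1 : ∀ q ∈ W, E q * E q * (jacU e e' q * jacV e e' q) = 1 := fun q hq =>
    hM.exp_confFactor_mul he he' (hWe hq)
  have hEd : ∀ q ∈ W, ∀ w, coordDeriv w e' E q = -coordDeriv w e' (confFactor e e') q * E q :=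
    fun q hq w => coordDeriv_exp_neg hq.2 (hρ q hq)
  have hEdd : ∀ q ∈ W, ∀ w, coordDeriv w e' (coordDeriv w e' E) q =
      (-coordDeriv w e' (coordDeriv w e' (confFactor e e')) q +
        coordDeriv w e' (confFactor e e') q ^ 2) * E q := fun q hq w => by
    have hρ' := (hρ q hq).coordDeriv (w := w) hq.2
    rw [coordDeriv_congr hq.2 ((hW.eventually_mem hq).mono fun x hx => hEd x hx w),
      coordDeriv_mul hq.2 hρ'.neg (hE q hq), coordDeriv_neg hρ', hEd q hq w]
    ring
  have hcT : ∀ q ∈ W, confTangent (fun _ q => E q • Y q) e' q = confTangent (fun _ => Y) e q :=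
    fun q hq => hM.confTangent_change he he' hW hWe hY hq
  have hcN : ∀ q ∈ W, confNormal r (fun _ q => E q • Y q) e' q = confNormal r (fun _ => Y) e q :=
    fun q hq => by rw [confNormal, hcT q hq]; rfl
  have hnp : ∀ q ∈ W, ∀ x η (a : ℝ), IsNormalPart r (fun _ => Y) e q x η →
      IsNormalPart r (fun _ q => E q • Y q) e' q (a • x) (a • η) := by
    intro q hq x η a hx
    rw [IsNormalPart, hcN q hq, hcT q hq, ← smul_sub]
    exact ⟨Submodule.smul_mem _ _ hx.1, Submodule.smul_mem _ _ hx.2⟩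
  have hYw : ∀ q ∈ W, ∀ w, ambientForm n r (Y q) (coordDeriv w e Y q) = 0 := by
    intro q hq w
    have := form_coordDeriv_eq_zero (w := w) (h.subset hq.1) (hY q hq) (hY q hq)
      ((h.isOpen.eventually_mem hq.1).mono h.null)
    rw [ambientForm_comm (coordDeriv _ _ _ _)] at this
    exact (add_self_eq_zero).1 this
  have hYu : ∀ q ∈ W, ambientForm n r (Y q) (pu e Y q) = 0 := fun q hq => hYw q hq _
  have hYv : ∀ q ∈ W, ambientForm n r (Y q) (pv e Y q) = 0 := fun q hq => hYw q hq _
  constructor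
  · exact hW
  · exact inter_subset_right
  · exact fun q hq => (hE q hq).smul (hM.chartSmoothAt_change he he' (hWe hq) (hY q hq))
  · exact fun q hq => smul_ne_zero (Real.exp_pos _).ne' (h.ne_zero q hq.1)
  · exact fun q hq => by simp [h.null q hq.1]
  · intro q hq
    rw [hM.pu_smul_change he he' hWe hY hE hq]
    simp [h.null q hq.1, h.metric_uu q hq.1, hYu q hq, ambientForm_comm (pu e Y q) (Y q)]
  · intro q hq
    rw [hM.pv_smul_change he he' hWe hY hE hq]
    simp [h.null q hq.1, h.metric_vv q hq.1, hYv q hq, ambientForm_comm (pv e Y q) (Y q)]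
  · intro q hq
    rw [hM.pu_smul_change he he' hWe hY hE hq, hM.pv_smul_change he he' hWe hY hE hq]
    simp [h.null q hq.1, h.metric_uv q hq.1, hYu q hq, hYv q hq,
      ambientForm_comm (pu e Y q) (Y q)]
    linear_combination (1 / 2 : ℝ) * hE1 q hq
  · exact fun q hq => (h.map_eq q hq.1).trans (hcN q hq).symm
  · exact fun q hq => h.isometry q hq.1
  · exact fun V hV hVo σ hσ q hq => hM.chartSmoothAt_change he he' (hWe (hV hq))
      (h.smooth_section V (hV.trans hWU) hVo σ hσ q hq)
  · intro V hV hVo σ hσ q hq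
    rw [hM.pu_change he he' (hWe (hV hq)) (h.smooth_section V (hV.trans hWU) hVo σ hσ q hq),
      𝒟.Du_change e he e' he' V hVo (hV.trans hWe) σ hσ q hq, map_smul]
    exact hnp q (hV hq) _ _ _ (h.connection_u V (hV.trans hWU) hVo σ hσ q hq)
  · intro V hV hVo σ hσ q hq
    rw [hM.pv_change he he' (hWe (hV hq)) (h.smooth_section V (hV.trans hWU) hVo σ hσ q hq),
      𝒟.Dv_change e he e' he' V hVo (hV.trans hWe) σ hσ q hq, map_smul]
    exact hnp q (hV hq) _ _ _ (h.connection_v V (hV.trans hWU) hVo σ hσ q hq)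
  -- With E = e^{-ρ} and J = ∂u/∂ũ, the Y_u-coefficient E_ũ J + (E J)_ũ vanishes because J_ũ = 2ρ_ũ
  -- J. The Y-coefficient contains E_ũũ = (ρ_ũ² - ρ_ũũ) E, which is the inhomogeneous term in the
  -- law of s₁.
  · intro q hq
    have h1 : coordDeriv (1, 0) e' (jacU e e') q = _ := hM.pu_jacU he he' (hWe hq)
    have h2 : E q = _ := hM.exp_confFactor_eq he he' (hWe hq)
    have h3 : weight₁ e e' q = jacU e e' q ^ 2 * E q := by rw [h2, weight₁, div_eq_mul_inv]
    have h4 : Real.exp (-confFactor e e' q) = E q := rfl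
    rw [hM.pu_pu_smul_change he he' hW hWe hY hE hq, h.eq_uu q hq.1,
      𝒟.κ₁_change e he e' he' q (hWe hq), 𝒟.s₁_change e he e' he' q (hWe hq), h3, h4, map_smul]
    simp only [pu] at h1 ⊢
    rw [hEdd q hq, hEd q hq,
      coordDeriv_mul hq.2 (hE q hq) (hM.chartSmoothAt_jacU he he' (hWe hq)), h1, hEd q hq]
    module
  · intro q hq
    have h1 : coordDeriv (0, 1) e' (jacV e e') q = _ := hM.pv_jacV he he' (hWe hq)
    have h2 : E q = _ := hM.exp_confFactor_eq he he' (hWe hq)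
    have h3 : weight₂ e e' q = jacV e e' q ^ 2 * E q := by rw [h2, weight₂, div_eq_mul_inv]
    have h4 : Real.exp (-confFactor e e' q) = E q := rfl
    rw [hM.pv_pv_smul_change he he' hW hWe hY hE hq, h.eq_vv q hq.1,
      𝒟.κ₂_change e he e' he' q (hWe hq), 𝒟.s₂_change e he e' he' q (hWe hq), h3, h4, map_smul]
    simp only [pv] at h1 ⊢
    rw [hEdd q hq, hEd q hq,
      coordDeriv_mul hq.2 (hE q hq) (hM.chartSmoothAt_jacV he he' (hWe hq)), h1, hEd q hq]
    module

end CoordinateChange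

/-! ### Locally constant cocycles on simply connected spaces -/

section Cocycles

open Set Filter Topology

variable {B : Type*} [TopologicalSpace B] {G : Type*} [Group G]

/-- The principal bundle with discrete fibre defined by a locally constant cocycle. -/
def cocycleCore [TopologicalSpace G] [DiscreteTopology G] (W : B → Set B)
    (hW : ∀ i, IsOpen (W i)) (hmem : ∀ i, i ∈ W i) (g : B → B → B → G)
    (hloc : ∀ i j, ∀ x ∈ W i ∩ W j, ∀ᶠ y in 𝓝 x, g i j y = g i j x)
    (hmul : ∀ i j k, ∀ x ∈ W i ∩ W j ∩ W k, g j k x * g i j x = g i k x) :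
    FiberBundleCore B B G where
  baseSet := W
  isOpen_baseSet := hW
  indexAt := id
  mem_baseSet_at := hmem
  -- Right multiplication by inverses matches the order g_jk g_ij = g_ik of the cocycle.
  coordChange i j x t := t * (g i j x)⁻¹
  coordChange_self i x hx t := by
    -- The cocycle identity makes g_ii idempotent, hence trivial.
    have := hmul i i i x ⟨⟨hx, hx⟩, hx⟩
    rw [mul_eq_left.1 this, inv_one, mul_one]
  continuousOn_coordChange i j := by
    rintro ⟨x, t⟩ hx
    refine ContinuousAt.continuousWithinAt ?_
    rw [ContinuousAt, nhds_discrete G, tendsto_pure, nhds_prod_eq, nhds_discrete G]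
    refine ((hloc i j x hx.1).prod_mk (eventually_pure (p := fun s => s = t).2 rfl)).mono ?_
    rintro ⟨y, s⟩ ⟨h1, h2⟩
    simp only at h1 h2 ⊢
    rw [h1, h2]
  coordChange_comp i j k x hx t := by
    rw [mul_assoc, ← mul_inv_rev, hmul i j k x hx]

/-- A locally constant cocycle on a simply connected space is a coboundary. -/
theorem exists_coboundary_of_simplyConnected [SimplyConnectedSpace B]
    [LocallyPathConnectedSpace B] (W : B → Set B)
    (hW : ∀ i, IsOpen (W i)) (hmem : ∀ i, i ∈ W i) (g : B → B → B → G)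
    (hloc : ∀ i j, ∀ x ∈ W i ∩ W j, ∀ᶠ y in 𝓝 x, g i j y = g i j x)
    (hmul : ∀ i j k, ∀ x ∈ W i ∩ W j ∩ W k, g j k x * g i j x = g i k x) :
    ∃ h : B → B → G, (∀ i, ∀ x ∈ W i, ∀ᶠ y in 𝓝 x, h i y = h i x) ∧
      ∀ i j, ∀ x ∈ W i ∩ W j, h j x * g i j x = h i x := by
  -- The discrete topology makes the associated bundle a covering. Lifting the identity map of the
  -- simply connected base then gives a global section F.
  let _ : TopologicalSpace G := ⊥
  have : DiscreteTopology G := ⟨rfl⟩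
  let Z := cocycleCore W hW hmem g hloc hmul
  have hcov : IsCoveringMap (Bundle.TotalSpace.proj : Z.TotalSpace → B) :=
    IsFiberBundle.isCoveringMap fun x => ⟨Z.localTriv x, hmem x⟩
  obtain ⟨b₀⟩ : Nonempty B := inferInstance
  obtain ⟨F, ⟨-, hF⟩, -⟩ := hcov.existsUnique_continuousMap_lifts (ContinuousMap.id B) b₀
    ⟨b₀, (1 : G)⟩ rfl
  have hF' : ∀ x, (F x).1 = x := fun x => congrFun hF x
  let fib : Z.TotalSpace → G := fun t => t.2
  have hval : ∀ i x, (Z.localTriv i (F x)).2 = fib (F x) * (g x i x)⁻¹ := by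
    intro i x
    have h1 : (Z.localTriv i (F x)).2 = fib (F x) * (g (F x).1 i (F x).1)⁻¹ := rfl
    rwa [hF' x] at h1
  -- The coboundary is the fibre coordinate of F in the i-th trivialisation. It is continuous with
  -- discrete values, so it is locally constant.
  refine ⟨fun i x => (Z.localTriv i (F x)).2, fun i x hx => ?_, fun i j x hx => ?_⟩
  · have h1 : ContinuousAt (fun y => (Z.localTriv i (F y)).2) x := by
      refine continuous_snd.continuousAt.comp
        (((Z.localTriv i).continuousAt ?_).comp F.continuous.continuousAt)
      change (F x).1 ∈ W i
      rwa [hF' x]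
    rw [ContinuousAt, nhds_discrete G, tendsto_pure] at h1
    exact h1
  · beta_reduce
    rw [hval, hval, ← hmul x i j x ⟨⟨hmem x, hx.1⟩, hx.2⟩, mul_inv_rev, mul_assoc,
      inv_mul_cancel_right]

end Cocycles

/-! ### Global realisation of integrable conformal data -/

section GlobalExistence

open Set Filter Topology Module

/-- The group `O(n-r+1, r+1)`. -/
def pseudoOrthogonalGroup (n r : ℕ) : Subgroup (Ambient n ≃ₗ[ℝ] Ambient n) where
  carrier := {T | IsPseudoOrthogonal n r T}
  mul_mem' hS hT x z := (hS _ _).trans (hT x z)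
  one_mem' _ _ := rfl
  inv_mem' {T} hT x z := by
    have h := hT (T.symm x) (T.symm z)
    rw [T.apply_symm_apply, T.apply_symm_apply] at h
    exact h.symm

variable {n r : ℕ} {M : Type*} [TopologicalSpace M] [ChartedSpace (ℝ × ℝ) M]
  {𝒟 : ConformalData M n r}

theorem ConformalData.IsIntegrable.exists_global (h𝒟 : 𝒟.IsIntegrable)
    (hM : IsLorentzSurface M) [SimplyConnectedSpace M] (hr : 1 ≤ r) (hn : r + 2 ≤ n) :
    ∃ (Y : Chart M → M → Ambient n) (Φ : M → Ambient n →ₗ[ℝ] Ambient n),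
      (∀ e ∈ atlas (ℝ × ℝ) M, RealizesOn 𝒟 e e.source (Y e) Φ) ∧
      ∀ e ∈ atlas (ℝ × ℝ) M, ∀ e' ∈ atlas (ℝ × ℝ) M, ∀ p ∈ e.source ∩ e'.source,
        Y e' p = Real.exp (-confFactor e e' p) • Y e p := by
  have hn2 : 2 ≤ n := by omega
  -- Needed for lifting maps to the covering; it is inherited from the plane through the charts.
  have : LocallyPathConnectedSpace M := ChartedSpace.locallyPathConnectedSpace (ℝ × ℝ) M
  let ch : M → Chart M := fun x => chartAt (ℝ × ℝ) x
  have hch : ∀ x, ch x ∈ atlas (ℝ × ℝ) M := chart_mem_atlas _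
  have hchm : ∀ x, x ∈ (ch x).source := mem_chart_source _
  choose W Yl Φl hmem hreal using fun x => h𝒟.exists_realizesOn hM hr hn (hch x) (hchm x)
  have hWo : ∀ i, IsOpen (W i) := fun i => (hreal i).isOpen
  have hWs : ∀ i, W i ⊆ (ch i).source := fun i => (hreal i).subset
  have exp_mul : ∀ e ∈ atlas (ℝ × ℝ) M, ∀ e' ∈ atlas (ℝ × ℝ) M, ∀ e'' ∈ atlas (ℝ × ℝ) M,
      ∀ p ∈ e.source ∩ e'.source ∩ e''.source,
      Real.exp (-confFactor e' e'' p) * Real.exp (-confFactor e e' p) =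
        Real.exp (-confFactor e e'' p) := by
    intro e he e' he' e'' he'' p hp
    rw [← Real.exp_add, ← hM.confFactor_add he he' he'' hp]
    congr 1
    ring
  -- The two lifts live in different charts, so the i-th one is first rescaled to the chart of j.
  -- Demanding agreement on the normal bundles as well makes T unique.
  let Cong : M → M → M → (Ambient n ≃ₗ[ℝ] Ambient n) → Prop := fun i j q T => ∀ᶠ y in 𝓝 q,
    T (Real.exp (-confFactor (ch i) (ch j) y) • Yl i y) = Yl j y ∧
      ∀ x ∈ 𝒟.NM y, T (Φl i y x) = Φl j y x
  have hreal' : ∀ i j, RealizesOn 𝒟 (ch j) (W i ∩ W j)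
      (fun y => Real.exp (-confFactor (ch i) (ch j) y) • Yl i y) (Φl i) := fun i j =>
    ((hreal i).change hM (hch i) (hch j)).mono ((hWo i).inter (hWo j))
      fun q hq => ⟨hq.1, hWs j hq.2⟩
  have hex : ∀ i j q, q ∈ W i ∩ W j → ∃ T : pseudoOrthogonalGroup n r, Cong i j q T := by
    intro i j q hq
    obtain ⟨T, hT, hC⟩ := (hreal' i j).exists_congruence hn2 (hch j)
      ((hreal j).mono ((hWo i).inter (hWo j)) inter_subset_right) hq
    exact ⟨⟨T, hT⟩, hC⟩
  have huniq : ∀ i j q, q ∈ W i ∩ W j → ∀ S T : pseudoOrthogonalGroup n r, Cong i j q S →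
      Cong i j q T → S = T := by
    intro i j q hq S T hS hT
    refine Subtype.ext ((hreal' i j).linearEquiv_ext hn2 (hch j) hq ?_ fun x hx =>
      (hS.self_of_nhds.2 x hx).trans (hT.self_of_nhds.2 x hx).symm)
    filter_upwards [hS, hT] with y h1 h2 using h1.1.trans h2.1.symm
  -- Off the overlaps the values of g are arbitrary; the cocycle conditions are asked only on
  -- overlaps.
  choose! g hg using hex
  obtain ⟨h, hloc, hrel⟩ := exists_coboundary_of_simplyConnected W hWo hmem g
    (fun i j q hq => by
      filter_upwards [(hg i j q hq).eventually_nhds, ((hWo i).inter (hWo j)).mem_nhds hq]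
        with y hy hyW
      exact huniq i j y hyW _ _ (hg i j y hyW) hy)
    (fun i j k q hq => by
      refine huniq i k q ⟨hq.1.1, hq.2⟩ _ _ ?_ (hg i k q ⟨hq.1.1, hq.2⟩)
      filter_upwards [hg i j q hq.1, hg j k q ⟨hq.1.2, hq.2⟩,
        (((hWo i).inter (hWo j)).inter (hWo k)).mem_nhds hq] with y h1 h2 hy
      refine ⟨?_, fun x hx => ?_⟩
      · rw [← h2.1, ← h1.1, ← exp_mul _ (hch i) _ (hch j) _ (hch k) y
          ⟨⟨hWs i hy.1.1, hWs j hy.1.2⟩, hWs k hy.2⟩, mul_smul]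
        simp only [map_smul]
        rfl
      · rw [← h2.2 x hx, ← h1.2 x hx]
        rfl)
  let H : M → M → Ambient n ≃ₗ[ℝ] Ambient n := fun i q => h i q
  have hH : ∀ i j q, q ∈ W i ∩ W j → ∀ x, H j q ((g i j q).1 x) = H i q x := by
    intro i j q hq x
    exact LinearEquiv.congr_fun (congrArg Subtype.val (hrel i j q hq)) x
  -- At each q the realisation indexed by q itself is corrected by the coboundary and rescaled to
  -- the chart e. By the relation h_j g_ij = h_i, any other index whose domain contains q gives the
  -- same value.
  refine ⟨fun e q => Real.exp (-confFactor (ch q) e q) • H q q (Yl q q),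
    fun q => (H q q : Ambient n →ₗ[ℝ] Ambient n) ∘ₗ Φl q q, fun e he => ?_,
    fun e he e' he' p hp => ?_⟩
  -- Near p the coboundary h_p is constant, so the global objects coincide there with a single
  -- realisation moved by one fixed isometry.
  · refine RealizesOn.of_locally e.open_source le_rfl fun p hp => ?_
    obtain ⟨V, hV, hVo, hpV⟩ := eventually_nhds_iff.1 (hloc p p (hmem p))
    have hV' := (hVo.inter (hWo p)).inter e.open_source
    refine ⟨V ∩ W p ∩ e.source, ⟨⟨hpV, hmem p⟩, hp⟩, ?_⟩
    refine ((((hreal p).comp_isometry (T := H p p) (h p p).2).change hM (hch p) he).mono hV'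
      fun q hq => ⟨hq.1.2, hq.2⟩).congr he (fun q hq => ?_) fun q hq x hx => ?_
    · have hqW : q ∈ W p ∩ W q := ⟨hq.1.2, hmem q⟩
      have h1 := (hg p q q hqW).self_of_nhds.1
      have h2 : H p q = H p p := congrArg Subtype.val (hV q hq.1.1)
      beta_reduce
      rw [← h1, hH p q q hqW, map_smul, smul_smul, exp_mul _ (hch p) _ (hch q) _ he q
        ⟨⟨hWs p hq.1.2, hchm q⟩, hq.2⟩, h2]
    · have hqW : q ∈ W p ∩ W q := ⟨hq.1.2, hmem q⟩
      have h1 := (hg p q q hqW).self_of_nhds.2 x hx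
      have h2 : H p q = H p p := congrArg Subtype.val (hV q hq.1.1)
      change H p p (Φl p q x) = H q q (Φl q q x)
      rw [← h1, hH p q q hqW, h2]
  · beta_reduce
    rw [smul_smul, exp_mul _ (hch p) _ he _ he' p ⟨⟨hchm p, hp.1⟩, hp.2⟩]

/-- Existence in the Bonnet theorem. -/
theorem ConformalData.IsIntegrable.exists_isRealizedBy (h𝒟 : 𝒟.IsIntegrable)
    (hM : IsLorentzSurface M) [SimplyConnectedSpace M] (hr : 1 ≤ r) (hn : r + 2 ≤ n) :
    ∃ y : M → ProjLightCone n r, IsTimelikeConformalImmersion y ∧ 𝒟.IsRealizedBy y := by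
  obtain ⟨Y, Φ, hY, hch⟩ := h𝒟.exists_global hM hr hn
  have hc : ∀ p : M, p ∈ (chartAt (ℝ × ℝ) p).source := mem_chart_source _
  have ha : ∀ p : M, chartAt (ℝ × ℝ) p ∈ atlas (ℝ × ℝ) M := chart_mem_atlas _
  -- The point of the light cone is read off in the preferred chart; lifts in other charts differ by
  -- the positive factor e^{-ρ} and give the same point.
  let y : M → ProjLightCone n r := fun p => ⟨Projectivization.mk ℝ (Y (chartAt (ℝ × ℝ) p) p)
    ((hY _ (ha p)).ne_zero p (hc p)), _, _, (hY _ (ha p)).null p (hc p), rfl⟩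
  have hsm : ∀ e ∈ atlas (ℝ × ℝ) M, SmoothOnSurface e.source (Y e) := fun e he =>
    (smoothOnSurface_iff hM e.open_source).2 fun p hp => ⟨e, he, hp, (hY e he).smooth p hp⟩
  have hlift : ∀ e ∈ atlas (ℝ × ℝ) M, IsLiftOn y e.source (Y e) := by
    intro e he p hp
    refine ⟨(hY e he).ne_zero p hp, (Projectivization.mk_eq_mk_iff' ℝ _ _ _ _).2
      ⟨Real.exp (-confFactor (chartAt (ℝ × ℝ) p) e p), ?_⟩⟩
    exact (hch _ (ha p) e he p ⟨hc p, hp⟩).symm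
  refine ⟨y, fun e he p hp => ⟨e.source, e.open_source, hp, le_rfl, Y e, hsm e he, hlift e he,
    fun q hq => ⟨(hY e he).metric_uu q hq, (hY e he).metric_vv q hq, ?_⟩⟩, Y, Φ,
    ⟨hsm, hlift, fun e he => (hY e he).metric_uu, fun e he => (hY e he).metric_vv,
      fun e he => (hY e he).metric_uv, hch⟩,
    ⟨fun e he => (hY e he).map_eq, fun p => (hY _ (ha p)).isometry p (hc p),
      fun U hU σ hσ => (smoothOnSurface_iff hM hU).2 fun p hp => ⟨_, ha p, hc p,
        (hY _ (ha p)).smooth_section (U ∩ (chartAt (ℝ × ℝ) p).source) inter_subset_right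
          (hU.inter (chartAt (ℝ × ℝ) p).open_source) σ (hσ.mono inter_subset_left) p ⟨hp, hc p⟩⟩,
      fun e he U hU hUe => (hY e he).connection_u U hUe hU,
      fun e he U hU hUe => (hY e he).connection_v U hUe hU⟩,
    ⟨fun e he p hp => (hY e he).mem_confNormal hp ((𝒟.isSection_κ₁ e he).2 p hp),
      fun e he p hp => (hY e he).mem_confNormal hp ((𝒟.isSection_κ₂ e he).2 p hp),
      fun e he => (hY e he).eq_uu, fun e he => (hY e he).eq_vv⟩⟩
  rw [(hY e he).metric_uv q hq]
  norm_num

end GlobalExistence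

theorem mainTheorem6 (n r : ℕ) (hr : 1 ≤ r) (hn : r + 2 ≤ n)
    {M : Type*} [TopologicalSpace M] [T2Space M] [SecondCountableTopology M] [ConnectedSpace M]
    [ChartedSpace (ℝ × ℝ) M] (hM : IsLorentzSurface M) :
    -- the line bundles `L₁` and `L₂`
    (IsLineBundleCocycle (M := M) weight₁ ∧ IsLineBundleCocycle (M := M) weight₂) ∧
    -- existence
    (SimplyConnectedSpace M → ∀ 𝒟 : ConformalData M n r, 𝒟.IsIntegrable →
      ∃ y : M → ProjLightCone n r, IsTimelikeConformalImmersion y ∧ 𝒟.IsRealizedBy y) ∧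
    -- uniqueness
    (∀ (y y' : M → ProjLightCone n r),
      IsTimelikeConformalImmersion y → IsTimelikeConformalImmersion y' →
      ∀ (Y Y' κ₁ κ₂ κ₁' κ₂' : Chart M → M → Ambient n) (s₁ s₂ s₁' s₂' : Chart M → M → ℝ),
      IsCanonicalLift y Y → IsCanonicalLift y' Y' →
      HasConformalInvariants r Y κ₁ κ₂ s₁ s₂ → HasConformalInvariants r Y' κ₁' κ₂' s₁' s₂' →
      (∀ e ∈ atlas (ℝ × ℝ) M, ∀ p ∈ e.source, s₁ e p = s₁' e p ∧ s₂ e p = s₂' e p) →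
      ∀ (ε : Fin (n - 2) → ℝ) (ψ ψ' : Fin (n - 2) → M → Ambient n),
      IsNormalFrame r Y ε ψ → IsNormalFrame r Y' ε ψ' →
      ∀ Γu Γv : Chart M → M → Fin (n - 2) → Fin (n - 2) → ℝ,
      HasConnectionCoefficients r Y ψ Γu Γv → HasConnectionCoefficients r Y' ψ' Γu Γv →
      ∀ k₁ k₂ : Chart M → M → Fin (n - 2) → ℝ,
      (∀ e ∈ atlas (ℝ × ℝ) M, ∀ p ∈ e.source,
        κ₁ e p = ∑ α, k₁ e p α • ψ α p ∧ κ₂ e p = ∑ α, k₂ e p α • ψ α p ∧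
        κ₁' e p = ∑ α, k₁ e p α • ψ' α p ∧ κ₂' e p = ∑ α, k₂ e p α • ψ' α p) →
      ∃ T : Ambient n ≃ₗ[ℝ] Ambient n, IsPseudoOrthogonal n r T ∧
        ∀ p, mobiusMap T (y p) = y' p) := by
  refine ⟨⟨isLineBundleCocycle_weight₁ hM, isLineBundleCocycle_weight₂ hM⟩,
    fun _ _ h𝒟 => h𝒟.exists_isRealizedBy hM hr hn, ?_⟩
  intro y y' _ _ Y Y' κ₁ κ₂ κ₁' κ₂' s₁ s₂ s₁' s₂' hY hY' hinv hinv' hs ε ψ ψ' hψ hψ' Γu Γv hΓ hΓ'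
    k₁ k₂ hk
  -- Equality of the Schwarzians is needed only on chart domains, where it replaces those of the
  -- second surface; afterwards both framed surfaces have literally the same coefficients.
  have hinv'' : HasConformalInvariants r Y' κ₁' κ₂' s₁ s₂ :=
    ⟨hinv'.normal_κ₁, hinv'.normal_κ₂,
      fun e he p hp => by rw [hinv'.eq_uu e he p hp, (hs e he p hp).1],
      fun e he p hp => by rw [hinv'.eq_vv e he p hp, (hs e he p hp).2]⟩
  exact exists_mobius_of_invariants_eq (by omega) hY hY'
    (fun e he => hY.isFramedSurface hinv hψ hΓ
      (fun e he p hp => ⟨(hk e he p hp).1, (hk e he p hp).2.1⟩) he)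
    (fun e he => hY'.isFramedSurface hinv'' hψ' hΓ'
      (fun e he p hp => (hk e he p hp).2.2) he)

end
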